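/- Let $\mathbb R^+=(0,\infty)$. There is a universal constant $C>0$ with the following property. Let $u\in L^1_{\rm loc}(\mathbb R^2;\mathbb R^2)$ be a time-independent vector field with $$\|u\|_{L^1_{\rm loc}}:=\sup_{x\in\mathbb R^2}\int_{B_1(x)}|u(y)|\,dy<\infty ,$$ divergence-free in the sense of distributions, i.e. $\int_{\mathbb R^2}u\cdot\nabla\varphi\,dx=0$ for all $\varphi\in C_c^\infty(\mathbb R^2)$. Let $\theta_0\in C^2(\mathbb R^2)\cap W^{4,1}(\mathbb R^2)$, where $C^2(\mathbb R^2)$ is the space of twice continuously differentiable functions with finite norm $\|f\|_{C^2}=\sum_{|\alpha|\le2}\sup|\partial^\alpha f|$, and let $\|\theta_0\|_{C^2\cap W^{4,1}}=\|\theta_0\|_{C^2}+\sum_{|\alpha|\le4}\|\partial^\alpha\theta_0\|_{L^1}$. Then there is a function $\theta\in L^\infty(\mathbb R^+\times\mathbb R^2)$, continuous on $\mathbb R^+\times\mathbb R^2$, which is a distributional solution of the Cauchy problem $\partial_t\theta+u\cdot\nabla\theta-\Delta\theta=0$, $\theta(0,\cdot)=\theta_0$, in the sense that $$\int_{\mathbb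 R^+\times\mathbb R^2}\theta\,(\partial_t\varphi+u\cdot\nabla\varphi+\Delta\varphi)\,dt\,dx=-\int_{\mathbb R^2}\theta_0(x)\varphi(0,x)\,dx\qquad\text{for all }\varphi\in C_c^\infty(\mathbb R\times\mathbb R^2),$$ and which satisfies the following at every time $t>0$: there is a modulus of continuity $\rho_t$ (a continuous non-decreasing function $\rho_t:[0,\infty)\to[0,\infty)$ with $\rho_t(0)=0$) such that $$\rho_t(r)=\frac{C\,(1+\|u\|_{L^1_{\rm loc}})\,\|\theta_0\|_{C^2\cap W^{4,1}}\,(1+t^{-1})}{\sqrt{-\log r}}\qquad\text{for }r\in(0,\tfrac12),$$ and $|\theta(t,x)-\theta(t,y)|\le\rho_t(|x-y|)$ for all $x,y\in\mathbb R^2$. -/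

import Mathlib

open MeasureTheory Set
open scoped ENNReal ContDiff

/-- The Euclidean plane `ℝ²`. -/
abbrev Plane : Type := EuclideanSpace ℝ (Fin 2)

/-- The classical partial derivative `∂ᵢ f`. -/
noncomputable def partialDeriv (i : Fin 2) (f : Plane → ℝ) : Plane → ℝ :=
  fun x => fderiv ℝ f x (EuclideanSpace.single i 1)

/-- The classical derivative `∂^α f` for the multi-index `α = (α₁, α₂)`. -/
noncomputable def multiDeriv (α : ℕ × ℕ) (f : Plane → ℝ) : Plane → ℝ :=
  (partialDeriv 0)^[α.1] ((partialDeriv 1)^[α.2] f)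

/-- The `C²` norm `∑_{|α| ≤ 2} sup |∂^α f|`, with values in `[0, ∞]`. -/
noncomputable def c2Norm (f : Plane → ℝ) : ℝ≥0∞ :=
  ∑ k ∈ Finset.range 3, ∑ α ∈ Finset.HasAntidiagonal.antidiagonal k, ⨆ x, ‖multiDeriv α f x‖ₑ

/-- `f ∈ C²(ℝ²)`: twice continuously differentiable, with finite `C²` norm. -/
def MemC2 (f : Plane → ℝ) : Prop :=
  ContDiff ℝ 2 f ∧ c2Norm f < ⊤

/-- `g` is the weak derivative `∂^α f`. -/
structure IsWeakDeriv (α : ℕ × ℕ) (f g : Plane → ℝ) : Prop where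
  locallyIntegrable_left : LocallyIntegrable f
  locallyIntegrable_right : LocallyIntegrable g
  integral_eq : ∀ φ : Plane → ℝ, ContDiff ℝ ∞ φ → HasCompactSupport φ →
    ∫ x, f x * multiDeriv α φ x = (-1 : ℝ) ^ (α.1 + α.2) * ∫ x, g x * φ x

/-- The `L¹` norm of the weak derivative `∂^α f`. Weak derivatives are unique almost everywhere, so
the infimum is over equal values; it is `∞` if there is no weak derivative `∂^α f`. -/
noncomputable def weakDerivL1Norm (α : ℕ × ℕ) (f : Plane → ℝ) : ℝ≥0∞ :=
  ⨅ (g : Plane → ℝ) (_ : IsWeakDeriv α f g), ∫⁻ x, ‖g x‖ₑ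

/-- The `W^{4,1}` norm `∑_{|α| ≤ 4} ‖∂^α f‖_{L¹}`, with values in `[0, ∞]`. -/
noncomputable def w41Norm (f : Plane → ℝ) : ℝ≥0∞ :=
  ∑ k ∈ Finset.range 5, ∑ α ∈ Finset.HasAntidiagonal.antidiagonal k, weakDerivL1Norm α f

/-- `f ∈ W^{4,1}(ℝ²)`: all weak derivatives of order at most `4` exist and are in `L¹`. -/
def MemW41 (f : Plane → ℝ) : Prop :=
  w41Norm f < ⊤

/-- The norm of `C² ∩ W^{4,1}`. -/
noncomputable def c2w41Norm (f : Plane → ℝ) : ℝ :=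
  (c2Norm f + w41Norm f).toReal

/-- The uniform local `L¹` norm `sup_x ‖u‖_{L¹(B₁(x))}`, with values in `[0, ∞]`. -/
noncomputable def uniformLocL1Norm (u : Plane → Plane) : ℝ≥0∞ :=
  ⨆ x, ∫⁻ y in Metric.ball x 1, ‖u y‖ₑ

/-- `u` is divergence-free in the sense of distributions: `∫ u · ∇φ = 0` for all test functions. -/
def IsDivFree (u : Plane → Plane) : Prop :=
  ∀ φ : Plane → ℝ, ContDiff ℝ ∞ φ → HasCompactSupport φ → ∫ x, fderiv ℝ φ x (u x) = 0

/-- `θ ∈ L^∞((0,∞) × ℝ²)` is a distributional solution of `∂ₜθ + u · ∇θ - Δθ = 0`,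
`θ(0, ·) = θ₀`. The test functions need not vanish at time `0`. -/
structure IsDistributionalSolution (u : Plane → Plane) (θ₀ : Plane → ℝ) (θ : ℝ → Plane → ℝ) :
    Prop where
  memLp_top : MemLp (fun p : ℝ × Plane => θ p.1 p.2) ⊤
    (volume.restrict (Ioi (0 : ℝ) ×ˢ (univ : Set Plane)))
  integral_eq : ∀ φ : ℝ → Plane → ℝ, ContDiff ℝ ∞ (fun p : ℝ × Plane => φ p.1 p.2) →
    HasCompactSupport (fun p : ℝ × Plane => φ p.1 p.2) →
    ∫ p in Ioi (0 : ℝ) ×ˢ (univ : Set Plane),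
        θ p.1 p.2 * (deriv (fun s => φ s p.2) p.1 + fderiv ℝ (φ p.1) p.2 (u p.2)
          + Laplacian.laplacian (φ p.1) p.2)
      = -∫ x, θ₀ x * φ 0 x

/-- A modulus of continuity: a continuous non-decreasing `ρ : [0,∞) → [0,∞)` with `ρ(0) = 0`
(only the values of `ρ` on `[0,∞)` matter, and they are non-negative by monotonicity). -/
structure IsModulusOfContinuity (ρ : ℝ → ℝ) : Prop where
  continuousOn : ContinuousOn ρ (Ici 0)
  monotoneOn : MonotoneOn ρ (Ici 0)
  map_zero : ρ 0 = 0

/-- `θ` satisfies `ρ` at time `t`. -/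
def SatisfiesModulusAt (θ : ℝ → Plane → ℝ) (ρ : ℝ → ℝ) (t : ℝ) : Prop :=
  ∀ x y : Plane, |θ t x - θ t y| ≤ ρ (dist x y)

/-! Formally `θ(t) = e^{tL} θ₀` with `L = Δ - u · ∇`. At a fixed time, `θ(t)` solves the elliptic
equation `L θ = ∂ₜθ`, and three estimates, each using the drift only through its divergence-free
structure and its uniform local `L¹` norm, give a logarithmic modulus.

(1) The right-hand side is bounded. Since `u` does not depend on time, `∂ₜθ(t) = e^{tL} L θ₀`. A
divergence-free drift does not contribute to the energy identity, so the Nash inequality bounds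
`e^{tL}` from `L¹` to `L^∞` by `K / t` with `K` independent of `u`. Moreover `L θ₀` is in `L¹`: on
unit squares `∇θ₀` is bounded by the `L¹` norms of its derivatives up to the mixed second one, and
this is integrated against `u`.

(2) The local Dirichlet energy is bounded. Testing the equation with `η θ` puts the drift into `∫ θ²
u · ∇η`, which is at most a constant times `‖θ‖²_∞` times the local `L¹` norm of `u`.

(3) Lebesgue's lemma. By the maximum principle the oscillation of `θ` inside a square of radius `r`
is at most twice a bound on its boundary, up to an error from the right-hand side. On the boundary
it is controlled by the integral of `|∇θ|`, so its square divided by `r` is at most a multiple of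
the boundary energy. Summing over radii between `r₀` and `√r₀` turns the left side into `osc² · log
(1 / r₀)` and the right side into the energy.

To have all this rigorously, and existence for free, the equation is replaced by a random walk on a
lattice of mesh `1 / N`, killed outside a finite set. Its jump rates are `1 ± flux`, where the flux
is that of the mollified drift through the faces of the cells. By the divergence theorem this flux
is exactly divergence-free, and for fine meshes the rates stay between `1/2` and `3/2`. The solution
is a matrix exponential. The discrete versions of (1), (2), (3) are
`IsLatticeFlux.abs_latticeGenerator_latticeSolution_le` with
`tsum_enorm_latticeGenerator_cellAvg_le`, `IsLatticeFlux.local_energy_le`, and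
`IsLatticeFlux.sq_mul_log_le`.

The bounds are uniform in the mesh, so the lattice solutions are asymptotically equicontinuous at
positive times and a subsequence converges pointwise (`exists_subseq_tendsto_continuousOn`). The
weak form passes to the limit in `integral_eq_of_tendsto_sol`: the adjoint generator acts on the
test function, and the mollified drifts converge in local `L¹`. -/

set_option linter.unusedSectionVars false

/-! ### Sub-Markov matrix semigroups and Nash's decay estimates. -/

section MatrixSemigroup

open Matrix

variable {V : Type*} [Fintype V] [DecidableEq V]

/-- A generator of a semigroup that is a contraction of both `ℓ^∞` and `ℓ^1`. -/
structure IsSubMarkov (M : Matrix V V ℝ) : Prop where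
  off_diag_nonneg : ∀ x y, x ≠ y → 0 ≤ M x y
  row_sum_nonpos : ∀ x, ∑ y, M x y ≤ 0
  col_sum_nonpos : ∀ y, ∑ x, M x y ≤ 0

/-- The Nash inequality for the quadratic form of `-M`. -/
def NashInequality (K : ℝ) (M : Matrix V V ℝ) : Prop :=
  ∀ f : V → ℝ, (∑ x, f x ^ 2) ^ 2 ≤ K * (∑ x, |f x|) ^ 2 * -(∑ x, f x * (M *ᵥ f) x)

/-- The semigroup `exp (t M)`. -/
noncomputable def matrixSemigroup (M : Matrix V V ℝ) (t : ℝ) : Matrix V V ℝ :=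
  NormedSpace.exp (t • M)

theorem IsSubMarkov.transpose {M : Matrix V V ℝ} (h : IsSubMarkov M) : IsSubMarkov Mᵀ where
  off_diag_nonneg x y hxy := h.off_diag_nonneg y x hxy.symm
  row_sum_nonpos := h.col_sum_nonpos
  col_sum_nonpos := h.row_sum_nonpos

/-- A quadratic form only sees the symmetric part of the matrix. The adjoint semigroup therefore
decays at the same rate, which the duality argument in `IsSubMarkov.matrixSemigroup_apply_le` needs.
-/
theorem NashInequality.transpose {K : ℝ} {M : Matrix V V ℝ} (h : NashInequality K M) :
    NashInequality K Mᵀ := by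
  intro f
  have : ∑ x, f x * (Mᵀ *ᵥ f) x = ∑ x, f x * (M *ᵥ f) x := by
    change f ⬝ᵥ (Mᵀ *ᵥ f) = f ⬝ᵥ (M *ᵥ f)
    rw [Matrix.mulVec_transpose, dotProduct_comm, ← Matrix.dotProduct_mulVec]
  rw [this]
  exact h f

theorem matrixSemigroup_zero (M : Matrix V V ℝ) : matrixSemigroup M 0 = 1 := by
  simp [matrixSemigroup]

theorem matrixSemigroup_add (M : Matrix V V ℝ) (s t : ℝ) :
    matrixSemigroup M (s + t) = matrixSemigroup M s * matrixSemigroup M t := by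
  unfold matrixSemigroup
  rw [add_smul]
  exact Matrix.exp_add_of_commute _ _ (((Commute.refl M).smul_left s).smul_right t)

theorem matrixSemigroup_transpose (M : Matrix V V ℝ) (t : ℝ) :
    matrixSemigroup Mᵀ t = (matrixSemigroup M t)ᵀ := by
  unfold matrixSemigroup
  rw [← Matrix.exp_transpose, Matrix.transpose_smul]

theorem matrixSemigroup_commute (M : Matrix V V ℝ) (t : ℝ) :
    M * matrixSemigroup M t = matrixSemigroup M t * M := by
  unfold matrixSemigroup
  exact (((Commute.refl M).smul_right t).exp_right).eq

theorem hasDerivAt_matrixSemigroup_apply (M : Matrix V V ℝ) (t : ℝ) (x y : V) :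
    HasDerivAt (fun s => matrixSemigroup M s x y) ((M * matrixSemigroup M t) x y) t := by
  let _ : NormedRing (Matrix V V ℝ) := Matrix.linftyOpNormedRing
  let _ : NormedAlgebra ℝ (Matrix V V ℝ) := Matrix.linftyOpNormedAlgebra
  have h : HasDerivAt (fun s : ℝ => NormedSpace.exp (s • M)) (M * NormedSpace.exp (t • M)) t :=
    hasDerivAt_exp_smul_const' M t
  let e : Matrix V V ℝ →ₗ[ℝ] ℝ := Matrix.entryLinearMap ℝ ℝ x y
  exact (e.toContinuousLinearMap.hasFDerivAt).comp_hasDerivAt t h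

theorem hasDerivAt_matrixSemigroup_mulVec (M : Matrix V V ℝ) (f : V → ℝ) (t : ℝ) (x : V) :
    HasDerivAt (fun s => (matrixSemigroup M s *ᵥ f) x)
      ((M *ᵥ (matrixSemigroup M t *ᵥ f)) x) t := by
  rw [Matrix.mulVec_mulVec]
  unfold Matrix.mulVec dotProduct
  exact HasDerivAt.fun_sum fun y _ => (hasDerivAt_matrixSemigroup_apply M t x y).mul_const (f y)

theorem exp_apply_nonneg {A : Matrix V V ℝ} (hA : ∀ x y, 0 ≤ A x y) (x y : V) :
    0 ≤ (NormedSpace.exp A : Matrix V V ℝ) x y := by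
  let _ : NormedRing (Matrix V V ℝ) := Matrix.linftyOpNormedRing
  let _ : NormedAlgebra ℝ (Matrix V V ℝ) := Matrix.linftyOpNormedAlgebra
  have hpow : ∀ n : ℕ, ∀ x y, 0 ≤ (A ^ n) x y := by
    intro n
    induction n with
    | zero =>
      intro x y
      rw [pow_zero, Matrix.one_apply]
      split_ifs <;> norm_num
    | succ n ih =>
      intro x y
      rw [pow_succ, Matrix.mul_apply]
      exact Finset.sum_nonneg fun z _ => mul_nonneg (ih x z) (hA z y)
  have h := NormedSpace.exp_series_hasSum_exp' (𝕂 := ℝ) A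
  let e : Matrix V V ℝ →ₗ[ℝ] ℝ := Matrix.entryLinearMap ℝ ℝ x y
  have h2 := e.toContinuousLinearMap.hasSum h
  refine h2.nonneg fun n => ?_
  change 0 ≤ ((((n.factorial : ℝ)⁻¹) • A ^ n : Matrix V V ℝ)) x y
  rw [Matrix.smul_apply, smul_eq_mul]
  exact mul_nonneg (by positivity) (hpow n x y)

/-- Adding a large multiple of the identity makes every entry of the matrix nonnegative, and changes
the exponential only by a positive scalar factor. -/
theorem IsSubMarkov.matrixSemigroup_nonneg {M : Matrix V V ℝ} (h : IsSubMarkov M) {t : ℝ}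
    (ht : 0 ≤ t) (x y : V) : 0 ≤ matrixSemigroup M t x y := by
  obtain ⟨κ, hκ⟩ : ∃ κ : ℝ, ∀ x, -M x x ≤ κ := by
    obtain ⟨κ, hκ⟩ := (Set.finite_range fun x => -M x x).bddAbove
    exact ⟨κ, fun x => hκ ⟨x, rfl⟩⟩
  have h1 : t • M = (-(t * κ)) • (1 : Matrix V V ℝ) + t • (M + κ • (1 : Matrix V V ℝ)) := by
    module
  have h2 : matrixSemigroup M t = Real.exp (-(t * κ)) •
      NormedSpace.exp (t • (M + κ • (1 : Matrix V V ℝ))) := by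
    unfold matrixSemigroup
    rw [h1, Matrix.exp_add_of_commute _ _ ((Commute.one_left _).smul_left _)]
    have : NormedSpace.exp ((-(t * κ)) • (1 : Matrix V V ℝ)) =
        Real.exp (-(t * κ)) • (1 : Matrix V V ℝ) := by
      rw [Matrix.smul_one_eq_diagonal, Matrix.exp_diagonal, Matrix.smul_one_eq_diagonal]
      congr 1
      funext i
      rw [Pi.coe_exp, Real.exp_eq_exp_ℝ]
    rw [this, smul_mul_assoc, one_mul]
  rw [h2, Matrix.smul_apply, smul_eq_mul]
  refine mul_nonneg (Real.exp_pos _).le (exp_apply_nonneg (fun x y => ?_) x y)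
  rw [Matrix.smul_apply, smul_eq_mul]
  refine mul_nonneg ht ?_
  rw [Matrix.add_apply, Matrix.smul_apply, smul_eq_mul, Matrix.one_apply]
  by_cases hxy : x = y
  · subst hxy
    simp only [if_true]
    linarith [hκ x]
  · simp only [hxy, if_false, mul_zero, add_zero]
    exact h.off_diag_nonneg x y hxy

/-- The time derivative of a row sum is an average, with the nonnegative weights `matrixSemigroup M
s x z`, of the row sums of `M`, hence nonpositive; at time `0` the row sum is `1`. -/
theorem IsSubMarkov.matrixSemigroup_row_sum {M : Matrix V V ℝ} (h : IsSubMarkov M) {t : ℝ}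
    (ht : 0 ≤ t) (x : V) : ∑ y, matrixSemigroup M t x y ≤ 1 := by
  have hd : ∀ s, HasDerivAt (fun s => ∑ y, matrixSemigroup M s x y)
      (∑ y, (matrixSemigroup M s * M) x y) s := fun s => by
    rw [← matrixSemigroup_commute]
    exact HasDerivAt.fun_sum fun y _ => hasDerivAt_matrixSemigroup_apply M s x y
  have hanti : AntitoneOn (fun s => ∑ y, matrixSemigroup M s x y) (Ici 0) := by
    refine antitoneOn_of_deriv_nonpos (convex_Ici 0)
      (fun s _ => (hd s).continuousAt.continuousWithinAt)
      (fun s _ => (hd s).differentiableAt.differentiableWithinAt) fun s hs => ?_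
    rw [interior_Ici] at hs
    rw [(hd s).deriv]
    simp_rw [Matrix.mul_apply]
    rw [Finset.sum_comm]
    refine Finset.sum_nonpos fun z _ => ?_
    rw [← Finset.mul_sum]
    exact mul_nonpos_of_nonneg_of_nonpos (h.matrixSemigroup_nonneg (le_of_lt hs) x z)
      (h.row_sum_nonpos z)
  have h0 := hanti (mem_Ici.2 le_rfl) (mem_Ici.2 ht) ht
  refine h0.trans ?_
  simp [matrixSemigroup_zero, Matrix.one_apply]

theorem IsSubMarkov.abs_mulVec_le {M : Matrix V V ℝ} (h : IsSubMarkov M) {t : ℝ} (ht : 0 ≤ t)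
    {f : V → ℝ} {A : ℝ} (hf : ∀ x, |f x| ≤ A) (hA : 0 ≤ A) (x : V) :
    |(matrixSemigroup M t *ᵥ f) x| ≤ A := by
  unfold Matrix.mulVec dotProduct
  calc |∑ y, matrixSemigroup M t x y * f y| ≤ ∑ y, |matrixSemigroup M t x y * f y| :=
        Finset.abs_sum_le_sum_abs _ _
    _ ≤ ∑ y, matrixSemigroup M t x y * A := by
        refine Finset.sum_le_sum fun y _ => ?_
        rw [abs_mul, abs_of_nonneg (h.matrixSemigroup_nonneg ht x y)]
        exact mul_le_mul_of_nonneg_left (hf y) (h.matrixSemigroup_nonneg ht x y)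
    _ = (∑ y, matrixSemigroup M t x y) * A := by rw [Finset.sum_mul]
    _ ≤ 1 * A := mul_le_mul_of_nonneg_right (h.matrixSemigroup_row_sum ht x) hA
    _ = A := one_mul A

theorem IsSubMarkov.sum_abs_mulVec_le {M : Matrix V V ℝ} (h : IsSubMarkov M) {t : ℝ} (ht : 0 ≤ t)
    (f : V → ℝ) : ∑ x, |(matrixSemigroup M t *ᵥ f) x| ≤ ∑ x, |f x| := by
  unfold Matrix.mulVec dotProduct
  calc ∑ x, |∑ y, matrixSemigroup M t x y * f y|
      ≤ ∑ x, ∑ y, matrixSemigroup M t x y * |f y| := by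
        refine Finset.sum_le_sum fun x _ => (Finset.abs_sum_le_sum_abs _ _).trans ?_
        refine Finset.sum_le_sum fun y _ => ?_
        rw [abs_mul, abs_of_nonneg (h.matrixSemigroup_nonneg ht x y)]
    _ = ∑ y, (∑ x, matrixSemigroup M t x y) * |f y| := by
        rw [Finset.sum_comm]
        simp_rw [Finset.sum_mul]
    _ ≤ ∑ y, 1 * |f y| := by
        refine Finset.sum_le_sum fun y _ => mul_le_mul_of_nonneg_right ?_ (abs_nonneg _)
        have := h.transpose.matrixSemigroup_row_sum ht y
        rw [matrixSemigroup_transpose] at this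
        simpa using this
    _ = ∑ x, |f x| := by simp

/-- Nash's decay estimate from `ℓ¹` to `ℓ²`. -/
theorem IsSubMarkov.sum_sq_mulVec_le {M : Matrix V V ℝ} (h : IsSubMarkov M) {K : ℝ} (hK : 0 < K)
    (hN : NashInequality K M) {t : ℝ} (ht : 0 < t) (f : V → ℝ) :
    ∑ x, (matrixSemigroup M t *ᵥ f) x ^ 2 ≤ K * (∑ x, |f x|) ^ 2 / (2 * t) := by
  set B := ∑ x, |f x| with hB
  have hB0 : 0 ≤ B := Finset.sum_nonneg fun _ _ => abs_nonneg _
  set Y : ℝ → ℝ := fun s => ∑ x, (matrixSemigroup M s *ᵥ f) x ^ 2 with hY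
  have hd : ∀ s, HasDerivAt Y (2 * ∑ x, (matrixSemigroup M s *ᵥ f) x *
      (M *ᵥ (matrixSemigroup M s *ᵥ f)) x) s := fun s => by
    have : HasDerivAt Y (∑ x, 2 * (matrixSemigroup M s *ᵥ f) x ^ 1 *
      (M *ᵥ (matrixSemigroup M s *ᵥ f)) x) s :=
      HasDerivAt.fun_sum fun x _ => (hasDerivAt_matrixSemigroup_mulVec M f s x).pow 2
    convert this using 1
    rw [Finset.mul_sum]
    exact Finset.sum_congr rfl fun x _ => by ring
  have hineq : ∀ s, 0 ≤ s → Y s ^ 2 ≤ K * B ^ 2 * -(∑ x, (matrixSemigroup M s *ᵥ f) x *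
      (M *ᵥ (matrixSemigroup M s *ᵥ f)) x) := fun s hs => by
    have h1 := hN (matrixSemigroup M s *ᵥ f)
    have h2 := h.sum_abs_mulVec_le hs f
    have h3 : 0 ≤ ∑ x, |(matrixSemigroup M s *ᵥ f) x| := Finset.sum_nonneg fun _ _ => abs_nonneg _
    set S1 := ∑ x, |(matrixSemigroup M s *ᵥ f) x|
    set E := -(∑ x, (matrixSemigroup M s *ᵥ f) x * (M *ᵥ (matrixSemigroup M s *ᵥ f)) x)
    -- Replacing the `ℓ¹` norm at time `s` by the larger initial one requires `E ≥ 0`. For a nonzero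
    -- vector this follows from the Nash inequality itself; for the zero vector both sides vanish.
    rcases h3.eq_or_lt with h0 | h0
    · have hz : ∀ x, (matrixSemigroup M s *ᵥ f) x = 0 := fun x => by
        have := (Finset.sum_eq_zero_iff_of_nonneg (fun x _ => abs_nonneg _)).1 h0.symm x
          (Finset.mem_univ x)
        exact abs_eq_zero.1 this
      have hE0 : E = 0 := by simp [E, hz]
      have hY0 : Y s = 0 := by simp [hY, hz]
      rw [hE0, hY0]; simp
    · have hE : 0 ≤ E := by
        by_contra hc
        push Not at hc
        have : K * S1 ^ 2 * E < 0 := mul_neg_of_pos_of_neg (by positivity) hc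
        have := h1.trans_lt this
        have hp : 0 ≤ (∑ x, (matrixSemigroup M s *ᵥ f) x ^ 2) ^ 2 := sq_nonneg _
        linarith
      refine h1.trans (mul_le_mul_of_nonneg_right ?_ hE)
      gcongr
  have hYt : 0 ≤ Y t := Finset.sum_nonneg fun x _ => sq_nonneg _
  rcases hYt.eq_or_lt with h0 | hpos
  · change Y t ≤ _
    rw [← h0]; positivity
  rcases hB0.eq_or_lt with hB00 | hBpos
  · have := hineq t ht.le
    rw [← hB00] at this
    simp at this
    exact absurd this hpos.ne'
  have hanti : AntitoneOn Y (Ici 0) := by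
    refine antitoneOn_of_deriv_nonpos (convex_Ici 0)
      (fun s _ => (hd s).continuousAt.continuousWithinAt)
      (fun s _ => (hd s).differentiableAt.differentiableWithinAt) fun s hs => ?_
    rw [interior_Ici] at hs
    rw [(hd s).deriv]
    have h1 := hineq s (le_of_lt hs)
    have h2 : 0 ≤ -(∑ x, (matrixSemigroup M s *ᵥ f) x *
      (M *ᵥ (matrixSemigroup M s *ᵥ f)) x) :=
      nonneg_of_mul_nonneg_right ((sq_nonneg _).trans h1) (by positivity)
    linarith
  have hYpos : ∀ s ∈ Icc 0 t, 0 < Y s := fun s hs =>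
    hpos.trans_le (hanti (mem_Ici.2 hs.1) (mem_Ici.2 ht.le) hs.2)
  -- Nash's argument: `Y' ≤ -(2 / (K B²)) Y²`, so the reciprocal `1 / Y` grows at least linearly
  -- with slope `2 / (K B²)`, whatever its initial value.
  have hmono : MonotoneOn (fun s => (Y s)⁻¹ - 2 / (K * B ^ 2) * s) (Icc 0 t) := by
    have hd2 : ∀ s ∈ Icc 0 t, HasDerivAt (fun s => (Y s)⁻¹ - 2 / (K * B ^ 2) * s)
        (-(2 * ∑ x, (matrixSemigroup M s *ᵥ f) x * (M *ᵥ (matrixSemigroup M s *ᵥ f)) x) / Y s ^ 2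
          - 2 / (K * B ^ 2) * 1) s := fun s hs =>
      ((hd s).inv (hYpos s hs).ne').sub ((hasDerivAt_id s).const_mul _)
    refine monotoneOn_of_deriv_nonneg (convex_Icc 0 t)
      (fun s hs => (hd2 s hs).continuousAt.continuousWithinAt)
      (fun s hs => (hd2 s (interior_subset hs)).differentiableAt.differentiableWithinAt)
      fun s hs => ?_
    have hs' := interior_subset hs
    rw [(hd2 s hs').deriv]
    have h1 := hineq s hs'.1
    have h2 := hYpos s hs'
    rw [sub_nonneg, mul_one, div_le_div_iff₀ (by positivity) (by positivity)]
    linarith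
  have h1 := hmono (left_mem_Icc.2 ht.le) (right_mem_Icc.2 ht.le) ht.le
  have h2 : 0 < (Y 0)⁻¹ := inv_pos.2 (hYpos 0 (left_mem_Icc.2 ht.le))
  have h3 : 2 / (K * B ^ 2) * t ≤ (Y t)⁻¹ := by simp only [mul_zero, sub_zero] at h1; linarith
  have h4 : 0 < 2 / (K * B ^ 2) * t := by positivity
  have h5 := inv_anti₀ h4 h3
  rw [inv_inv] at h5
  refine h5.trans (le_of_eq ?_)
  field_simp

/-- By the semigroup property the kernel at time `t` is the product of a row and a column of the
kernel at time `t / 2`. The `ℓ¹` to `ℓ²` estimate for point masses bounds the squared norms of both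
by `K / t`, the row being a column of the transposed semigroup, and Cauchy–Schwarz concludes. -/
theorem IsSubMarkov.matrixSemigroup_apply_le {M : Matrix V V ℝ} (h : IsSubMarkov M) {K : ℝ}
    (hK : 0 < K) (hN : NashInequality K M) {t : ℝ} (ht : 0 < t) (x y : V) :
    matrixSemigroup M t x y ≤ K / t := by
  have key : ∀ {M : Matrix V V ℝ}, IsSubMarkov M → NashInequality K M → ∀ y,
      ∑ z, matrixSemigroup M (t / 2) z y ^ 2 ≤ K / t := by
    intro M h hN y
    have h1 := h.sum_sq_mulVec_le hK hN (half_pos ht) (Pi.single y 1)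
    have h2 : ∑ x, |(Pi.single y 1 : V → ℝ) x| = 1 := by
      rw [Finset.sum_eq_single y] <;> simp +contextual
    rw [h2] at h1
    simp only [Matrix.mulVec_single_one, one_pow, mul_one] at h1
    rwa [mul_div_cancel₀ t two_ne_zero] at h1
  have h1 := key h hN y
  have h2 := key h.transpose hN.transpose x
  rw [matrixSemigroup_transpose] at h2
  simp only [Matrix.transpose_apply] at h2
  have h3 : matrixSemigroup M t x y =
      ∑ z, matrixSemigroup M (t / 2) x z * matrixSemigroup M (t / 2) z y := by
    rw [← Matrix.mul_apply, ← matrixSemigroup_add, add_halves]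
  have h4 := Finset.sum_mul_sq_le_sq_mul_sq Finset.univ
    (fun z => matrixSemigroup M (t / 2) x z) (fun z => matrixSemigroup M (t / 2) z y)
  rw [← h3] at h4
  have h5 : matrixSemigroup M t x y ^ 2 ≤ (K / t) ^ 2 := by
    rw [sq (K / t)]
    exact h4.trans (mul_le_mul h2 h1 (Finset.sum_nonneg fun _ _ => sq_nonneg _) (by positivity))
  exact le_of_sq_le_sq h5 (by positivity)

/-- Nash's decay estimate from `ℓ¹` to `ℓ^∞`. -/
theorem IsSubMarkov.abs_mulVec_le_div {M : Matrix V V ℝ} (h : IsSubMarkov M) {K : ℝ}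
    (hK : 0 < K) (hN : NashInequality K M) {t : ℝ} (ht : 0 < t) (f : V → ℝ) (x : V) :
    |(matrixSemigroup M t *ᵥ f) x| ≤ K / t * ∑ y, |f y| := by
  unfold Matrix.mulVec dotProduct
  rw [Finset.mul_sum]
  refine (Finset.abs_sum_le_sum_abs _ _).trans (Finset.sum_le_sum fun y _ => ?_)
  rw [abs_mul, abs_of_nonneg (h.matrixSemigroup_nonneg ht.le x y)]
  exact mul_le_mul_of_nonneg_right (h.matrixSemigroup_apply_le hK hN ht x y) (abs_nonneg _)

/-- A maximum principle: subsolutions of `M v = -F` are bounded in terms of the number of points. -/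
theorem IsSubMarkov.le_of_neg_le_mulVec {M : Matrix V V ℝ} (h : IsSubMarkov M) {K : ℝ}
    (hK : 0 < K) (hN : NashInequality K M) {v : V → ℝ} {F : ℝ} (hF : 0 ≤ F)
    (hv : ∀ x, -F ≤ (M *ᵥ v) x) (x : V) : v x ≤ 4 * K * Fintype.card V * F := by
  have : Nonempty V := ⟨x⟩
  have hcard : (0 : ℝ) < Fintype.card V := by exact_mod_cast Fintype.card_pos
  -- At this time each kernel entry is at most `K / T = 1 / (2 card V)`, so at most half of the mass
  -- started anywhere survives.
  set T : ℝ := 2 * K * Fintype.card V with hT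
  have hTpos : 0 < T := by positivity
  -- Duhamel's formula as an inequality: the derivative of the evolved `v` is the evolved `M v`,
  -- which is at least `-F` because row sums are at most `1`. At a positive maximum `z` this gives
  -- `v z ≤ v z / 2 + F T`.
  have hstep : ∀ x, v x ≤ (matrixSemigroup M T *ᵥ v) x + F * T := by
    intro x
    have hd : ∀ s, HasDerivAt (fun s => (matrixSemigroup M s *ᵥ v) x + F * s)
        ((M *ᵥ (matrixSemigroup M s *ᵥ v)) x + F * 1) s := fun s =>
      (hasDerivAt_matrixSemigroup_mulVec M v s x).add ((hasDerivAt_id s).const_mul F)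
    have hmono : MonotoneOn (fun s => (matrixSemigroup M s *ᵥ v) x + F * s) (Ici 0) := by
      refine monotoneOn_of_deriv_nonneg (convex_Ici 0)
        (fun s _ => (hd s).continuousAt.continuousWithinAt)
        (fun s _ => (hd s).differentiableAt.differentiableWithinAt) fun s hs => ?_
      rw [interior_Ici] at hs
      have hs0 : 0 ≤ s := le_of_lt hs
      rw [(hd s).deriv, Matrix.mulVec_mulVec, matrixSemigroup_commute, ← Matrix.mulVec_mulVec]
      have h1 : ∑ y, matrixSemigroup M s x y * (-F) ≤
          (matrixSemigroup M s *ᵥ (M *ᵥ v)) x :=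
        Finset.sum_le_sum fun y _ =>
          mul_le_mul_of_nonneg_left (hv y) (h.matrixSemigroup_nonneg hs0 x y)
      rw [← Finset.sum_mul] at h1
      have h2 := mul_le_mul_of_nonneg_right (h.matrixSemigroup_row_sum hs0 x) hF
      linarith
    have h0 := hmono (mem_Ici.2 le_rfl) (mem_Ici.2 hTpos.le) hTpos.le
    simpa [matrixSemigroup_zero] using h0
  obtain ⟨z, -, hz⟩ := Finset.exists_max_image Finset.univ v Finset.univ_nonempty
  rcases le_or_gt (v z) 0 with hz0 | hz0
  · exact (hz x (Finset.mem_univ x)).trans (hz0.trans (by positivity))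
  have h1 : (matrixSemigroup M T *ᵥ v) z ≤ v z / 2 := by
    calc (matrixSemigroup M T *ᵥ v) z ≤ ∑ y : V, 1 / (2 * Fintype.card V) * v z := by
          refine Finset.sum_le_sum fun y _ => ?_
          have h2 := h.matrixSemigroup_apply_le hK hN hTpos z y
          have h3 := h.matrixSemigroup_nonneg hTpos.le z y
          have h4 : K / T = 1 / (2 * Fintype.card V) := by rw [hT]; field_simp
          rw [h4] at h2
          exact (mul_le_mul_of_nonneg_left (hz y (Finset.mem_univ y)) h3).trans
            (mul_le_mul_of_nonneg_right h2 hz0.le)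
      _ = v z / 2 := by
          rw [Finset.sum_const, Finset.card_univ, nsmul_eq_mul]
          field_simp
  have h2 := hstep z
  have h3 := hz x (Finset.mem_univ x)
  have h4 : F * T * 2 = 4 * K * Fintype.card V * F := by rw [hT]; ring
  linarith

end MatrixSemigroup

/-! ### Lattice random walks with divergence-free drift and the discrete Nash inequality. -/

section LatticeGenerator

open Function

/-- The horizontal unit step in the lattice `ℤ²`. -/
abbrev dirX : ℤ × ℤ := (1, 0)

/-- The vertical unit step in the lattice `ℤ²`. -/
abbrev dirY : ℤ × ℤ := (0, 1)

/-- The generator of a lattice random walk whose drift has flux `p` through the left edge and `q`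
through the lower edge of each cell. -/
def latticeGenerator (p q f : ℤ × ℤ → ℝ) (x : ℤ × ℤ) : ℝ :=
  (1 - p (x + dirX)) * (f (x + dirX) - f x) + (1 + p x) * (f (x - dirX) - f x) +
    (1 - q (x + dirY)) * (f (x + dirY) - f x) + (1 + q x) * (f (x - dirY) - f x)

/-- The carré du champ of `latticeGenerator`. -/
def carreDuChamp (p q f : ℤ × ℤ → ℝ) (x : ℤ × ℤ) : ℝ :=
  (1 - p (x + dirX)) * (f (x + dirX) - f x) ^ 2 + (1 + p x) * (f (x - dirX) - f x) ^ 2 +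
    (1 - q (x + dirY)) * (f (x + dirY) - f x) ^ 2 + (1 + q x) * (f (x - dirY) - f x) ^ 2

/-- A discretely divergence-free flux, small enough for the maximum principle. -/
structure IsLatticeFlux (p q : ℤ × ℤ → ℝ) : Prop where
  div_free : ∀ x, p (x + dirX) - p x + (q (x + dirY) - q x) = 0
  abs_left_le : ∀ x, |p x| ≤ 1 / 2
  abs_right_le : ∀ x, |q x| ≤ 1 / 2

variable {p q f g : ℤ × ℤ → ℝ}

theorem IsLatticeFlux.neg (h : IsLatticeFlux p q) : IsLatticeFlux (-p) (-q) where
  div_free x := by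
    have := h.div_free x
    simp only [Pi.neg_apply]
    linarith
  abs_left_le x := by simpa using h.abs_left_le x
  abs_right_le x := by simpa using h.abs_right_le x

@[fun_prop]
theorem hasFiniteSupport_abs (hf : f.HasFiniteSupport) : HasFiniteSupport fun x => |f x| :=
  hf.fun_comp abs_zero

@[fun_prop]
theorem hasFiniteSupport_sq (hf : f.HasFiniteSupport) : HasFiniteSupport fun x => f x ^ 2 :=
  hf.fun_comp (g := fun a => a ^ 2) (by norm_num)

@[fun_prop]
theorem hasFiniteSupport_latticeGenerator (hf : f.HasFiniteSupport) :
    HasFiniteSupport (latticeGenerator p q f) := by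
  unfold latticeGenerator
  fun_prop (disch := first | exact add_left_injective _ | exact sub_left_injective)

theorem tsum_comp_add (f : ℤ × ℤ → ℝ) (e : ℤ × ℤ) : ∑' x, f (x + e) = ∑' x, f x :=
  (Equiv.addRight e).tsum_eq f

theorem tsum_comp_sub (f : ℤ × ℤ → ℝ) (e : ℤ × ℤ) : ∑' x, f (x - e) = ∑' x, f x :=
  (Equiv.subRight e).tsum_eq f

theorem tsum_add_sub_self (hf : f.HasFiniteSupport) (e : ℤ × ℤ) :
    ∑' x, (f (x + e) - f x) = 0 := by
  rw [Summable.tsum_sub (summable_of_hasFiniteSupport (by fun_prop (disch := first | exact add_left_injective _ | exact sub_left_injective)))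
    (summable_of_hasFiniteSupport hf), tsum_comp_add, sub_self]

/-- Summation by parts. The two summands differ by the discrete divergence of the finitely supported
field `(A, B)`, which sums to zero, and by `2 f g` times the divergence of the flux `(p, q)`, which
vanishes. -/
theorem tsum_mul_latticeGenerator (h : IsLatticeFlux p q) (hf : f.HasFiniteSupport) :
    ∑' x, g x * latticeGenerator p q f x = ∑' x, f x * latticeGenerator (-p) (-q) g x := by
  set A : ℤ × ℤ → ℝ := fun x => (g (x - dirX) * f x - f (x - dirX) * g x) -
    p x * (g (x - dirX) * f x + f (x - dirX) * g x) with hA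
  set B : ℤ × ℤ → ℝ := fun x => (g (x - dirY) * f x - f (x - dirY) * g x) -
    q x * (g (x - dirY) * f x + f (x - dirY) * g x) with hB
  have hAf : A.HasFiniteSupport := by
    rw [hA]; fun_prop (disch := first | exact add_left_injective _ | exact sub_left_injective)
  have hBf : B.HasFiniteSupport := by
    rw [hB]; fun_prop (disch := first | exact add_left_injective _ | exact sub_left_injective)
  have key : ∀ x, g x * latticeGenerator p q f x = f x * latticeGenerator (-p) (-q) g x +
      ((A (x + dirX) - A x) + (B (x + dirY) - B x)) := by
    intro x
    simp only [hA, hB, latticeGenerator, add_sub_cancel_right, Pi.neg_apply]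
    linear_combination (2 * f x * g x) * h.div_free x
  simp_rw [key]
  rw [Summable.tsum_add, Summable.tsum_add, tsum_add_sub_self hAf, tsum_add_sub_self hBf,
    add_zero, add_zero]
  all_goals exact summable_of_hasFiniteSupport (by fun_prop (disch := first | exact add_left_injective _ | exact sub_left_injective))

theorem latticeGenerator_sq (p q f : ℤ × ℤ → ℝ) (x : ℤ × ℤ) :
    latticeGenerator p q (fun y => f y ^ 2) x =
      2 * (f x * latticeGenerator p q f x) + carreDuChamp p q f x := by
  unfold latticeGenerator carreDuChamp
  ring

/-- Every jump rate is at least `1/2`, so the drift cannot destroy ellipticity. -/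
theorem IsLatticeFlux.carreDuChamp_ge (h : IsLatticeFlux p q) (f : ℤ × ℤ → ℝ) (x : ℤ × ℤ) :
    1 / 2 * ((f (x + dirX) - f x) ^ 2 + (f (x - dirX) - f x) ^ 2 +
      (f (x + dirY) - f x) ^ 2 + (f (x - dirY) - f x) ^ 2) ≤ carreDuChamp p q f x := by
  unfold carreDuChamp
  have h1 := abs_le.1 (h.abs_left_le x)
  have h2 := abs_le.1 (h.abs_left_le (x + dirX))
  have h3 := abs_le.1 (h.abs_right_le x)
  have h4 := abs_le.1 (h.abs_right_le (x + dirY))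
  have k1 := mul_le_mul_of_nonneg_right (show 1 / 2 ≤ 1 - p (x + dirX) by linarith)
    (sq_nonneg (f (x + dirX) - f x))
  have k2 := mul_le_mul_of_nonneg_right (show 1 / 2 ≤ 1 + p x by linarith)
    (sq_nonneg (f (x - dirX) - f x))
  have k3 := mul_le_mul_of_nonneg_right (show 1 / 2 ≤ 1 - q (x + dirY) by linarith)
    (sq_nonneg (f (x + dirY) - f x))
  have k4 := mul_le_mul_of_nonneg_right (show 1 / 2 ≤ 1 + q x by linarith)
    (sq_nonneg (f (x - dirY) - f x))
  linarith

/-- The Dirichlet form controls the discrete gradient. -/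
theorem IsLatticeFlux.energy_le (h : IsLatticeFlux p q) (hf : f.HasFiniteSupport) :
    ∑' x, (f (x + dirX) - f x) ^ 2 + ∑' x, (f (x + dirY) - f x) ^ 2 ≤
      2 * -∑' x, f x * latticeGenerator p q f x := by
  -- The adjoint generator kills constants, so the generator of any finitely supported function has
  -- total sum zero. Applied to `f²` this is the energy identity, free of the drift.
  have h0 : ∑' x, latticeGenerator p q (fun y => f y ^ 2) x = 0 := by
    have := tsum_mul_latticeGenerator (g := fun _ => 1) h
      (f := fun y => f y ^ 2) (by fun_prop (disch := first | exact add_left_injective _ | exact sub_left_injective))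
    simp only [one_mul] at this
    rw [this]
    simp [latticeGenerator]
  have hΓ : HasFiniteSupport (carreDuChamp p q f) := by
    unfold carreDuChamp
    fun_prop (disch := first | exact add_left_injective _ | exact sub_left_injective)
  simp_rw [latticeGenerator_sq] at h0
  rw [Summable.tsum_add (summable_of_hasFiniteSupport (by fun_prop (disch := first | exact add_left_injective _ | exact sub_left_injective)))
    (summable_of_hasFiniteSupport hΓ), tsum_mul_left] at h0
  have h1 : ∑' x, 1 / 2 * ((f (x + dirX) - f x) ^ 2 + (f (x - dirX) - f x) ^ 2 +
      (f (x + dirY) - f x) ^ 2 + (f (x - dirY) - f x) ^ 2) ≤ ∑' x, carreDuChamp p q f x :=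
    Summable.tsum_le_tsum (h.carreDuChamp_ge f)
      (summable_of_hasFiniteSupport (by fun_prop (disch := first | exact add_left_injective _ | exact sub_left_injective))) (summable_of_hasFiniteSupport hΓ)
  have hshift : ∀ e : ℤ × ℤ, ∑' x, (f (x - e) - f x) ^ 2 = ∑' x, (f (x + e) - f x) ^ 2 := by
    intro e
    rw [← tsum_comp_sub (fun x => (f (x + e) - f x) ^ 2) e]
    refine tsum_congr fun x => ?_
    rw [sub_add_cancel]
    ring
  rw [tsum_mul_left, Summable.tsum_add, Summable.tsum_add, Summable.tsum_add, hshift,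
    hshift] at h1
  · linarith
  all_goals exact summable_of_hasFiniteSupport (by fun_prop (disch := first | exact add_left_injective _ | exact sub_left_injective))

theorem enorm_le_tsum_enorm_sub {g : ℤ → ℝ} (hg : g.HasFiniteSupport) (i : ℤ) :
    ‖g i‖ₑ ≤ ∑' k, ‖g (k + 1) - g k‖ₑ := by
  -- A point to the left of `i` where `g` vanishes; telescoping from there gives the bound.
  obtain ⟨m, hm, hm0⟩ := (Set.Iio_infinite i).exists_notMem_finite hg
  have hm0 : g m = 0 := by simpa using hm0
  have key : ∀ n : ℕ, ‖g (m + n)‖ₑ ≤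
      ∑ l ∈ Finset.range n, ‖g ((m + l : ℤ) + 1) - g (m + l)‖ₑ := by
    intro n
    induction n with
    | zero => simp [hm0]
    | succ n ih =>
      rw [Finset.sum_range_succ]
      calc ‖g (m + (n + 1 : ℕ))‖ₑ = ‖g (m + n) + (g ((m + n : ℤ) + 1) - g (m + n))‖ₑ := by
            congr 1
            push_cast
            rw [add_assoc]
            ring
        _ ≤ _ := (enorm_add_le _ _).trans (by gcongr)
  have h1 := key (i - m).toNat
  have h2 : m + ((i - m).toNat : ℤ) = i := by
    have : m < i := hm
    omega
  rw [h2] at h1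
  refine h1.trans ((ENNReal.sum_le_tsum _).trans ?_)
  exact ENNReal.tsum_comp_le_tsum_of_injective (f := fun l : ℕ => m + (l : ℤ))
    (fun a b hab => by simpa using hab) (fun k => ‖g (k + 1) - g k‖ₑ)

/-- Gagliardo's argument: a value is bounded by the variation along its horizontal line, which
depends only on `j`, and along its vertical line, which depends only on `i`. The sum of the product
of the two bounds factorises. -/
theorem tsum_enorm_sq_le (hg : g.HasFiniteSupport) :
    ∑' x, ‖g x‖ₑ ^ 2 ≤ (∑' x, ‖g (x + dirX) - g x‖ₑ) * ∑' x, ‖g (x + dirY) - g x‖ₑ := by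
  set R : ℤ → ℝ≥0∞ := fun j => ∑' k : ℤ, ‖g (k + 1, j) - g (k, j)‖ₑ with hR
  set C : ℤ → ℝ≥0∞ := fun i => ∑' k : ℤ, ‖g (i, k + 1) - g (i, k)‖ₑ with hC
  have hRs : ∑' j, R j = ∑' x, ‖g (x + dirX) - g x‖ₑ := by
    rw [ENNReal.tsum_prod', ENNReal.tsum_comm]
    simp
  have hCs : ∑' j, C j = ∑' x, ‖g (x + dirY) - g x‖ₑ := by
    rw [ENNReal.tsum_prod']
    simp [hC]
  have h1 : ∀ i j, ‖g (i, j)‖ₑ ≤ R j := fun i j =>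
    enorm_le_tsum_enorm_sub (g := fun k => g (k, j))
      (hg.fun_comp_of_injective (Prod.mk_left_injective j)) i
  have h2 : ∀ i j, ‖g (i, j)‖ₑ ≤ C i := fun i j =>
    enorm_le_tsum_enorm_sub (g := fun k => g (i, k))
      (hg.fun_comp_of_injective (Prod.mk_right_injective i)) j
  rw [← hRs, ← hCs, ENNReal.tsum_prod', mul_comm, ← ENNReal.tsum_mul_right]
  refine ENNReal.tsum_le_tsum fun i => ?_
  rw [← ENNReal.tsum_mul_left]
  refine ENNReal.tsum_le_tsum fun j => ?_
  rw [sq]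
  exact mul_le_mul' (h2 i j) (h1 i j)

theorem ofReal_tsum_abs (hf : f.HasFiniteSupport) :
    ENNReal.ofReal (∑' x, |f x|) = ∑' x, ‖f x‖ₑ := by
  rw [ENNReal.ofReal_tsum_of_nonneg (fun _ => abs_nonneg _)
    (summable_of_hasFiniteSupport (by fun_prop (disch := first | exact add_left_injective _ | exact sub_left_injective)))]
  simp [Real.enorm_eq_ofReal_abs]

/-- The discrete Gagliardo–Nirenberg inequality. -/
theorem tsum_sq_le_mul (hg : g.HasFiniteSupport) :
    ∑' x, g x ^ 2 ≤ (∑' x, |g (x + dirX) - g x|) * ∑' x, |g (x + dirY) - g x| := by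
  have h := tsum_enorm_sq_le hg
  rw [← ofReal_tsum_abs (by fun_prop (disch := first | exact add_left_injective _ | exact sub_left_injective)), ← ofReal_tsum_abs (by fun_prop (disch := first | exact add_left_injective _ | exact sub_left_injective)),
    ← ENNReal.ofReal_mul (tsum_nonneg fun _ => abs_nonneg _)] at h
  have h2 : ∑' x, ‖g x‖ₑ ^ 2 = ENNReal.ofReal (∑' x, g x ^ 2) := by
    rw [ENNReal.ofReal_tsum_of_nonneg (fun _ => sq_nonneg _)
      (summable_of_hasFiniteSupport (by fun_prop (disch := first | exact add_left_injective _ | exact sub_left_injective)))]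
    refine tsum_congr fun x => ?_
    rw [Real.enorm_eq_ofReal_abs, ← ENNReal.ofReal_pow (abs_nonneg _), sq_abs]
  rw [h2] at h
  exact (ENNReal.ofReal_le_ofReal_iff (mul_nonneg (tsum_nonneg fun _ => abs_nonneg _)
    (tsum_nonneg fun _ => abs_nonneg _))).1 h

theorem tsum_mul_sq_le (hf : f.HasFiniteSupport) (hg : g.HasFiniteSupport) :
    (∑' x, f x * g x) ^ 2 ≤ (∑' x, f x ^ 2) * ∑' x, g x ^ 2 := by
  have h : ∀ F : ℤ × ℤ → ℝ, (∀ x, f x = 0 → g x = 0 → F x = 0) →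
      ∑' x, F x = ∑ x ∈ hf.toFinset ∪ hg.toFinset, F x := fun F hF =>
    tsum_eq_sum fun x hx => by
      rw [Finset.mem_union, not_or] at hx
      exact hF x (by_contra fun hc => hx.1 ((Set.Finite.mem_toFinset _).2 hc))
        (by_contra fun hc => hx.2 ((Set.Finite.mem_toFinset _).2 hc))
  rw [h _ fun x hx _ => by simp [hx], h _ fun x hx _ => by simp [hx],
    h _ fun x _ hx => by simp [hx]]
  exact Finset.sum_mul_sq_le_sq_mul_sq _ _ _

/-- The discrete Nash inequality in two dimensions. -/
theorem lattice_nash (hf : f.HasFiniteSupport) :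
    (∑' x, f x ^ 2) ^ 2 ≤ 2 * (∑' x, |f x|) ^ 2 *
      (∑' x, (f (x + dirX) - f x) ^ 2 + ∑' x, (f (x + dirY) - f x) ^ 2) := by
  set S := ∑' x, f x ^ 2 with hS
  set E := ∑' x, (f (x + dirX) - f x) ^ 2 + ∑' x, (f (x + dirY) - f x) ^ 2 with hE
  set B := ∑' x, |f x| with hB
  have hS0 : 0 ≤ S := tsum_nonneg fun _ => sq_nonneg _
  have hE0 : 0 ≤ E := add_nonneg (tsum_nonneg fun _ => sq_nonneg _)
    (tsum_nonneg fun _ => sq_nonneg _)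
  -- Cauchy–Schwarz applied to the factorisation of a difference of squares.
  have hgrad : ∀ e : ℤ × ℤ, (∑' x, |f (x + e) ^ 2 - f x ^ 2|) ^ 2 ≤
      (∑' x, (f (x + e) - f x) ^ 2) * (4 * S) := by
    intro e
    have h1 := tsum_mul_sq_le (f := fun x => |f (x + e) - f x|)
      (g := fun x => |f (x + e)| + |f x|) (by fun_prop (disch := first | exact add_left_injective _ | exact sub_left_injective)) (by fun_prop (disch := first | exact add_left_injective _ | exact sub_left_injective))
    have h2 : ∑' x, (|f (x + e)| + |f x|) ^ 2 ≤ 4 * S := by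
      calc ∑' x, (|f (x + e)| + |f x|) ^ 2 ≤ ∑' x, (2 * f (x + e) ^ 2 + 2 * f x ^ 2) := by
            refine Summable.tsum_le_tsum (fun x => ?_)
              (summable_of_hasFiniteSupport (by fun_prop (disch := first | exact add_left_injective _ | exact sub_left_injective)))
              (summable_of_hasFiniteSupport (by fun_prop (disch := first | exact add_left_injective _ | exact sub_left_injective)))
            rw [← sq_abs (f (x + e)), ← sq_abs (f x)]
            nlinarith [sq_nonneg (|f (x + e)| - |f x|)]
        _ = 4 * S := by
            rw [Summable.tsum_add (summable_of_hasFiniteSupport (by fun_prop (disch := first | exact add_left_injective _ | exact sub_left_injective)))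
              (summable_of_hasFiniteSupport (by fun_prop (disch := first | exact add_left_injective _ | exact sub_left_injective))), tsum_mul_left, tsum_mul_left,
              tsum_comp_add (fun x => f x ^ 2) e]
            ring
    have h3 : ∑' x, |f (x + e) ^ 2 - f x ^ 2| ≤
        ∑' x, |f (x + e) - f x| * (|f (x + e)| + |f x|) := by
      refine Summable.tsum_le_tsum (fun x => ?_)
        (summable_of_hasFiniteSupport (by fun_prop (disch := first | exact add_left_injective _ | exact sub_left_injective))) (summable_of_hasFiniteSupport (by fun_prop (disch := first | exact add_left_injective _ | exact sub_left_injective)))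
      rw [sq_sub_sq, mul_comm, abs_mul]
      gcongr
      exact abs_add_le _ _
    calc _ ≤ (∑' x, |f (x + e) - f x| * (|f (x + e)| + |f x|)) ^ 2 := by
          gcongr
      _ ≤ _ := h1
      _ ≤ _ := by
          simp_rw [sq_abs]
          exact mul_le_mul_of_nonneg_left h2 (tsum_nonneg fun _ => sq_nonneg _)
  -- Ladyzhenskaya's inequality: Gagliardo–Nirenberg for `f²`, then `2ab ≤ a² + b²` and the two
  -- bounds from `hgrad`.
  have h4 : ∑' x, (f x ^ 2) ^ 2 ≤ 2 * E * S := by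
    have h := tsum_sq_le_mul (g := fun x => f x ^ 2) (by fun_prop (disch := first | exact add_left_injective _ | exact sub_left_injective))
    have h1 := hgrad dirX
    have h2 := hgrad dirY
    nlinarith [sq_nonneg ((∑' x, |f (x + dirX) ^ 2 - f x ^ 2|) -
      ∑' x, |f (x + dirY) ^ 2 - f x ^ 2|)]
  -- Interpolation of `ℓ²` between `ℓ¹` and `ℓ³`. Together with `h6`, which places `ℓ³` between `ℓ²`
  -- and `ℓ⁴`, and with `h4`, it gives `S⁴ ≤ 2 B² E S²`.
  have h5 : S ^ 2 ≤ B * ∑' x, |f x| ^ 3 := by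
    have h : S ^ 2 ≤ (∑' x, (√|f x|) ^ 2) * ∑' x, (√|f x| * |f x|) ^ 2 := by
      have hq : HasFiniteSupport fun x => √|f x| :=
        hf.fun_comp (g := fun a => √|a|) (by simp)
      refine le_of_eq_of_le ?_ (tsum_mul_sq_le (f := fun x => √|f x|)
        (g := fun x => √|f x| * |f x|) hq (by fun_prop (disch := first | exact add_left_injective _ | exact sub_left_injective)))
      congr 1
      refine tsum_congr fun x => ?_
      rw [← mul_assoc, Real.mul_self_sqrt (abs_nonneg _), ← sq, sq_abs]
    refine h.trans (le_of_eq ?_)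
    congr 1
    · exact tsum_congr fun x => Real.sq_sqrt (abs_nonneg _)
    · refine tsum_congr fun x => ?_
      rw [mul_pow, Real.sq_sqrt (abs_nonneg _)]
      ring
  have h6 : (∑' x, |f x| ^ 3) ^ 2 ≤ S * ∑' x, (f x ^ 2) ^ 2 := by
    refine le_of_eq_of_le ?_ ((tsum_mul_sq_le (f := fun x => |f x|)
      (g := fun x => f x ^ 2) (by fun_prop (disch := first | exact add_left_injective _ | exact sub_left_injective)) (by fun_prop (disch := first | exact add_left_injective _ | exact sub_left_injective))).trans (le_of_eq ?_))
    · congr 1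
      refine tsum_congr fun x => ?_
      rw [← sq_abs (f x)]; ring
    · simp_rw [sq_abs]; rfl
  have h3n : 0 ≤ ∑' x, |f x| ^ 3 := tsum_nonneg fun _ => by positivity
  have h7 : S ^ 4 ≤ 2 * B ^ 2 * E * S ^ 2 := by
    calc S ^ 4 = (S ^ 2) ^ 2 := by ring
      _ ≤ (B * ∑' x, |f x| ^ 3) ^ 2 := by gcongr
      _ = B ^ 2 * (∑' x, |f x| ^ 3) ^ 2 := by ring
      _ ≤ B ^ 2 * (S * (2 * E * S)) := by
          gcongr
          exact h6.trans (by gcongr)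
      _ = _ := by ring
  rcases hS0.eq_or_lt with h | h
  · rw [← h]
    have : 0 ≤ 2 * B ^ 2 * E := by positivity
    simpa using this
  · have : S ^ 2 * S ^ 2 ≤ 2 * B ^ 2 * E * S ^ 2 := by linarith [h7, show S ^ 4 = S ^ 2 * S ^ 2 by ring]
    exact le_of_mul_le_mul_right this (by positivity)

/-- Extension by zero of a function on a finite subset of the lattice. -/
def extendZero (S : Finset (ℤ × ℤ)) (v : S → ℝ) (x : ℤ × ℤ) : ℝ :=
  if h : x ∈ S then v ⟨x, h⟩ else 0

/-- The generator with Dirichlet conditions outside the finite set `S`. -/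
def restrictedGenerator (p q : ℤ × ℤ → ℝ) (S : Finset (ℤ × ℤ)) : Matrix S S ℝ :=
  fun x y => latticeGenerator p q (Pi.single (y : ℤ × ℤ) 1) x

variable {S : Finset (ℤ × ℤ)}

theorem extendZero_coe (v : S → ℝ) (x : S) : extendZero S v x = v x := by
  simp [extendZero]

theorem extendZero_of_notMem (v : S → ℝ) {x : ℤ × ℤ} (hx : x ∉ S) : extendZero S v x = 0 := by
  simp [extendZero, hx]

theorem hasFiniteSupport_extendZero (v : S → ℝ) : (extendZero S v).HasFiniteSupport :=
  S.finite_toSet.subset fun x hx => by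
    by_contra hc
    exact hx (extendZero_of_notMem v hc)

theorem extendZero_eq_sum (v : S → ℝ) (x : ℤ × ℤ) :
    extendZero S v x = ∑ y : S, (Pi.single (y : ℤ × ℤ) (1 : ℝ) : ℤ × ℤ → ℝ) x * v y := by
  by_cases h : x ∈ S
  · rw [Finset.sum_eq_single ⟨x, h⟩]
    · simp [extendZero, h]
    · intro y _ hy
      rw [Pi.single_eq_of_ne (fun hc => hy (Subtype.ext hc.symm)), zero_mul]
    · simp
  · rw [extendZero_of_notMem v h]
    refine (Finset.sum_eq_zero fun y _ => ?_).symm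
    rw [Pi.single_eq_of_ne (fun hc => h (by rw [hc]; exact y.2)), zero_mul]

theorem restrictedGenerator_mulVec (p q : ℤ × ℤ → ℝ) (v : S → ℝ) (x : S) :
    (restrictedGenerator p q S).mulVec v x = latticeGenerator p q (extendZero S v) x := by
  unfold Matrix.mulVec dotProduct restrictedGenerator latticeGenerator
  simp only [extendZero_eq_sum, ← Finset.sum_sub_distrib, Finset.mul_sum,
    ← Finset.sum_add_distrib]
  exact Finset.sum_congr rfl fun y _ => by ring

/-- This is the adjoint relation tested on point masses. It turns statements about rows into
statements about columns. -/
theorem restrictedGenerator_transpose (h : IsLatticeFlux p q) :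
    (restrictedGenerator p q S).transpose = restrictedGenerator (-p) (-q) S := by
  ext x y
  have hfs : ∀ z : ℤ × ℤ, (Pi.single z (1 : ℝ) : ℤ × ℤ → ℝ).HasFiniteSupport := fun z =>
    (Set.finite_singleton z).subset fun w hw => by
      by_contra hc
      exact hw (Pi.single_eq_of_ne hc _)
  have key := tsum_mul_latticeGenerator (g := Pi.single (y : ℤ × ℤ) 1) h (hfs x)
  rw [tsum_eq_single (y : ℤ × ℤ) (fun z hz => by rw [Pi.single_eq_of_ne hz, zero_mul]),
    tsum_eq_single (x : ℤ × ℤ) (fun z hz => by rw [Pi.single_eq_of_ne hz, zero_mul])] at key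
  simpa [restrictedGenerator] using key

/-- The row sum is the generator applied to the indicator of `S` at a point where the indicator
attains its maximum; the jump rates are nonnegative. -/
theorem IsLatticeFlux.restrictedGenerator_row_sum (h : IsLatticeFlux p q) (x : S) :
    ∑ y, restrictedGenerator p q S x y ≤ 0 := by
  have h0 : ∑ y, restrictedGenerator p q S x y =
      (restrictedGenerator p q S).mulVec (fun _ => 1) x := by
    simp [Matrix.mulVec, dotProduct]
  rw [h0, restrictedGenerator_mulVec]
  have hx : extendZero S (fun _ => 1) (x : ℤ × ℤ) = 1 := extendZero_coe _ x
  have hle : ∀ y, extendZero S (fun _ => 1) y ≤ 1 := fun y => by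
    unfold extendZero
    split_ifs <;> norm_num
  unfold latticeGenerator
  rw [hx]
  have h1 := abs_le.1 (h.abs_left_le x)
  have h2 := abs_le.1 (h.abs_left_le (x + dirX))
  have h3 := abs_le.1 (h.abs_right_le x)
  have h4 := abs_le.1 (h.abs_right_le (x + dirY))
  have k : ∀ {a b : ℝ}, 0 ≤ a → b ≤ 1 → a * (b - 1) ≤ 0 := fun ha hb =>
    mul_nonpos_of_nonneg_of_nonpos ha (by linarith)
  have k1 := k (show 0 ≤ 1 - p (x + dirX) by linarith) (hle (x + dirX))
  have k2 := k (show 0 ≤ 1 + p x by linarith) (hle (x - dirX))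
  have k3 := k (show 0 ≤ 1 - q (x + dirY) by linarith) (hle (x + dirY))
  have k4 := k (show 0 ≤ 1 + q x by linarith) (hle (x - dirY))
  linarith

theorem IsLatticeFlux.isSubMarkov (h : IsLatticeFlux p q) (S : Finset (ℤ × ℤ)) :
    IsSubMarkov (restrictedGenerator p q S) where
  off_diag_nonneg x y hxy := by
    unfold restrictedGenerator latticeGenerator
    rw [Pi.single_eq_of_ne (fun hc => hxy (Subtype.ext hc))]
    have h1 := abs_le.1 (h.abs_left_le x)
    have h2 := abs_le.1 (h.abs_left_le (x + dirX))
    have h3 := abs_le.1 (h.abs_right_le x)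
    have h4 := abs_le.1 (h.abs_right_le (x + dirY))
    have hs : ∀ z, 0 ≤ (Pi.single (y : ℤ × ℤ) (1 : ℝ) : ℤ × ℤ → ℝ) z := fun z => by
      rw [Pi.single_apply]
      split_ifs <;> norm_num
    have k1 := mul_nonneg (show 0 ≤ 1 - p (x + dirX) by linarith) (hs (x + dirX))
    have k2 := mul_nonneg (show 0 ≤ 1 + p x by linarith) (hs (x - dirX))
    have k3 := mul_nonneg (show 0 ≤ 1 - q (x + dirY) by linarith) (hs (x + dirY))
    have k4 := mul_nonneg (show 0 ≤ 1 + q x by linarith) (hs (x - dirY))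
    linarith
  row_sum_nonpos := h.restrictedGenerator_row_sum
  col_sum_nonpos y := by
    have := h.neg.restrictedGenerator_row_sum y
    rw [← restrictedGenerator_transpose h] at this
    exact this

theorem tsum_eq_sum_coe {F : ℤ × ℤ → ℝ} (hF : ∀ x, x ∉ S → F x = 0) :
    ∑' x, F x = ∑ x : S, F x := by
  rw [tsum_eq_sum (s := S) fun x hx => hF x hx, ← Finset.sum_coe_sort]

theorem IsLatticeFlux.nashInequality (h : IsLatticeFlux p q) (S : Finset (ℤ × ℤ)) :
    NashInequality 4 (restrictedGenerator p q S) := by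
  intro v
  have hfs := hasFiniteSupport_extendZero v
  have h1 := lattice_nash hfs
  have h2 := h.energy_le hfs
  rw [tsum_eq_sum_coe (S := S) (F := fun x => extendZero S v x ^ 2)
      (fun x hx => by simp [extendZero_of_notMem v hx]),
    tsum_eq_sum_coe (S := S) (F := fun x => |extendZero S v x|)
      (fun x hx => by simp [extendZero_of_notMem v hx])] at h1
  rw [tsum_eq_sum_coe (S := S) (F := fun x => extendZero S v x * latticeGenerator p q (extendZero S v) x)
      (fun x hx => by simp [extendZero_of_notMem v hx])] at h2

  simp only [extendZero_coe] at h1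
  simp only [extendZero_coe, ← restrictedGenerator_mulVec] at h2
  -- The constant `4` is the `2` of `lattice_nash` times the `2` of `energy_le`.
  refine h1.trans ((mul_le_mul_of_nonneg_left h2 (by positivity)).trans (le_of_eq ?_))
  ring

end LatticeGenerator

/-! ### Maximum principle on squares and Lebesgue's lemma on the lattice. -/

section LatticeElliptic

open Function

variable {p q f : ℤ × ℤ → ℝ}

/-- The lattice points at sup-distance less than `r` from `c`. -/
noncomputable def openSquare (c : ℤ × ℤ) (r : ℕ) : Finset (ℤ × ℤ) :=
  Finset.Ioo (c.1 - r) (c.1 + r) ×ˢ Finset.Ioo (c.2 - r) (c.2 + r)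

/-- The lattice points at sup-distance at most `r` from `c`. -/
noncomputable def closedSquare (c : ℤ × ℤ) (r : ℕ) : Finset (ℤ × ℤ) :=
  Finset.Icc (c.1 - r) (c.1 + r) ×ˢ Finset.Icc (c.2 - r) (c.2 + r)

theorem mem_openSquare {c x : ℤ × ℤ} {r : ℕ} : x ∈ openSquare c r ↔
    (c.1 - r < x.1 ∧ x.1 < c.1 + r) ∧ c.2 - r < x.2 ∧ x.2 < c.2 + r := by
  simp [openSquare]

theorem mem_closedSquare {c x : ℤ × ℤ} {r : ℕ} : x ∈ closedSquare c r ↔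
    (c.1 - r ≤ x.1 ∧ x.1 ≤ c.1 + r) ∧ c.2 - r ≤ x.2 ∧ x.2 ≤ c.2 + r := by
  simp [closedSquare]

theorem card_openSquare_le (c : ℤ × ℤ) (r : ℕ) : (openSquare c r).card ≤ 4 * r ^ 2 := by
  have h : ∀ a : ℤ, (Finset.Ioo (a - r) (a + r)).card ≤ 2 * r := fun a => by
    rw [Int.card_Ioo]
    omega
  rw [openSquare, Finset.card_product]
  calc _ ≤ (2 * r) * (2 * r) := Nat.mul_le_mul (h _) (h _)
    _ = _ := by ring

/-- The maximum principle on a square, with a right-hand side. -/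
theorem IsLatticeFlux.le_add_of_ring (h : IsLatticeFlux p q) {c : ℤ × ℤ} {r : ℕ} {F m : ℝ}
    (hF : 0 ≤ F) (hL : ∀ x ∈ openSquare c r, -F ≤ latticeGenerator p q f x)
    (hm : ∀ x ∈ closedSquare c r, x ∉ openSquare c r → f x ≤ m) {x : ℤ × ℤ}
    (hx : x ∈ closedSquare c r) : f x ≤ m + 64 * r ^ 2 * F := by
  by_cases hxo : x ∈ openSquare c r
  swap
  · have := hm x hx hxo
    have : 0 ≤ 64 * (r : ℝ) ^ 2 * F := by positivity
    linarith
  set S := openSquare c r with hS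
  set v : S → ℝ := fun y => f y - m with hv
  -- The zero extension of `f - m` dominates `f - m` on the closed square, with equality on `S`. As
  -- the jump rates are nonnegative, passing to Dirichlet conditions only increases the generator at
  -- points of `S`.
  have hge : ∀ y ∈ closedSquare c r, f y - m ≤ extendZero S v y := by
    intro y hy
    by_cases hyo : y ∈ S
    · exact (extendZero_coe v ⟨y, hyo⟩).ge
    · rw [extendZero_of_notMem v hyo]
      linarith [hm y hy hyo]
  have hMv : ∀ y : S, -F ≤ (restrictedGenerator p q S).mulVec v y := by
    intro y
    rw [restrictedGenerator_mulVec]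
    refine (hL y y.2).trans ?_
    have hy := mem_openSquare.1 y.2
    unfold latticeGenerator
    rw [extendZero_coe]
    have h1 := abs_le.1 (h.abs_left_le y)
    have h2 := abs_le.1 (h.abs_left_le (y + dirX))
    have h3 := abs_le.1 (h.abs_right_le y)
    have h4 := abs_le.1 (h.abs_right_le (y + dirY))
    have n1 := hge (y + dirX) (mem_closedSquare.2 (by simp; omega))
    have n2 := hge (y - dirX) (mem_closedSquare.2 (by simp; omega))
    have n3 := hge (y + dirY) (mem_closedSquare.2 (by simp; omega))
    have n4 := hge (y - dirY) (mem_closedSquare.2 (by simp; omega))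
    have hvy : v y = f y - m := rfl
    rw [hvy]
    refine add_le_add (add_le_add (add_le_add ?_ ?_) ?_) ?_ <;>
      exact mul_le_mul_of_nonneg_left (by linarith) (by linarith)
  have h1 := (h.isSubMarkov S).le_of_neg_le_mulVec (by norm_num : (0 : ℝ) < 4)
    (h.nashInequality S) hF hMv ⟨x, hxo⟩
  have h2 : (Fintype.card S : ℝ) ≤ 4 * r ^ 2 := by
    rw [Fintype.card_coe]
    exact_mod_cast card_openSquare_le c r
  have h3 : v ⟨x, hxo⟩ = f x - m := rfl
  -- The factor `4 K card S` of the abstract maximum principle, with `K = 4` and at most `4 r²`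
  -- points.
  have h4 : 4 * 4 * (Fintype.card S : ℝ) * F ≤ 64 * r ^ 2 * F := by
    have := mul_le_mul_of_nonneg_right h2 hF
    linarith
  linarith

theorem latticeGenerator_neg (p q f : ℤ × ℤ → ℝ) (x : ℤ × ℤ) :
    latticeGenerator p q (-f) x = -latticeGenerator p q f x := by
  unfold latticeGenerator
  simp only [Pi.neg_apply]
  ring

theorem IsLatticeFlux.abs_sub_le_of_ring (h : IsLatticeFlux p q) {c : ℤ × ℤ} {r : ℕ} {F a T : ℝ}
    (hF : 0 ≤ F) (hL : ∀ x ∈ openSquare c r, |latticeGenerator p q f x| ≤ F)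
    (hm : ∀ x ∈ closedSquare c r, x ∉ openSquare c r → |f x - a| ≤ T) {x : ℤ × ℤ}
    (hx : x ∈ closedSquare c r) : |f x - a| ≤ T + 64 * r ^ 2 * F := by
  have h1 := h.le_add_of_ring (m := a + T) hF (fun y hy => (abs_le.1 (hL y hy)).1)
    (fun y hy hyo => by linarith [(abs_le.1 (hm y hy hyo)).2]) hx
  have h2 := h.le_add_of_ring (f := -f) (m := T - a) hF
    (fun y hy => by rw [latticeGenerator_neg]; linarith [(abs_le.1 (hL y hy)).2])
    (fun y hy hyo => by rw [Pi.neg_apply]; linarith [(abs_le.1 (hm y hy hyo)).1]) hx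
  rw [Pi.neg_apply] at h2
  rw [abs_le]
  constructor <;> linarith

theorem abs_sub_le_sum_range (g : ℤ → ℝ) (m : ℤ) {i : ℤ} {n : ℕ} (h1 : m ≤ i) (h2 : i ≤ m + n) :
    |g i - g m| ≤ ∑ l ∈ Finset.range n, |g (m + l + 1) - g (m + l)| := by
  obtain ⟨k, rfl⟩ := Int.le.dest h1
  have hk : k ≤ n := by omega
  have h3 : |g (m + k) - g m| ≤ ∑ l ∈ Finset.range k, |g (m + l + 1) - g (m + l)| := by
    clear h1 h2 hk
    induction k with
    | zero => simp
    | succ k ih =>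
      rw [Finset.sum_range_succ]
      have : g (m + (k + 1 : ℕ)) - g m =
          (g (m + k) - g m) + (g (m + k + 1) - g (m + k)) := by
        push_cast
        rw [add_assoc]
        ring
      rw [this]
      exact (abs_add_le _ _).trans (by gcongr)
  refine h3.trans (Finset.sum_le_sum_of_subset_of_nonneg ?_ fun _ _ _ => abs_nonneg _)
  exact Finset.range_subset_range.2 hk

/-- The sum of `φ` over the horizontal edges and of `ψ` over the vertical edges of the boundary of
a square. -/
def ringSum (φ ψ : ℤ × ℤ → ℝ) (c : ℤ × ℤ) (r : ℕ) : ℝ :=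
  ∑ l ∈ Finset.range (2 * r), φ (c.1 - r + l, c.2 - r) +
    ∑ l ∈ Finset.range (2 * r), φ (c.1 - r + l, c.2 + r) +
    ∑ l ∈ Finset.range (2 * r), ψ (c.1 - r, c.2 - r + l) +
    ∑ l ∈ Finset.range (2 * r), ψ (c.1 + r, c.2 - r + l)

/-- A boundary point is joined to the lower left corner along at most two sides of the square. -/
theorem abs_sub_le_ringSum (f : ℤ × ℤ → ℝ) {c x : ℤ × ℤ} {r : ℕ} (hx : x ∈ closedSquare c r)
    (hxo : x ∉ openSquare c r) : |f x - f (c.1 - r, c.2 - r)| ≤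
      ringSum (fun y => |f (y + dirX) - f y|) (fun y => |f (y + dirY) - f y|) c r := by
  obtain ⟨i, j⟩ := x
  rw [mem_closedSquare] at hx
  rw [mem_openSquare] at hxo
  simp only at hx hxo
  have hrow : ∀ b : ℤ, ∀ i, c.1 - r ≤ i → i ≤ c.1 + r → |f (i, b) - f (c.1 - r, b)| ≤
      ∑ l ∈ Finset.range (2 * r), |f ((c.1 - r + l, b) + dirX) - f (c.1 - r + l, b)| := by
    intro b i h1 h2
    refine (abs_sub_le_sum_range (fun k => f (k, b)) (c.1 - r) h1 (n := 2 * r)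
      (by push_cast; omega)).trans (le_of_eq ?_)
    simp
  have hcol : ∀ b : ℤ, ∀ j, c.2 - r ≤ j → j ≤ c.2 + r → |f (b, j) - f (b, c.2 - r)| ≤
      ∑ l ∈ Finset.range (2 * r), |f ((b, c.2 - r + l) + dirY) - f (b, c.2 - r + l)| := by
    intro b j h1 h2
    refine (abs_sub_le_sum_range (fun k => f (b, k)) (c.2 - r) h1 (n := 2 * r)
      (by push_cast; omega)).trans (le_of_eq ?_)
    simp
  have s1 : 0 ≤ ∑ l ∈ Finset.range (2 * r),
    |f ((c.1 - r + l, c.2 - r) + dirX) - f (c.1 - r + l, c.2 - r)| :=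
    Finset.sum_nonneg fun _ _ => abs_nonneg _
  have s2 : 0 ≤ ∑ l ∈ Finset.range (2 * r),
    |f ((c.1 - r + l, c.2 + r) + dirX) - f (c.1 - r + l, c.2 + r)| :=
    Finset.sum_nonneg fun _ _ => abs_nonneg _
  have s3 : 0 ≤ ∑ l ∈ Finset.range (2 * r),
    |f ((c.1 - r, c.2 - r + l) + dirY) - f (c.1 - r, c.2 - r + l)| :=
    Finset.sum_nonneg fun _ _ => abs_nonneg _
  have s4 : 0 ≤ ∑ l ∈ Finset.range (2 * r),
    |f ((c.1 + r, c.2 - r + l) + dirY) - f (c.1 + r, c.2 - r + l)| :=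
    Finset.sum_nonneg fun _ _ => abs_nonneg _
  unfold ringSum
  have hcases : j = c.2 - r ∨ j = c.2 + r ∨ i = c.1 - r ∨ i = c.1 + r := by omega
  rcases hcases with hj | hj | hi | hi
  · subst hj
    have := hrow (c.2 - r) i hx.1.1 hx.1.2
    linarith
  · subst hj
    have h1 := hrow (c.2 + r) i hx.1.1 hx.1.2
    have h2 := hcol (c.1 - r) (c.2 + r) (by omega) le_rfl
    have := abs_sub_le (f (i, c.2 + r)) (f (c.1 - r, c.2 + r)) (f (c.1 - r, c.2 - r))
    linarith
  · subst hi
    have := hcol (c.1 - r) j hx.2.1 hx.2.2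
    linarith
  · subst hi
    have h1 := hcol (c.1 + r) j hx.2.1 hx.2.2
    have h2 := hrow (c.2 - r) (c.1 + r) (by omega) le_rfl
    have := abs_sub_le (f (c.1 + r, j)) (f (c.1 + r, c.2 - r)) (f (c.1 - r, c.2 - r))
    linarith

theorem ringSum_nonneg {φ ψ : ℤ × ℤ → ℝ} (hφ : ∀ x, 0 ≤ φ x) (hψ : ∀ x, 0 ≤ ψ x) (c : ℤ × ℤ)
    (r : ℕ) : 0 ≤ ringSum φ ψ c r :=
  add_nonneg (add_nonneg (add_nonneg (Finset.sum_nonneg fun _ _ => hφ _)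
    (Finset.sum_nonneg fun _ _ => hφ _)) (Finset.sum_nonneg fun _ _ => hψ _))
    (Finset.sum_nonneg fun _ _ => hψ _)

theorem closedSquare_subset (c : ℤ × ℤ) {k r : ℕ} (h : k ≤ r) :
    closedSquare c k ⊆ closedSquare c r := fun x hx => by
  rw [mem_closedSquare] at *
  omega

theorem openSquare_subset (c : ℤ × ℤ) {k r : ℕ} (h : k ≤ r) :
    openSquare c k ⊆ openSquare c r := fun x hx => by
  rw [mem_openSquare] at *
  omega

/-- Cauchy–Schwarz over the four sides of `2r` edges each. -/
theorem ringSum_sq_le (φ ψ : ℤ × ℤ → ℝ) (c : ℤ × ℤ) (r : ℕ) :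
    ringSum φ ψ c r ^ 2 ≤ 8 * r * ringSum (fun y => φ y ^ 2) (fun y => ψ y ^ 2) c r := by
  have key : ∀ g : ℕ → ℝ, (∑ l ∈ Finset.range (2 * r), g l) ^ 2 ≤
      2 * r * ∑ l ∈ Finset.range (2 * r), g l ^ 2 := fun g => by
    have := sq_sum_le_card_mul_sum_sq (s := Finset.range (2 * r)) (f := g)
    simpa using this
  unfold ringSum
  have h1 := key fun l => φ (c.1 - r + l, c.2 - r)
  have h2 := key fun l => φ (c.1 - r + l, c.2 + r)
  have h3 := key fun l => ψ (c.1 - r, c.2 - r + l)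
  have h4 := key fun l => ψ (c.1 + r, c.2 - r + l)
  generalize ∑ l ∈ Finset.range (2 * r), φ (c.1 - r + l, c.2 - r) = a at *
  generalize ∑ l ∈ Finset.range (2 * r), φ (c.1 - r + l, c.2 + r) = b at *
  generalize ∑ l ∈ Finset.range (2 * r), ψ (c.1 - r, c.2 - r + l) = d at *
  generalize ∑ l ∈ Finset.range (2 * r), ψ (c.1 + r, c.2 - r + l) = e at *
  have h5 : (a + b + d + e) ^ 2 ≤ 4 * (a ^ 2 + b ^ 2 + d ^ 2 + e ^ 2) := by
    nlinarith [sq_nonneg (a - b), sq_nonneg (a - d), sq_nonneg (a - e), sq_nonneg (b - d),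
      sq_nonneg (b - e), sq_nonneg (d - e)]
  linarith

theorem sum_sum_le_of_injOn {ι κ α : Type*} [DecidableEq α] (s : Finset ι) (t : ι → Finset κ)
    (B : Finset α) (F : ι → κ → α) {φ : α → ℝ} (hφ : ∀ x, 0 ≤ φ x)
    (hF : ∀ i ∈ s, ∀ l ∈ t i, F i l ∈ B)
    (hinj : ∀ i l i' l', F i l = F i' l' → i = i' ∧ l = l') :
    ∑ i ∈ s, ∑ l ∈ t i, φ (F i l) ≤ ∑ x ∈ B, φ x := by
  rw [Finset.sum_sigma']
  rw [← Finset.sum_image (f := φ) (g := fun x : (_ : ι) × κ => F x.1 x.2)]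
  · refine Finset.sum_le_sum_of_subset_of_nonneg ?_ fun x _ _ => hφ x
    intro x hx
    obtain ⟨y, hy, rfl⟩ := Finset.mem_image.1 hx
    rw [Finset.mem_sigma] at hy
    exact hF _ hy.1 _ hy.2
  · rintro ⟨i, l⟩ _ ⟨i', l'⟩ _ heq
    obtain ⟨rfl, rfl⟩ := hinj _ _ _ _ heq
    rfl

/-- Corresponding sides of concentric squares consist of distinct edges, so each of the four
families of sides contributes at most one full sum. The factor `2` appears because horizontal and
vertical edges each come from two families. -/
theorem sum_ringSum_le {φ ψ : ℤ × ℤ → ℝ} (hφ : ∀ x, 0 ≤ φ x) (hψ : ∀ x, 0 ≤ ψ x) (c : ℤ × ℤ)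
    (k R : ℕ) : ∑ r ∈ Finset.Icc k R, ringSum φ ψ c r ≤
      2 * ∑ x ∈ closedSquare c R, (φ x + ψ x) := by
  unfold ringSum
  rw [Finset.sum_add_distrib, Finset.sum_add_distrib, Finset.sum_add_distrib,
    Finset.sum_add_distrib]
  have h1 := sum_sum_le_of_injOn (Finset.Icc k R) (fun r => Finset.range (2 * r))
    (closedSquare c R) (fun r l => ((c.1 - r + l, c.2 - r) : ℤ × ℤ)) hφ
    (fun r hr l hl => by
      simp only [Finset.mem_Icc, Finset.mem_range, mem_closedSquare] at *
      omega) (fun r l r' l' h => by simp only [Prod.mk.injEq] at h; omega)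
  have h2 := sum_sum_le_of_injOn (Finset.Icc k R) (fun r => Finset.range (2 * r))
    (closedSquare c R) (fun r l => ((c.1 - r + l, c.2 + r) : ℤ × ℤ)) hφ
    (fun r hr l hl => by
      simp only [Finset.mem_Icc, Finset.mem_range, mem_closedSquare] at *
      omega) (fun r l r' l' h => by simp only [Prod.mk.injEq] at h; omega)
  have h3 := sum_sum_le_of_injOn (Finset.Icc k R) (fun r => Finset.range (2 * r))
    (closedSquare c R) (fun r l => ((c.1 - r, c.2 - r + l) : ℤ × ℤ)) hψ
    (fun r hr l hl => by
      simp only [Finset.mem_Icc, Finset.mem_range, mem_closedSquare] at *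
      omega) (fun r l r' l' h => by simp only [Prod.mk.injEq] at h; omega)
  have h4 := sum_sum_le_of_injOn (Finset.Icc k R) (fun r => Finset.range (2 * r))
    (closedSquare c R) (fun r l => ((c.1 + r, c.2 - r + l) : ℤ × ℤ)) hψ
    (fun r hr l hl => by
      simp only [Finset.mem_Icc, Finset.mem_range, mem_closedSquare] at *
      omega) (fun r l r' l' h => by simp only [Prod.mk.injEq] at h; omega)
  linarith

theorem log_div_le_sum_inv {k R : ℕ} (hk : 1 ≤ k) (hkR : k ≤ R) :
    Real.log ((R + 1) / k) ≤ ∑ r ∈ Finset.Icc k R, (1 / r : ℝ) := by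
  induction R, hkR using Nat.le_induction with
  | base =>
    have hk0 : (0 : ℝ) < k := by exact_mod_cast hk
    have := Real.log_le_sub_one_of_pos (show 0 < ((k : ℝ) + 1) / k by positivity)
    rw [Finset.Icc_self, Finset.sum_singleton]
    refine this.trans (le_of_eq ?_)
    field_simp
    ring
  | succ R hR ih =>
    have hk0 : (0 : ℝ) < k := by exact_mod_cast hk
    rw [Finset.sum_Icc_succ_top (by omega)]
    have h1 : (((R + 1 : ℕ) : ℝ) + 1) / k = ((R : ℝ) + 1) / k * (((R : ℝ) + 2) / (R + 1)) := by
      push_cast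
      field_simp
      ring
    rw [h1, Real.log_mul (by positivity) (by positivity)]
    have := Real.log_le_sub_one_of_pos (show 0 < ((R : ℝ) + 2) / (R + 1) by positivity)
    have h2 : ((R : ℝ) + 2) / (R + 1) - 1 = 1 / ((R + 1 : ℕ) : ℝ) := by
      push_cast
      field_simp
      ring
    rw [h2] at this
    linarith

/-- Lebesgue's lemma: functions that obey the maximum principle on squares, up to an error, and
have finite Dirichlet energy are logarithmically continuous. -/
theorem IsLatticeFlux.sq_mul_log_le (h : IsLatticeFlux p q) {c x y : ℤ × ℤ} {k R : ℕ} {F G : ℝ}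
    (hk : 1 ≤ k) (hkR : k ≤ R) (hF : 0 ≤ F)
    (hL : ∀ x ∈ openSquare c R, |latticeGenerator p q f x| ≤ F)
    (hG : ∑ x ∈ closedSquare c R, ((f (x + dirX) - f x) ^ 2 + (f (x + dirY) - f x) ^ 2) ≤ G)
    (hx : x ∈ closedSquare c k) (hy : y ∈ closedSquare c k) :
    (max (|f x - f y| - 128 * R ^ 2 * F) 0) ^ 2 * Real.log ((R + 1) / k) ≤ 64 * G := by
  set o := max (|f x - f y| - 128 * R ^ 2 * F) 0 with ho
  have ho0 : 0 ≤ o := le_max_right _ _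
  -- On each ring the maximum principle transports the boundary oscillation inward: `o ≤ 2T`. With
  -- `T² ≤ 8 r · ringSum` this gives the factor `4 · 8 = 32`.
  have hring : ∀ r ∈ Finset.Icc k R, o ^ 2 * (1 / r) ≤ 32 *
      ringSum (fun y => |f (y + dirX) - f y| ^ 2) (fun y => |f (y + dirY) - f y| ^ 2) c r := by
    intro r hr
    rw [Finset.mem_Icc] at hr
    have hr0 : (0 : ℝ) < r := by exact_mod_cast hk.trans hr.1
    have hrR : (r : ℝ) ≤ R := by exact_mod_cast hr.2
    set T := ringSum (fun y => |f (y + dirX) - f y|) (fun y => |f (y + dirY) - f y|) c r with hT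
    have hsub : ∀ z ∈ closedSquare c k, |f z - f (c.1 - r, c.2 - r)| ≤ T + 64 * r ^ 2 * F :=
      fun z hz => h.abs_sub_le_of_ring hF
        (fun z hz => hL z (openSquare_subset c hr.2 hz))
        (fun z hz hzo => abs_sub_le_ringSum f hz hzo)
        (closedSquare_subset c hr.1 hz)
    have hT0 : 0 ≤ T := ringSum_nonneg (fun _ => abs_nonneg _) (fun _ => abs_nonneg _) c r
    have h1 : |f x - f y| ≤ 2 * T + 128 * R ^ 2 * F := by
      have a1 := hsub x hx
      have a2 := hsub y hy
      rw [abs_sub_comm] at a2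
      have a3 := abs_sub_le (f x) (f (c.1 - r, c.2 - r)) (f y)
      have a4 : 64 * (r : ℝ) ^ 2 * F ≤ 64 * R ^ 2 * F := by gcongr
      linarith
    have h2 : o ≤ 2 * T := max_le (by linarith) (by linarith)
    have h3 := ringSum_sq_le (fun y => |f (y + dirX) - f y|) (fun y => |f (y + dirY) - f y|) c r
    rw [← hT] at h3
    rw [mul_one_div, div_le_iff₀ hr0]
    nlinarith
  -- Summing over the radii from `k` to `R`, the harmonic sum on the left produces the logarithm,
  -- and the rings on the right add up to at most twice the energy of the large square.
  have hsum := Finset.sum_le_sum hring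
  rw [← Finset.mul_sum, ← Finset.mul_sum] at hsum
  have h1 := sum_ringSum_le (φ := fun y => |f (y + dirX) - f y| ^ 2)
    (ψ := fun y => |f (y + dirY) - f y| ^ 2) (fun _ => sq_nonneg _) (fun _ => sq_nonneg _) c k R
  simp only [sq_abs] at h1 hsum
  have h2 := mul_le_mul_of_nonneg_left (log_div_le_sum_inv hk hkR) (sq_nonneg o)
  linarith

end LatticeElliptic

/-! ### Local energy estimate, logarithmic modulus and the discrete parabolic problem. -/

section LatticeEnergy

open Function

variable {p q f : ℤ × ℤ → ℝ}

/-- The piecewise linear function of height `2M` supported in `[-2M, 2M]`. -/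
def tent (M : ℕ) (i : ℤ) : ℤ := max 0 (2 * M - |i|)

theorem tent_nonneg (M : ℕ) (i : ℤ) : 0 ≤ tent M i := le_max_left _ _

theorem tent_le (M : ℕ) (i : ℤ) : tent M i ≤ 2 * M := by
  unfold tent
  have := abs_nonneg i
  omega

theorem le_tent {M : ℕ} {i : ℤ} (h : |i| ≤ M) : M ≤ tent M i := by
  unfold tent
  omega

theorem tent_eq_zero {M : ℕ} {i : ℤ} (h : i ≤ -(2 * M) ∨ 2 * M ≤ i) : tent M i = 0 := by
  unfold tent
  rcases abs_cases i with h1 | h1 <;> omega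

theorem abs_tent_sub_le (M : ℕ) (i : ℤ) : |tent M i - tent M (i - 1)| ≤ 1 := by
  unfold tent
  rw [abs_le]
  rcases abs_cases i with h1 | h1 <;> rcases abs_cases (i - 1) with h2 | h2 <;> omega

theorem tent_second_diff_eq_zero {M : ℕ} {i : ℤ} (h0 : i ≠ 0) (h1 : i ≠ 2 * M) (h2 : i ≠ -(2 * M)) :
    tent M (i + 1) + tent M (i - 1) - 2 * tent M i = 0 := by
  unfold tent
  rcases abs_cases i with h3 | h3 <;> rcases abs_cases (i - 1) with h4 | h4 <;>
    rcases abs_cases (i + 1) with h5 | h5 <;> omega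

theorem abs_tent_second_diff_le (M : ℕ) (i : ℤ) :
    |tent M (i + 1) + tent M (i - 1) - 2 * tent M i| ≤ 2 := by
  have h1 := abs_le.1 (abs_tent_sub_le M i)
  have h2 := abs_le.1 (abs_tent_sub_le M (i + 1))
  rw [add_sub_cancel_right] at h2
  rw [abs_le]
  omega

/-- A cutoff function at scale `M`. -/
noncomputable def cutoff (M : ℕ) (c x : ℤ × ℤ) : ℝ :=
  tent M (x.1 - c.1) * tent M (x.2 - c.2) / M ^ 2

theorem cutoff_nonneg (M : ℕ) (c x : ℤ × ℤ) : 0 ≤ cutoff M c x := by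
  have h1 : (0 : ℝ) ≤ tent M (x.1 - c.1) := by exact_mod_cast tent_nonneg _ _
  have h2 : (0 : ℝ) ≤ tent M (x.2 - c.2) := by exact_mod_cast tent_nonneg _ _
  unfold cutoff
  positivity

theorem cutoff_le {M : ℕ} (hM : 1 ≤ M) (c x : ℤ × ℤ) : cutoff M c x ≤ 4 := by
  have hM0 : (0 : ℝ) < M := by exact_mod_cast hM
  have h1 : (0 : ℝ) ≤ tent M (x.2 - c.2) := by exact_mod_cast tent_nonneg _ _
  have h2 : (tent M (x.1 - c.1) : ℝ) ≤ 2 * M := by exact_mod_cast tent_le _ _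
  have h3 : (tent M (x.2 - c.2) : ℝ) ≤ 2 * M := by exact_mod_cast tent_le _ _
  unfold cutoff
  rw [div_le_iff₀ (by positivity)]
  calc _ ≤ (2 * M : ℝ) * (2 * M) := by gcongr
    _ = _ := by ring

theorem cutoff_eq_zero {M : ℕ} {c x : ℤ × ℤ} (hx : x ∉ openSquare c (2 * M)) :
    cutoff M c x = 0 := by
  rw [mem_openSquare] at hx
  unfold cutoff
  have : tent M (x.1 - c.1) = 0 ∨ tent M (x.2 - c.2) = 0 := by
    by_cases h : x.1 - c.1 ≤ -(2 * M) ∨ 2 * M ≤ x.1 - c.1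
    · exact Or.inl (tent_eq_zero h)
    · exact Or.inr (tent_eq_zero (by push_cast at hx; omega))
  rcases this with h | h <;> simp [h]

theorem one_le_cutoff {M : ℕ} (hM : 1 ≤ M) {c x : ℤ × ℤ} (hx : x ∈ closedSquare c M) :
    1 ≤ cutoff M c x := by
  rw [mem_closedSquare] at hx
  have hM0 : (0 : ℝ) < M := by exact_mod_cast hM
  have h1 : (M : ℝ) ≤ tent M (x.1 - c.1) := by
    exact_mod_cast le_tent (abs_le.2 ⟨by omega, by omega⟩)
  have h2 : (M : ℝ) ≤ tent M (x.2 - c.2) := by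
    exact_mod_cast le_tent (abs_le.2 ⟨by omega, by omega⟩)
  unfold cutoff
  rw [le_div_iff₀ (by positivity)]
  calc (1 : ℝ) * M ^ 2 = M * M := by ring
    _ ≤ _ := mul_le_mul h1 h2 hM0.le (hM0.le.trans h1)

theorem hasFiniteSupport_cutoff (M : ℕ) (c : ℤ × ℤ) : HasFiniteSupport (cutoff M c) :=
  (openSquare c (2 * M)).finite_toSet.subset fun x hx => by
    by_contra hc
    exact hx (cutoff_eq_zero hc)

theorem tsum_le_card_mul {g : ℤ × ℤ → ℝ} {B : ℝ} (S : Finset (ℤ × ℤ)) (hS : ∀ x, x ∉ S → g x = 0)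
    (hB : ∀ x, g x ≤ B) : ∑' x, g x ≤ S.card * B := by
  rw [tsum_eq_sum fun x hx => hS x hx, ← nsmul_eq_mul]
  exact Finset.sum_le_card_nsmul _ _ _ fun x _ => hB x

theorem abs_mul_div_le {a b : ℤ} {M A : ℕ} (hM : 1 ≤ M) (ha : |a| ≤ A) (hb0 : 0 ≤ b)
    (hb : b ≤ 2 * M) : |(a * b / M ^ 2 : ℝ)| ≤ 2 * A / M := by
  have hM0 : (0 : ℝ) < M := by exact_mod_cast hM
  have h1 : |(a : ℝ)| ≤ A := by exact_mod_cast ha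
  have h2 : |(b : ℝ)| ≤ 2 * M := by
    rw [abs_of_nonneg (by exact_mod_cast hb0)]
    exact_mod_cast hb
  rw [abs_div, abs_mul, abs_of_pos (by positivity : (0 : ℝ) < M ^ 2),
    div_le_div_iff₀ (by positivity) hM0]
  calc |(a : ℝ)| * |(b : ℝ)| * M ≤ A * (2 * M) * M := by gcongr
    _ = _ := by ring

/-- A tent is linear away from its three kinks, so a second difference lives on three lines, each
meeting the support in at most `4M` points. Its values are at most `2 · 2M / M² = 4 / M`, and `12 M
· 4 / M = 48`. -/
theorem tsum_abs_cutoff_second_diff_le {M : ℕ} (hM : 1 ≤ M) (c : ℤ × ℤ) :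
    ∑' x, |cutoff M c (x + dirX) + cutoff M c (x - dirX) - 2 * cutoff M c x| ≤ 48 ∧
    ∑' x, |cutoff M c (x + dirY) + cutoff M c (x - dirY) - 2 * cutoff M c x| ≤ 48 := by
  have hM0 : (0 : ℝ) < M := by exact_mod_cast hM
  have hcard : ∀ a : ℤ, (Finset.Ioo (a - 2 * M) (a + 2 * M)).card ≤ 4 * M := fun a => by
    rw [Int.card_Ioo]
    omega
  have hcard3 : ∀ a : ℤ, ({a, a + 2 * M, a - 2 * M} : Finset ℤ).card ≤ 3 := fun a =>
    Finset.card_le_three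
  have hfin : ∀ n : ℕ, n ≤ 12 * M → (n : ℝ) * (2 * (2 : ℕ) / M) ≤ 48 := fun n hn => by
    have : (n : ℝ) ≤ 12 * M := by exact_mod_cast hn
    rw [mul_div_assoc', div_le_iff₀ hM0]
    push_cast
    linarith
  constructor
  · have hform : ∀ x, cutoff M c (x + dirX) + cutoff M c (x - dirX) - 2 * cutoff M c x =
        ((tent M (x.1 - c.1 + 1) + tent M (x.1 - c.1 - 1) - 2 * tent M (x.1 - c.1) : ℤ) : ℝ) *
          (tent M (x.2 - c.2) : ℤ) / M ^ 2 := fun x => by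
      unfold cutoff
      simp only [Prod.fst_add, Prod.snd_add, Prod.fst_sub, Prod.snd_sub, add_zero, sub_zero]
      rw [show x.1 + 1 - c.1 = x.1 - c.1 + 1 by ring, show x.1 - 1 - c.1 = x.1 - c.1 - 1 by ring]
      push_cast
      ring
    simp_rw [hform]
    refine (tsum_le_card_mul
      (({c.1, c.1 + 2 * M, c.1 - 2 * M} : Finset ℤ) ×ˢ Finset.Ioo (c.2 - 2 * M) (c.2 + 2 * M))
      (fun x hx => ?_) fun x => abs_mul_div_le hM (abs_tent_second_diff_le M _)
        (tent_nonneg M _) (tent_le M _)).trans (hfin _ ?_)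
    · simp only [Finset.mem_product, Finset.mem_insert, Finset.mem_singleton,
        Finset.mem_Ioo] at hx
      by_cases h : x.2 - c.2 ≤ -(2 * M) ∨ 2 * M ≤ x.2 - c.2
      · simp [tent_eq_zero h]
      · rw [tent_second_diff_eq_zero (by omega) (by omega) (by omega)]
        simp
    · rw [Finset.card_product]
      calc _ ≤ 3 * (4 * M) := Nat.mul_le_mul (hcard3 _) (hcard _)
        _ = _ := by ring
  · have hform : ∀ x, cutoff M c (x + dirY) + cutoff M c (x - dirY) - 2 * cutoff M c x =
        ((tent M (x.2 - c.2 + 1) + tent M (x.2 - c.2 - 1) - 2 * tent M (x.2 - c.2) : ℤ) : ℝ) *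
          (tent M (x.1 - c.1) : ℤ) / M ^ 2 := fun x => by
      unfold cutoff
      simp only [Prod.fst_add, Prod.snd_add, Prod.fst_sub, Prod.snd_sub, add_zero, sub_zero]
      rw [show x.2 + 1 - c.2 = x.2 - c.2 + 1 by ring, show x.2 - 1 - c.2 = x.2 - c.2 - 1 by ring]
      push_cast
      ring
    simp_rw [hform]
    refine (tsum_le_card_mul
      (Finset.Ioo (c.1 - 2 * M) (c.1 + 2 * M) ×ˢ ({c.2, c.2 + 2 * M, c.2 - 2 * M} : Finset ℤ))
      (fun x hx => ?_) fun x => abs_mul_div_le hM (abs_tent_second_diff_le M _)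
        (tent_nonneg M _) (tent_le M _)).trans (hfin _ ?_)
    · simp only [Finset.mem_product, Finset.mem_insert, Finset.mem_singleton,
        Finset.mem_Ioo] at hx
      by_cases h : x.1 - c.1 ≤ -(2 * M) ∨ 2 * M ≤ x.1 - c.1
      · simp [tent_eq_zero h]
      · rw [tent_second_diff_eq_zero (by omega) (by omega) (by omega)]
        simp
    · rw [Finset.card_product]
      calc _ ≤ (4 * M) * 3 := Nat.mul_le_mul (hcard _) (hcard3 _)
        _ = _ := by ring

/-- The block of `N × N` lattice points whose lower left corner is next to `x`. -/
noncomputable def latticeBlock (x : ℤ × ℤ) (N : ℕ) : Finset (ℤ × ℤ) :=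
  Finset.Ioc x.1 (x.1 + N) ×ˢ Finset.Ioc x.2 (x.2 + N)

/-- A first difference of the cutoff is at most `2M / M² = 2 / M`. Backward differences of a
function supported in the open interval `(-2M, 2M)` live in `(-2M, 2M]`, which is why blocks are
half-open. -/
theorem tsum_mul_abs_cutoff_diff_le {M : ℕ} (hM : 1 ≤ M) (c : ℤ × ℤ) (w : ℤ × ℤ → ℝ) :
    ∑' x, |w x| * |cutoff M c x - cutoff M c (x - dirX)| ≤
      2 / M * ∑ x ∈ latticeBlock (c - ((2 * M : ℤ), (2 * M : ℤ))) (4 * M), |w x| ∧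
    ∑' x, |w x| * |cutoff M c x - cutoff M c (x - dirY)| ≤
      2 / M * ∑ x ∈ latticeBlock (c - ((2 * M : ℤ), (2 * M : ℤ))) (4 * M), |w x| := by
  have hb : ∀ a b : ℤ, 0 ≤ b → b ≤ 2 * M →
      |(((tent M a - tent M (a - 1) : ℤ) : ℝ) * (b : ℤ) / M ^ 2)| ≤ 2 / M := fun a b h0 h1 => by
    have := abs_mul_div_le (A := 1) hM (by simpa using abs_tent_sub_le M a) h0 h1
    simpa using this
  constructor
  · have hform : ∀ x, cutoff M c x - cutoff M c (x - dirX) =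
        ((tent M (x.1 - c.1) - tent M (x.1 - c.1 - 1) : ℤ) : ℝ) *
          (tent M (x.2 - c.2) : ℤ) / M ^ 2 := fun x => by
      unfold cutoff
      simp only [Prod.fst_sub, Prod.snd_sub, sub_zero]
      rw [show x.1 - 1 - c.1 = x.1 - c.1 - 1 by ring]
      push_cast
      ring
    simp_rw [hform]
    rw [tsum_eq_sum (s := latticeBlock (c - ((2 * M : ℤ), (2 * M : ℤ))) (4 * M)), Finset.mul_sum]
    · refine Finset.sum_le_sum fun x _ => ?_
      rw [mul_comm]
      exact mul_le_mul_of_nonneg_right (hb _ _ (tent_nonneg M _) (tent_le M _)) (abs_nonneg _)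
    · intro x hx
      simp only [latticeBlock, Finset.mem_product, Finset.mem_Ioc, Prod.fst_sub,
        Prod.snd_sub] at hx
      push_cast at hx
      by_cases h : x.2 - c.2 ≤ -(2 * M) ∨ 2 * M ≤ x.2 - c.2
      · simp [tent_eq_zero h]
      · rw [tent_eq_zero (i := x.1 - c.1) (by omega),
          tent_eq_zero (i := x.1 - c.1 - 1) (by omega)]
        simp
  · have hform : ∀ x, cutoff M c x - cutoff M c (x - dirY) =
        ((tent M (x.2 - c.2) - tent M (x.2 - c.2 - 1) : ℤ) : ℝ) *
          (tent M (x.1 - c.1) : ℤ) / M ^ 2 := fun x => by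
      unfold cutoff
      simp only [Prod.fst_sub, Prod.snd_sub, sub_zero]
      rw [show x.2 - 1 - c.2 = x.2 - c.2 - 1 by ring]
      push_cast
      ring
    simp_rw [hform]
    rw [tsum_eq_sum (s := latticeBlock (c - ((2 * M : ℤ), (2 * M : ℤ))) (4 * M)), Finset.mul_sum]
    · refine Finset.sum_le_sum fun x _ => ?_
      rw [mul_comm]
      exact mul_le_mul_of_nonneg_right (hb _ _ (tent_nonneg M _) (tent_le M _)) (abs_nonneg _)
    · intro x hx
      simp only [latticeBlock, Finset.mem_product, Finset.mem_Ioc, Prod.fst_sub,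
        Prod.snd_sub] at hx
      push_cast at hx
      by_cases h : x.1 - c.1 ≤ -(2 * M) ∨ 2 * M ≤ x.1 - c.1
      · simp [tent_eq_zero h]
      · rw [tent_eq_zero (i := x.2 - c.2) (by omega),
          tent_eq_zero (i := x.2 - c.2 - 1) (by omega)]
        simp

/-- A bound for the `ℓ¹` norm of the generator applied to a function. -/
theorem tsum_abs_latticeGenerator_le (hf : f.HasFiniteSupport) :
    ∑' x, |latticeGenerator p q f x| ≤
      ∑' x, |f (x + dirX) + f (x - dirX) - 2 * f x| +
      ∑' x, |f (x + dirY) + f (x - dirY) - 2 * f x| +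
      2 * (∑' x, |p x| * |f x - f (x - dirX)| + ∑' x, |q x| * |f x - f (x - dirY)|) := by
  have hs : ∀ {g : ℤ × ℤ → ℝ}, g.HasFiniteSupport → Summable g := fun h =>
    summable_of_hasFiniteSupport h
  have hpt : ∀ x, |latticeGenerator p q f x| ≤
      |f (x + dirX) + f (x - dirX) - 2 * f x| + |f (x + dirY) + f (x - dirY) - 2 * f x| +
      (|p (x + dirX)| * |f (x + dirX) - f x| + |p x| * |f x - f (x - dirX)|) +
      (|q (x + dirY)| * |f (x + dirY) - f x| + |q x| * |f x - f (x - dirY)|) := by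
    intro x
    have : latticeGenerator p q f x = (f (x + dirX) + f (x - dirX) - 2 * f x) +
        (f (x + dirY) + f (x - dirY) - 2 * f x) +
        (-(p (x + dirX) * (f (x + dirX) - f x)) - p x * (f x - f (x - dirX))) +
        (-(q (x + dirY) * (f (x + dirY) - f x)) - q x * (f x - f (x - dirY))) := by
      unfold latticeGenerator
      ring
    rw [this]
    simp only [← abs_mul]
    refine (abs_add_le _ _).trans (add_le_add ((abs_add_le _ _).trans (add_le_add
      (abs_add_le _ _) ?_)) ?_)
    · exact (abs_sub _ _).trans (by rw [abs_neg])
    · exact (abs_sub _ _).trans (by rw [abs_neg])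
  refine (Summable.tsum_le_tsum hpt (hs (by
    fun_prop (disch := first | exact add_left_injective _ | exact sub_left_injective))) (hs (by
    fun_prop (disch := first | exact add_left_injective _ | exact sub_left_injective)))).trans ?_
  have e1 : ∑' x, |p (x + dirX)| * |f (x + dirX) - f x| =
      ∑' x, |p x| * |f x - f (x - dirX)| := by
    rw [← tsum_comp_add (fun x => |p x| * |f x - f (x - dirX)|) dirX]
    simp only [add_sub_cancel_right]
  have e2 : ∑' x, |q (x + dirY)| * |f (x + dirY) - f x| =
      ∑' x, |q x| * |f x - f (x - dirY)| := by
    rw [← tsum_comp_add (fun x => |q x| * |f x - f (x - dirY)|) dirY]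
    simp only [add_sub_cancel_right]
  rw [Summable.tsum_add, Summable.tsum_add, Summable.tsum_add, Summable.tsum_add,
    Summable.tsum_add, e1, e2]
  · linarith
  all_goals exact hs (by
    fun_prop (disch := first | exact add_left_injective _ | exact sub_left_injective))

/-- The local energy estimate. -/
theorem IsLatticeFlux.local_energy_le (h : IsLatticeFlux p q) {M : ℕ} (hM : 1 ≤ M) {c : ℤ × ℤ}
    {A F U : ℝ} (hF : 0 ≤ F) (hA : ∀ x, |f x| ≤ A)
    (hL : ∀ x ∈ openSquare c (2 * M), |latticeGenerator p q f x| ≤ F)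
    (hU : ∀ x, ∑ y ∈ latticeBlock x (4 * M), (|p y| + |q y|) ≤ (4 * M : ℕ) * U) :
    ∑ x ∈ closedSquare c M, ((f (x + dirX) - f x) ^ 2 + (f (x + dirY) - f x) ^ 2) ≤
      A ^ 2 * (192 + 32 * U) + 256 * A * F * M ^ 2 := by
  have hM0 : (0 : ℝ) < M := by exact_mod_cast hM
  have hA0 : 0 ≤ A := (abs_nonneg _).trans (hA 0)
  set η := cutoff M c with hη
  have hηf : η.HasFiniteSupport := hasFiniteSupport_cutoff M c
  have hs : ∀ {g : ℤ × ℤ → ℝ}, g.HasFiniteSupport → Summable g := fun h =>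
    summable_of_hasFiniteSupport h
  -- Testing the adjoint relation with `η` and `f²` expresses the localised energy through `f²`
  -- times the adjoint generator of `η`. The drift therefore meets only the bounded function `f²`
  -- and the cutoff, and its `ℓ¹` norm suffices.
  have hadj := tsum_mul_latticeGenerator (g := fun x => f x ^ 2) h.neg hηf
  simp only [neg_neg, latticeGenerator_sq] at hadj
  -- The two second differences give `48 + 48`; the drift gives `2 · (2 / M) · 4M · U = 16 U`.
  have hLη : ∑' x, |latticeGenerator (-p) (-q) η x| ≤ 96 + 16 * U := by
    have h1 := tsum_abs_cutoff_second_diff_le hM c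
    have h2 := (tsum_mul_abs_cutoff_diff_le hM c p).1
    have h3 := (tsum_mul_abs_cutoff_diff_le hM c q).2
    have h4 := hU (c - ((2 * M : ℤ), (2 * M : ℤ)))
    rw [Finset.sum_add_distrib] at h4
    have h5 := tsum_abs_latticeGenerator_le (p := -p) (q := -q) hηf
    simp only [Pi.neg_apply, abs_neg] at h5
    have h6 := mul_le_mul_of_nonneg_left h4 (show 0 ≤ 2 / (M : ℝ) by positivity)
    have h7 : 2 / (M : ℝ) * (((4 * M : ℕ) : ℝ) * U) = 8 * U := by
      push_cast
      field_simp
      ring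
    rw [h7] at h6
    linarith [h1.1, h1.2]
  have h1 : ∑' x, f x ^ 2 * latticeGenerator (-p) (-q) η x ≤ A ^ 2 * (96 + 16 * U) := by
    calc ∑' x, f x ^ 2 * latticeGenerator (-p) (-q) η x
        ≤ ∑' x, A ^ 2 * |latticeGenerator (-p) (-q) η x| := by
          refine Summable.tsum_le_tsum (fun x => ?_) (hs (by fun_prop)) (hs (by fun_prop))
          have h1 : f x ^ 2 ≤ A ^ 2 := sq_le_sq' (abs_le.1 (hA x)).1 (abs_le.1 (hA x)).2
          calc _ ≤ f x ^ 2 * |latticeGenerator (-p) (-q) η x| :=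
                mul_le_mul_of_nonneg_left (le_abs_self _) (sq_nonneg _)
            _ ≤ _ := mul_le_mul_of_nonneg_right h1 (abs_nonneg _)
      _ = A ^ 2 * ∑' x, |latticeGenerator (-p) (-q) η x| := tsum_mul_left
      _ ≤ _ := by gcongr
  -- The cutoff is at most `4` and its support has at most `4 (2M)²` points, so the bound is `2 · 4
  -- · A F · 16 M²`.
  have h2 : -∑' x, η x * (2 * (f x * latticeGenerator p q f x)) ≤ 128 * A * F * M ^ 2 := by
    rw [← tsum_neg]
    refine (tsum_le_card_mul (B := 8 * A * F) (openSquare c (2 * M)) (fun x hx => ?_)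
      fun x => ?_).trans ?_
    · rw [hη, cutoff_eq_zero hx]
      simp
    · by_cases hx : x ∈ openSquare c (2 * M)
      · have k1 := cutoff_le hM c x
        have k2 := cutoff_nonneg M c x
        have k3 : |f x * latticeGenerator p q f x| ≤ A * F := by
          rw [abs_mul]
          exact mul_le_mul (hA x) (hL x hx) (abs_nonneg _) hA0
        have k4 : -(η x * (2 * (f x * latticeGenerator p q f x))) =
          2 * (η x * -(f x * latticeGenerator p q f x)) := by ring
        rw [k4]
        have k5 : η x * -(f x * latticeGenerator p q f x) ≤ 4 * (A * F) :=
          (mul_le_mul_of_nonneg_left ((neg_le_abs _).trans k3) k2).trans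
            (mul_le_mul_of_nonneg_right k1 (by positivity))
        linarith
      · rw [hη, cutoff_eq_zero hx]
        simp only [zero_mul, neg_zero]
        positivity
    · have k1 : ((openSquare c (2 * M)).card : ℝ) ≤ 4 * (2 * M : ℕ) ^ 2 := by
        exact_mod_cast card_openSquare_le c (2 * M)
      calc _ ≤ 4 * ((2 * M : ℕ) : ℝ) ^ 2 * (8 * A * F) := by gcongr
        _ = _ := by push_cast; ring
  have h3 : ∑ x ∈ closedSquare c M, 1 / 2 *
      ((f (x + dirX) - f x) ^ 2 + (f (x + dirY) - f x) ^ 2) ≤ ∑' x, η x * carreDuChamp p q f x := by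
    have hΓ0 : ∀ x, 0 ≤ carreDuChamp p q f x := fun x =>
      le_trans (by positivity) (h.carreDuChamp_ge f x)
    calc _ ≤ ∑ x ∈ closedSquare c M, η x * carreDuChamp p q f x := by
          refine Finset.sum_le_sum fun x hx => ?_
          calc _ ≤ 1 * carreDuChamp p q f x := by
                rw [one_mul]
                refine le_trans ?_ (h.carreDuChamp_ge f x)
                have := sq_nonneg (f (x - dirX) - f x)
                have := sq_nonneg (f (x - dirY) - f x)
                linarith
            _ ≤ _ := mul_le_mul_of_nonneg_right (one_le_cutoff hM hx) (hΓ0 x)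
      _ ≤ _ := (hs (by fun_prop)).sum_le_tsum _ fun x _ => mul_nonneg (cutoff_nonneg M c x) (hΓ0 x)
  have h4 : ∑' x, f x ^ 2 * latticeGenerator (-p) (-q) η x =
      ∑' x, η x * (2 * (f x * latticeGenerator p q f x)) + ∑' x, η x * carreDuChamp p q f x := by
    rw [hadj, ← Summable.tsum_add (hs (by fun_prop)) (hs (by fun_prop))]
    exact tsum_congr fun x => by ring
  rw [← Finset.mul_sum] at h3
  linarith

/-- The logarithmic modulus of continuity on the lattice of mesh `1 / N`, `N = 4M`. -/
theorem IsLatticeFlux.abs_sub_le_div_sqrt_log (h : IsLatticeFlux p q) {M : ℕ} (hM : 1 ≤ M)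
    {c y : ℤ × ℤ} {A Φ U : ℝ} (hΦ : 0 ≤ Φ) (hU0 : 0 ≤ U) (hA : ∀ x, |f x| ≤ A)
    (hL : ∀ x ∈ openSquare c (2 * M), |latticeGenerator p q f x| ≤ Φ / (4 * M : ℕ) ^ 2)
    (hU : ∀ x, ∑ y ∈ latticeBlock x (4 * M), (|p y| + |q y|) ≤ (4 * M : ℕ) * U)
    {k : ℕ} (hk : 1 ≤ k) (hkM : 4 * k ≤ M) (hy : y ∈ closedSquare c k) :
    |f c - f y| ≤ (128 * Φ + √(128 * (A ^ 2 * (192 + 32 * U) + 16 * A * Φ))) /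
      √(-Real.log (k / (4 * M : ℕ))) := by
  set N : ℝ := ((4 * M : ℕ) : ℝ) with hN
  have hM0 : (0 : ℝ) < M := by exact_mod_cast hM
  have hNM : N = 4 * M := by rw [hN]; push_cast; ring
  have hN0 : 0 < N := by rw [hNM]; positivity
  have hk0 : (0 : ℝ) < k := by exact_mod_cast hk
  have hkM' : 4 * (k : ℝ) ≤ M := by exact_mod_cast hkM
  have hA0 : 0 ≤ A := (abs_nonneg _).trans (hA 0)
  set ρ : ℝ := k / N with hρ
  have hρ0 : 0 < ρ := by positivity
  have hρN : ρ * N = k := by rw [hρ]; field_simp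
  have hρ16 : ρ ≤ 1 / 16 := by
    rw [hρ, div_le_iff₀ hN0, hNM]
    linarith
  -- The outer radius is the geometric mean of `k` and `N`, up to rounding. It is large enough for
  -- `log ((R + 1) / k)` to be half of `-log ρ`, and small enough for the error `R² Φ / N² ≤ ρ Φ` to
  -- be negligible.
  set R : ℕ := ⌊√ρ * N⌋₊ with hR
  have hsρ : √ρ ≤ 1 / 4 := by
    rw [Real.sqrt_le_left (by norm_num)]
    linarith
  have hsρ0 : 0 < √ρ := Real.sqrt_pos.2 hρ0
  have hRle : (R : ℝ) ≤ √ρ * N := Nat.floor_le (by positivity)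
  have hRlt : √ρ * N < R + 1 := Nat.lt_floor_add_one _
  have hRM : R ≤ M := by
    have : (R : ℝ) ≤ M := hRle.trans (by rw [hNM]; nlinarith)
    exact_mod_cast this
  have hss : √ρ * √ρ = ρ := Real.mul_self_sqrt hρ0.le
  have hkR : k ≤ R := by
    refine Nat.le_floor ?_
    rw [← hρN]
    refine mul_le_mul_of_nonneg_right ?_ hN0.le
    nlinarith
  have hlogpos : 0 < -Real.log ρ := by
    have := Real.log_neg hρ0 (by linarith)
    linarith
  have hlog : 1 / 2 * -Real.log ρ ≤ Real.log ((R + 1) / k) := by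
    have h1 : 1 / √ρ ≤ ((R : ℝ) + 1) / k := by
      rw [div_le_div_iff₀ hsρ0 hk0, one_mul, ← hρN]
      calc ρ * N = (√ρ * N) * √ρ := by linear_combination (-N) * hss
        _ ≤ _ := by gcongr
    have h2 := Real.log_le_log (by positivity) h1
    rw [one_div, Real.log_inv, Real.log_sqrt hρ0.le] at h2
    linarith
  have hF : 0 ≤ Φ / N ^ 2 := by positivity
  set G := A ^ 2 * (192 + 32 * U) + 16 * A * Φ with hG
  have hG0 : 0 ≤ G := by positivity
  have hen : ∑ x ∈ closedSquare c R, ((f (x + dirX) - f x) ^ 2 + (f (x + dirY) - f x) ^ 2) ≤ G := by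
    refine (Finset.sum_le_sum_of_subset_of_nonneg (closedSquare_subset c hRM)
      fun _ _ _ => by positivity).trans ((h.local_energy_le hM hF hA hL hU).trans (le_of_eq ?_))
    rw [hG, hNM]
    field_simp
    ring
  have hcc : c ∈ closedSquare c k := by
    rw [mem_closedSquare]
    omega
  have hmain := h.sq_mul_log_le hk hkR hF
    (fun x hx => hL x (openSquare_subset c (by omega) hx)) hen hcc hy
  set o := max (|f c - f y| - 128 * (R : ℝ) ^ 2 * (Φ / N ^ 2)) 0 with ho
  have ho2 : o ^ 2 * -Real.log ρ ≤ 128 * G := by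
    have := mul_le_mul_of_nonneg_left hlog (sq_nonneg o)
    linarith
  have hs0 : 0 < √(-Real.log ρ) := Real.sqrt_pos.2 hlogpos
  have ho3 : o ≤ √(128 * G) / √(-Real.log ρ) := by
    rw [le_div_iff₀ hs0]
    refine Real.le_sqrt_of_sq_le ?_
    rwa [mul_pow, Real.sq_sqrt hlogpos.le]
  -- The error from the right-hand side fits under the logarithmic modulus because `ρ √(-log ρ) ≤ √ρ
  -- ≤ 1`.
  have hRΦ : 128 * (R : ℝ) ^ 2 * (Φ / N ^ 2) ≤ 128 * Φ / √(-Real.log ρ) := by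
    have h1 : (R : ℝ) ^ 2 ≤ ρ * N ^ 2 := by
      calc (R : ℝ) ^ 2 ≤ (√ρ * N) ^ 2 := by gcongr
        _ = ρ * N ^ 2 := by rw [mul_pow, Real.sq_sqrt hρ0.le]
    have h2 : ρ * √(-Real.log ρ) ≤ 1 := by
      have h3 : -Real.log ρ ≤ 1 / ρ := by
        have := Real.log_le_sub_one_of_pos (show 0 < 1 / ρ by positivity)
        rw [one_div, Real.log_inv] at this
        rw [one_div]
        linarith
      have h4 : ρ * √(-Real.log ρ) ≤ ρ * √(1 / ρ) := by gcongr
      refine h4.trans ?_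
      have h5 : ρ * √(1 / ρ) = √ρ := by
        rw [one_div, Real.sqrt_inv, ← hss]
        field_simp
        rw [Real.sqrt_sq hsρ0.le]
      rw [h5]
      linarith
    rw [le_div_iff₀ hs0]
    calc _ ≤ 128 * (ρ * N ^ 2) * (Φ / N ^ 2) * √(-Real.log ρ) := by gcongr
      _ = 128 * Φ * (ρ * √(-Real.log ρ)) := by field_simp
      _ ≤ 128 * Φ * 1 := by gcongr
      _ = _ := by ring
  have hfin : |f c - f y| ≤ o + 128 * (R : ℝ) ^ 2 * (Φ / N ^ 2) := by
    have := le_max_left (|f c - f y| - 128 * (R : ℝ) ^ 2 * (Φ / N ^ 2)) 0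
    linarith
  rw [add_div]
  linarith

/-- The discrete parabolic problem with Dirichlet conditions outside a finite set. -/
noncomputable def latticeSolution (p q f : ℤ × ℤ → ℝ) (S : Finset (ℤ × ℤ)) (t : ℝ) :
    ℤ × ℤ → ℝ :=
  extendZero S ((matrixSemigroup (restrictedGenerator p q S) t).mulVec fun x => f x)

variable {S : Finset (ℤ × ℤ)}

theorem latticeSolution_zero {x : ℤ × ℤ} (hx : x ∈ S) : latticeSolution p q f S 0 x = f x := by
  simp [latticeSolution, extendZero, hx, matrixSemigroup_zero]

theorem latticeSolution_of_notMem {x : ℤ × ℤ} (hx : x ∉ S) (t : ℝ) :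
    latticeSolution p q f S t x = 0 :=
  extendZero_of_notMem _ hx

theorem IsLatticeFlux.abs_latticeSolution_le (h : IsLatticeFlux p q) {A : ℝ}
    (hA : ∀ x, |f x| ≤ A) {t : ℝ} (ht : 0 ≤ t) (x : ℤ × ℤ) :
    |latticeSolution p q f S t x| ≤ A := by
  have hA0 : 0 ≤ A := (abs_nonneg _).trans (hA 0)
  by_cases hx : x ∈ S
  · rw [latticeSolution, extendZero_coe _ ⟨x, hx⟩]
    exact (h.isSubMarkov S).abs_mulVec_le ht (fun y => hA y) hA0 _
  · rw [latticeSolution_of_notMem hx, abs_zero]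
    exact hA0

theorem hasDerivAt_latticeSolution (p q f : ℤ × ℤ → ℝ) {x : ℤ × ℤ} (hx : x ∈ S) (t : ℝ) :
    HasDerivAt (fun s => latticeSolution p q f S s x)
      (latticeGenerator p q (latticeSolution p q f S t) x) t := by
  have := hasDerivAt_matrixSemigroup_mulVec (restrictedGenerator p q S) (fun x => f x) t ⟨x, hx⟩
  rw [restrictedGenerator_mulVec] at this
  refine this.congr_of_eventuallyEq (Filter.Eventually.of_forall fun s => ?_)
  exact extendZero_coe _ ⟨x, hx⟩

/-- Since the drift does not depend on time, the time derivative decays like the solution. -/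
theorem IsLatticeFlux.abs_latticeGenerator_latticeSolution_le (h : IsLatticeFlux p q)
    (hf : f.HasFiniteSupport) (hfS : ∀ x, x ∉ S → f x = 0) {t : ℝ} (ht : 0 < t) {x : ℤ × ℤ}
    (hx : x ∈ S) : |latticeGenerator p q (latticeSolution p q f S t) x| ≤
      4 / t * ∑' y, |latticeGenerator p q f y| := by
  have hext : extendZero S (fun y => f y) = f := by
    funext y
    by_cases hy : y ∈ S
    · exact extendZero_coe _ ⟨y, hy⟩
    · rw [extendZero_of_notMem _ hy, hfS y hy]
  -- The decay estimate is applied to the generator of the initial value; the matrix then commutes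
  -- past its semigroup. As `f` vanishes off `S`, the Dirichlet generator agrees with the full one
  -- on `f`.
  have h1 := (h.isSubMarkov S).abs_mulVec_le_div (by norm_num : (0 : ℝ) < 4)
    (h.nashInequality S) ht ((restrictedGenerator p q S).mulVec fun y => f y) ⟨x, hx⟩
  rw [Matrix.mulVec_mulVec, ← matrixSemigroup_commute, ← Matrix.mulVec_mulVec,
    restrictedGenerator_mulVec] at h1
  refine h1.trans (mul_le_mul_of_nonneg_left ?_ (by positivity))
  simp only [restrictedGenerator_mulVec, hext]
  rw [Finset.sum_coe_sort S fun y => |latticeGenerator p q f y|]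
  exact (summable_of_hasFiniteSupport (by fun_prop)).sum_le_tsum _ fun _ _ => abs_nonneg _

end LatticeEnergy

/-! ### Mollification of the drift and of the initial value. -/

section Mollification

open Function Convolution

/-- The convolution `η * f`. -/
noncomputable def mollify (η f : Plane → ℝ) (x : Plane) : ℝ := ∫ y, η (x - y) * f y

/-- A smooth probability density supported in the ball of radius `ε`. -/
structure IsMollifier (η : Plane → ℝ) (ε : ℝ) : Prop where
  contDiff : ContDiff ℝ ∞ η
  nonneg : ∀ x, 0 ≤ η x
  eq_zero : ∀ x, ε ≤ ‖x‖ → η x = 0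
  integral_eq : ∫ x, η x = 1

theorem exists_isMollifier {ε : ℝ} (hε : 0 < ε) : ∃ η, IsMollifier η ε := by
  let φ : ContDiffBump (0 : Plane) := ⟨ε / 2, ε, half_pos hε, half_lt_self hε⟩
  refine ⟨φ.normed volume, φ.contDiff_normed, φ.nonneg_normed, fun x hx => ?_, φ.integral_normed⟩
  have h : x ∉ support (φ.normed volume) := by
    rw [φ.support_normed_eq]
    simpa using hx
  simpa using h

variable {η f g : Plane → ℝ} {ε : ℝ}

theorem hasCompactSupport_of_eq_zero (h : ∀ x, ε ≤ ‖x‖ → η x = 0) : HasCompactSupport η :=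
  HasCompactSupport.intro (isCompact_closedBall (0 : Plane) ε) fun x hx =>
    h x (by simpa using (not_le.1 (fun hc => hx (by simpa using hc))).le)

theorem IsMollifier.hasCompactSupport (h : IsMollifier η ε) : HasCompactSupport η :=
  hasCompactSupport_of_eq_zero h.eq_zero

theorem mollify_eq_convolution (η f : Plane → ℝ) :
    mollify η f = η ⋆[ContinuousLinearMap.lsmul ℝ ℝ, volume] f := by
  funext x
  rw [convolution_lsmul_swap]
  rfl

theorem mollify_eq_integral_sub (η f : Plane → ℝ) (x : Plane) :
    mollify η f x = ∫ t, η t * f (x - t) := by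
  rw [mollify_eq_convolution, convolution_lsmul]
  rfl

theorem contDiff_mollify (hη : ContDiff ℝ ∞ η) (hc : HasCompactSupport η)
    (hf : LocallyIntegrable f) : ContDiff ℝ ∞ (mollify η f) := by
  rw [mollify_eq_convolution]
  exact hc.contDiff_convolution_left _ hη hf

theorem integrable_mollify_integrand (hη : Continuous η) (hc : HasCompactSupport η)
    (hf : LocallyIntegrable f) (x : Plane) : Integrable fun y => η (x - y) * f y := by
  have h : HasCompactSupport fun y => η (x - y) :=
    hc.comp_homeomorph (Homeomorph.subLeft x)
  have h2 := hf.integrable_smul_left_of_hasCompactSupport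
    (g := fun y => η (x - y)) (by fun_prop) h
  simpa using h2

theorem contDiff_partialDeriv (hη : ContDiff ℝ ∞ η) (i : Fin 2) :
    ContDiff ℝ ∞ (partialDeriv i η) :=
  (hη.fderiv_right (m := ∞) (by simp)).clm_apply contDiff_const

theorem partialDeriv_eq_zero (h : ∀ x, ε ≤ ‖x‖ → η x = 0) {x : Plane} (hx : ε < ‖x‖) (i : Fin 2) :
    partialDeriv i η x = 0 := by
  have : η =ᶠ[nhds x] fun _ => 0 := by
    filter_upwards [(isOpen_lt continuous_const continuous_norm).mem_nhds hx] with y hy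
    exact h y (le_of_lt hy)
  unfold partialDeriv
  rw [this.fderiv_eq]
  simp

theorem hasCompactSupport_partialDeriv (hc : HasCompactSupport η) (i : Fin 2) :
    HasCompactSupport (partialDeriv i η) :=
  (hc.fderiv ℝ).comp_left (g := fun L : Plane →L[ℝ] ℝ => L (EuclideanSpace.single i 1)) (by simp)

theorem partialDeriv_mollify (hη : ContDiff ℝ ∞ η) (hc : HasCompactSupport η)
    (hf : LocallyIntegrable f) (i : Fin 2) :
    partialDeriv i (mollify η f) = mollify (partialDeriv i η) f := by
  funext x
  have h1 := hc.hasFDerivAt_convolution_left (ContinuousLinearMap.lsmul ℝ ℝ)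
    (hη.of_le (by simp)) hf (μ := volume) x
  have hex := (hc.fderiv ℝ).convolutionExists_left
    ((ContinuousLinearMap.lsmul ℝ ℝ : ℝ →L[ℝ] ℝ →L[ℝ] ℝ).precompL Plane)
    (hη.continuous_fderiv (by simp)) hf x
  rw [mollify_eq_convolution (partialDeriv i η), mollify_eq_convolution]
  unfold partialDeriv
  rw [h1.fderiv]
  unfold convolution
  rw [ContinuousLinearMap.integral_apply hex]
  rfl

theorem multiDeriv_mollify (hη : ContDiff ℝ ∞ η) (hc : HasCompactSupport η)
    (hf : LocallyIntegrable f) (α : ℕ × ℕ) :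
    multiDeriv α (mollify η f) = mollify (multiDeriv α η) f ∧ ContDiff ℝ ∞ (multiDeriv α η) ∧
      HasCompactSupport (multiDeriv α η) := by
  have key : ∀ (i : Fin 2) (n : ℕ) (η : Plane → ℝ), ContDiff ℝ ∞ η → HasCompactSupport η →
      (partialDeriv i)^[n] (mollify η f) = mollify ((partialDeriv i)^[n] η) f ∧
      ContDiff ℝ ∞ ((partialDeriv i)^[n] η) ∧ HasCompactSupport ((partialDeriv i)^[n] η) := by
    intro i n
    induction n with
    | zero => intro η hη hc; exact ⟨rfl, hη, hc⟩
    | succ n ih =>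
      intro η hη hc
      simp only [Function.iterate_succ, Function.comp]
      rw [partialDeriv_mollify hη hc hf]
      exact ih _ (contDiff_partialDeriv hη i) (hasCompactSupport_partialDeriv hc i)
  obtain ⟨h1, h2, h3⟩ := key 1 α.2 η hη hc
  obtain ⟨h4, h5, h6⟩ := key 0 α.1 _ h2 h3
  refine ⟨?_, h5, h6⟩
  unfold multiDeriv
  rw [h1, h4]

theorem partialDeriv_const_mul_comp_sub (hη : ContDiff ℝ ∞ η) (c : ℝ) (x : Plane) (i : Fin 2) :
    partialDeriv i (fun y => c * η (x - y)) = fun y => -c * partialDeriv i η (x - y) := by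
  funext y
  have h1 : HasFDerivAt η (fderiv ℝ η (x - y)) (x - y) :=
    (hη.differentiable (by simp)).differentiableAt.hasFDerivAt
  have h2 : HasFDerivAt (fun y => x - y) (-ContinuousLinearMap.id ℝ Plane) y :=
    (hasFDerivAt_id y).const_sub x
  have h3 := (h1.comp y h2).const_mul c
  unfold partialDeriv
  rw [show (fun y => c * η (x - y)) = fun y => c * (η ∘ fun y => x - y) y from rfl, h3.fderiv]
  simp

theorem multiDeriv_comp_sub (hη : ContDiff ℝ ∞ η) (x : Plane)
    (α : ℕ × ℕ) : multiDeriv α (fun y => η (x - y)) =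
      fun y => (-1) ^ (α.1 + α.2) * multiDeriv α η (x - y) := by
  have key : ∀ (i : Fin 2) (n : ℕ) (η : Plane → ℝ) (c : ℝ), ContDiff ℝ ∞ η →
      (partialDeriv i)^[n] (fun y => c * η (x - y)) =
        (fun y => (-1) ^ n * c * (partialDeriv i)^[n] η (x - y)) ∧
      ContDiff ℝ ∞ ((partialDeriv i)^[n] η) := by
    intro i n
    induction n with
    | zero => intro η c hη; exact ⟨by simp, hη⟩
    | succ n ih =>
      intro η c hη
      simp only [Function.iterate_succ, Function.comp]
      rw [partialDeriv_const_mul_comp_sub hη]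
      obtain ⟨h1, h2⟩ := ih (partialDeriv i η) (-c) (contDiff_partialDeriv hη i)
      refine ⟨?_, h2⟩
      rw [h1]
      funext y
      ring
  obtain ⟨h1, h2⟩ := key 1 α.2 η 1 hη
  obtain ⟨h3, -⟩ := key 0 α.1 _ ((-1) ^ α.2 * 1) h2
  unfold multiDeriv
  rw [show (fun y => η (x - y)) = fun y => 1 * η (x - y) by simp, h1, h3]
  funext y
  ring

/-- The weak derivative is tested with `y ↦ η (x - y)`; the sign from reflecting `η` cancels the
sign from integrating by parts. Mollifications thus inherit the `L¹` bounds of the weak derivatives.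
-/
theorem multiDeriv_mollify_of_isWeakDeriv (hη : ContDiff ℝ ∞ η) (hc : HasCompactSupport η)
    {α : ℕ × ℕ} (h : IsWeakDeriv α f g) : multiDeriv α (mollify η f) = mollify η g := by
  rw [(multiDeriv_mollify hη hc h.locallyIntegrable_left α).1]
  funext x
  have h1 := h.integral_eq (fun y => η (x - y)) (hη.comp (contDiff_const.sub contDiff_id))
    (hc.comp_homeomorph (Homeomorph.subLeft x))
  rw [multiDeriv_comp_sub hη] at h1
  have h2 : ∫ y, f y * ((-1) ^ (α.1 + α.2) * multiDeriv α η (x - y)) =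
      (-1) ^ (α.1 + α.2) * mollify (multiDeriv α η) f x := by
    unfold mollify
    rw [← integral_const_mul]
    congr 1
    funext y
    ring
  rw [h2] at h1
  have h3 := mul_left_cancel₀ (pow_ne_zero _ (by norm_num : (-1 : ℝ) ≠ 0)) h1
  rw [h3]
  unfold mollify
  congr 1
  funext y
  ring

/-- A mollification is an average of translates by vectors shorter than `ε`, so Tonelli reduces the
bound to translates. The set `A` is left free to cover the global norm, the norm on unit balls and
local convergence. -/
theorem lintegral_mollify_le (h : IsMollifier η ε) (hf : AEStronglyMeasurable f volume)
    {A : Set Plane} {C : ℝ≥0∞} (hC : ∀ t : Plane, ‖t‖ < ε → ∫⁻ x in A, ‖f (x - t)‖ₑ ≤ C) :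
    ∫⁻ x in A, ‖mollify η f x‖ₑ ≤ C := by
  have hη1 : ∫⁻ t, ‖η t‖ₑ = 1 := by
    have : ∫⁻ t, ‖η t‖ₑ = ∫⁻ t, ENNReal.ofReal (η t) := by
      refine lintegral_congr fun t => ?_
      rw [Real.enorm_eq_ofReal (h.nonneg t)]
    rw [this, ← ofReal_integral_eq_lintegral_ofReal
      (h.contDiff.continuous.integrable_of_hasCompactSupport h.hasCompactSupport)
      (Filter.Eventually.of_forall h.nonneg), h.integral_eq, ENNReal.ofReal_one]
  have hmeas : AEStronglyMeasurable (fun p : Plane × Plane => η p.2 * f (p.1 - p.2))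
      ((volume.restrict A).prod volume) := by
    have := AEStronglyMeasurable.convolution_integrand (ContinuousLinearMap.lsmul ℝ ℝ)
      (μ := volume) (ν := volume) h.contDiff.continuous.aestronglyMeasurable hf
    exact this.mono_ac ((Measure.restrict_le_self.absolutelyContinuous).prod
      Measure.AbsolutelyContinuous.rfl)
  calc ∫⁻ x in A, ‖mollify η f x‖ₑ ≤ ∫⁻ x in A, ∫⁻ t, ‖η t * f (x - t)‖ₑ := by
        refine lintegral_mono fun x => ?_
        rw [mollify_eq_integral_sub]
        exact enorm_integral_le_lintegral_enorm _
    _ = ∫⁻ t, ∫⁻ x in A, ‖η t * f (x - t)‖ₑ := lintegral_lintegral_swap hmeas.enorm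
    _ ≤ ∫⁻ t, ‖η t‖ₑ * C := by
        refine lintegral_mono fun t => ?_
        simp only [enorm_mul]
        rw [lintegral_const_mul' _ _ enorm_ne_top]
        by_cases ht : ‖t‖ < ε
        · exact mul_le_mul_right (hC t ht) _
        · rw [h.eq_zero t (not_lt.1 ht)]
          simp
    _ = C := by
        rw [lintegral_mul_const'' _ h.contDiff.continuous.aemeasurable.enorm, hη1, one_mul]

theorem lintegral_enorm_mollify_le (h : IsMollifier η ε) (hf : AEStronglyMeasurable f volume) :
    ∫⁻ x, ‖mollify η f x‖ₑ ≤ ∫⁻ x, ‖f x‖ₑ := by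
  have := lintegral_mollify_le h hf (A := univ) (C := ∫⁻ x, ‖f x‖ₑ) fun t _ => by
    rw [Measure.restrict_univ]
    exact (lintegral_sub_right_eq_self (fun x => ‖f x‖ₑ) t).le
  simpa using this

theorem setLIntegral_ball_comp_sub (F : Plane → ℝ≥0∞) (x t : Plane) (R : ℝ) :
    ∫⁻ y in Metric.ball x R, F (y - t) = ∫⁻ y in Metric.ball (x - t) R, F y := by
  rw [← lintegral_indicator measurableSet_ball, ← lintegral_indicator measurableSet_ball,
    ← lintegral_sub_right_eq_self ((Metric.ball (x - t) R).indicator F) t]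
  refine lintegral_congr fun y => ?_
  have : y ∈ Metric.ball x R ↔ y - t ∈ Metric.ball (x - t) R := by
    simp [Metric.mem_ball, dist_eq_norm]
  by_cases hy : y ∈ Metric.ball x R
  · rw [indicator_of_mem hy, indicator_of_mem (this.1 hy)]
  · rw [indicator_of_notMem hy, indicator_of_notMem (fun hc => hy (this.2 hc))]

/-- Positivity and normalisation of `η` play no role, so the bound also applies to derivatives of a
mollifier: a uniformly locally integrable drift becomes bounded and Lipschitz. -/
theorem abs_mollify_le {B U : ℝ} (hB : ∀ x, |η x| ≤ B)
    (h1 : ∀ x, 1 < ‖x‖ → η x = 0) (x : Plane)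
    (hU : ∫⁻ y in Metric.closedBall x 1, ‖f y‖ₑ ≤ ENNReal.ofReal U) (hU0 : 0 ≤ U) :
    |mollify η f x| ≤ B * U := by
  have hB0 : 0 ≤ B := (abs_nonneg _).trans (hB 0)
  have h2 : mollify η f x = ∫ y in Metric.closedBall x 1, η (x - y) * f y := by
    unfold mollify
    rw [setIntegral_eq_integral_of_forall_compl_eq_zero]
    intro y hy
    rw [h1, zero_mul]
    rw [← dist_eq_norm, dist_comm]
    simpa using hy
  have h3 : ‖mollify η f x‖ₑ ≤ ENNReal.ofReal (B * U) := by
    rw [h2]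
    refine (enorm_integral_le_lintegral_enorm _).trans ?_
    rw [ENNReal.ofReal_mul hB0]
    calc ∫⁻ y in Metric.closedBall x 1, ‖η (x - y) * f y‖ₑ
        ≤ ∫⁻ y in Metric.closedBall x 1, ENNReal.ofReal B * ‖f y‖ₑ := by
          refine lintegral_mono fun y => ?_
          rw [enorm_mul, Real.enorm_eq_ofReal_abs (η (x - y))]
          exact mul_le_mul_left (ENNReal.ofReal_le_ofReal (hB _)) _
      _ = ENNReal.ofReal B * ∫⁻ y in Metric.closedBall x 1, ‖f y‖ₑ :=
          lintegral_const_mul' _ _ ENNReal.ofReal_ne_top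
      _ ≤ _ := mul_le_mul_right hU _
  rw [Real.enorm_eq_ofReal_abs] at h3
  exact (ENNReal.ofReal_le_ofReal_iff (by positivity)).1 h3

theorem IsMollifier.abs_mollify_sub_le (h : IsMollifier η ε) (hf : LocallyIntegrable f)
    {x : Plane} {a δ : ℝ} (hδ : ∀ y, dist y x < ε → |f y - a| ≤ δ) :
    |mollify η f x - a| ≤ δ := by
  have hint := integrable_mollify_integrand h.contDiff.continuous h.hasCompactSupport hf x
  have hηint : Integrable fun y => η (x - y) :=
    (h.contDiff.continuous.integrable_of_hasCompactSupport h.hasCompactSupport).comp_sub_left x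
  have h1 : ∫ y, η (x - y) = 1 := by rw [integral_sub_left_eq_self, h.integral_eq]
  have h2 : mollify η f x - a = ∫ y, η (x - y) * (f y - a) := by
    have : ∀ y, η (x - y) * (f y - a) = η (x - y) * f y - η (x - y) * a := fun y => by ring
    simp_rw [this]
    rw [integral_sub hint (hηint.mul_const a), integral_mul_const, h1, one_mul]
    rfl
  rw [h2, ← Real.norm_eq_abs]
  have h3 := norm_integral_le_of_norm_le (hηint.mul_const δ)
    (f := fun y => η (x - y) * (f y - a)) (Filter.Eventually.of_forall fun y => ?_)
  · rwa [integral_mul_const, h1, one_mul] at h3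
  · rw [norm_mul, Real.norm_of_nonneg (h.nonneg _)]
    by_cases hy : dist y x < ε
    · exact mul_le_mul_of_nonneg_left (hδ y hy) (h.nonneg _)
    · rw [h.eq_zero (x - y) (by rw [← dist_eq_norm, dist_comm]; exact not_lt.1 hy)]
      simp

theorem mollify_sub (hη : Continuous η) (hc : HasCompactSupport η) (hf : LocallyIntegrable f)
    (hg : LocallyIntegrable g) (x : Plane) :
    mollify η (fun y => f y - g y) x = mollify η f x - mollify η g x := by
  unfold mollify
  rw [← integral_sub (integrable_mollify_integrand hη hc hf x)
    (integrable_mollify_integrand hη hc hg x)]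
  congr 1
  funext y
  ring

/-- Mollifications converge locally in `L¹`. -/
theorem tendsto_lintegral_mollify_sub {η : ℕ → Plane → ℝ} {ε : ℕ → ℝ}
    (h : ∀ n, IsMollifier (η n) (ε n)) (hε : Filter.Tendsto ε Filter.atTop (nhds 0))
    (hf : LocallyIntegrable f) (R : ℝ) :
    Filter.Tendsto (fun n => ∫⁻ x in Metric.ball 0 R, ‖mollify (η n) f x - f x‖ₑ) Filter.atTop
      (nhds 0) := by
  set B := Metric.closedBall (0 : Plane) (R + 1) with hB
  have hfB : Integrable (B.indicator f) :=
    (integrable_indicator_iff measurableSet_closedBall).2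
      (hf.integrableOn_isCompact (isCompact_closedBall _ _))
  rw [ENNReal.tendsto_nhds_zero]
  intro δ hδ
  -- The tolerance `δ` may be infinite, so a finite positive real below its third is extracted
  -- first.
  obtain ⟨δ', hδ'0, hδ'⟩ : ∃ δ' : ℝ, 0 < δ' ∧ ENNReal.ofReal δ' ≤ δ / 3 := by
    have h3 : 0 < δ / 3 := ENNReal.div_pos hδ.ne' (by norm_num)
    rcases eq_or_ne (δ / 3) ⊤ with ht | ht
    · exact ⟨1, one_pos, by rw [ht]; exact le_top⟩
    · exact ⟨(δ / 3).toReal, ENNReal.toReal_pos h3.ne' ht, ENNReal.ofReal_toReal_le⟩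
  -- Three-term splitting: `g` is continuous of compact support and close to `f` in `L¹` on a ball
  -- one unit larger, since mollification at scale below `1` reads values there. For `g` itself the
  -- convergence is uniform.
  obtain ⟨g, hgc, hg, hgcont, hgint⟩ := hfB.exists_hasCompactSupport_lintegral_sub_le
    (ε := ENNReal.ofReal δ') (by simpa using hδ'0)
  have hvol : volume (Metric.ball (0 : Plane) R) ≠ ⊤ := measure_ball_lt_top.ne
  obtain ⟨κ, hκ0, hκ⟩ : ∃ κ : ℝ, 0 < κ ∧
      ENNReal.ofReal κ * volume (Metric.ball (0 : Plane) R) ≤ ENNReal.ofReal δ' := by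
    refine ⟨δ' / ((volume (Metric.ball (0 : Plane) R)).toReal + 1), by positivity, ?_⟩
    rw [← ENNReal.ofReal_toReal hvol, ← ENNReal.ofReal_mul (by positivity)]
    refine ENNReal.ofReal_le_ofReal ?_
    rw [ENNReal.toReal_ofReal ENNReal.toReal_nonneg, div_mul_eq_mul_div, div_le_iff₀ (by positivity)]
    have : 0 ≤ (volume (Metric.ball (0 : Plane) R)).toReal := ENNReal.toReal_nonneg
    nlinarith
  have hguc := hgcont.uniformContinuous_of_tendsto_cocompact
    (hgc.is_zero_at_infty)
  rw [Metric.uniformContinuous_iff] at hguc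
  obtain ⟨s, hs0, hs⟩ := hguc κ hκ0
  filter_upwards [hε.eventually (gt_mem_nhds hs0), hε.eventually (gt_mem_nhds one_pos)]
    with n hn1 hn2
  have hgl : LocallyIntegrable g := hgcont.locallyIntegrable
  have hsub : LocallyIntegrable fun y => f y - g y := hf.sub hgl
  have hfgB : ∫⁻ x in B, ‖f x - g x‖ₑ ≤ ENNReal.ofReal δ' := by
    refine le_trans ?_ hg
    rw [← lintegral_indicator measurableSet_closedBall]
    refine lintegral_mono fun x => ?_
    by_cases hx : x ∈ B
    · rw [indicator_of_mem hx, indicator_of_mem hx]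
    · rw [indicator_of_notMem hx]
      exact bot_le
  have hRB : Metric.ball (0 : Plane) R ⊆ B := fun x hx => by
    rw [hB, Metric.mem_closedBall]
    rw [Metric.mem_ball] at hx
    linarith
  have h1 : ∫⁻ x in Metric.ball 0 R, ‖mollify (η n) (fun y => f y - g y) x‖ₑ ≤
      ENNReal.ofReal δ' := by
    refine lintegral_mollify_le (h n) hsub.aestronglyMeasurable fun t ht => ?_
    rw [setLIntegral_ball_comp_sub (fun y => ‖f y - g y‖ₑ)]
    refine le_trans (lintegral_mono_set fun x hx => ?_) hfgB
    rw [hB, mem_closedBall_zero_iff]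
    rw [Metric.mem_ball, dist_eq_norm] at hx
    have := norm_add_le (x - (0 - t)) (0 - t)
    rw [sub_add_cancel, zero_sub, norm_neg] at this
    rw [zero_sub] at hx
    linarith
  have h2 : ∫⁻ x in Metric.ball 0 R, ‖mollify (η n) g x - g x‖ₑ ≤ ENNReal.ofReal δ' := by
    calc ∫⁻ x in Metric.ball 0 R, ‖mollify (η n) g x - g x‖ₑ
        ≤ ∫⁻ x in Metric.ball (0 : Plane) R, ENNReal.ofReal κ := by
          refine lintegral_mono fun x => ?_
          rw [Real.enorm_eq_ofReal_abs]
          refine ENNReal.ofReal_le_ofReal ((h n).abs_mollify_sub_le hgl fun y hy => ?_)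
          rw [← Real.dist_eq]
          exact (hs (hy.trans hn1)).le
      _ = ENNReal.ofReal κ * volume (Metric.ball (0 : Plane) R) := by
          rw [lintegral_const, Measure.restrict_apply_univ]
      _ ≤ _ := hκ
  have hcm : AEStronglyMeasurable (fun x => mollify (η n) (fun y => f y - g y) x)
      (volume.restrict (Metric.ball 0 R)) :=
    (contDiff_mollify (h n).contDiff (h n).hasCompactSupport hsub).continuous.aestronglyMeasurable
  have hcg : AEStronglyMeasurable (fun x => mollify (η n) g x - g x)
      (volume.restrict (Metric.ball 0 R)) :=
    ((contDiff_mollify (h n).contDiff (h n).hasCompactSupport hgl).continuous.sub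
      hgcont).aestronglyMeasurable
  calc ∫⁻ x in Metric.ball 0 R, ‖mollify (η n) f x - f x‖ₑ
      ≤ ∫⁻ x in Metric.ball 0 R, (‖mollify (η n) (fun y => f y - g y) x‖ₑ +
          ‖mollify (η n) g x - g x‖ₑ + ‖f x - g x‖ₑ) := by
        refine lintegral_mono fun x => ?_
        have : mollify (η n) f x - f x = mollify (η n) (fun y => f y - g y) x +
            (mollify (η n) g x - g x) + (g x - f x) := by
          rw [mollify_sub (h n).contDiff.continuous (h n).hasCompactSupport hf hgl]
          ring
        simp only
        rw [this]
        refine (enorm_add_le _ _).trans (add_le_add (enorm_add_le _ _) (le_of_eq ?_))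
        rw [← enorm_neg, neg_sub]
    _ = (∫⁻ x in Metric.ball 0 R, ‖mollify (η n) (fun y => f y - g y) x‖ₑ) +
          (∫⁻ x in Metric.ball 0 R, ‖mollify (η n) g x - g x‖ₑ) +
          ∫⁻ x in Metric.ball 0 R, ‖f x - g x‖ₑ := by
        rw [← lintegral_add_left' hcm.enorm]
        exact lintegral_add_left' (hcm.enorm.add hcg.enorm) _
    _ ≤ ENNReal.ofReal δ' + ENNReal.ofReal δ' + ENNReal.ofReal δ' :=
        add_le_add (add_le_add h1 h2) ((lintegral_mono_set hRB).trans hfgB)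
    _ ≤ δ / 3 + δ / 3 + δ / 3 := by gcongr
    _ = δ := ENNReal.add_thirds δ

theorem fderiv_eq_sum_partialDeriv (φ : Plane → ℝ) (x v : Plane) :
    fderiv ℝ φ x v = partialDeriv 0 φ x * v 0 + partialDeriv 1 φ x * v 1 := by
  have hv : v = v 0 • EuclideanSpace.single 0 (1 : ℝ) + v 1 • EuclideanSpace.single 1 1 := by
    ext i
    fin_cases i <;> simp
  conv_lhs => rw [hv]
  rw [map_add, map_smul, map_smul]
  unfold partialDeriv
  simp only [smul_eq_mul]
  ring

theorem locallyIntegrable_coord {u : Plane → Plane} (hu : LocallyIntegrable u) (i : Fin 2) :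
    LocallyIntegrable fun x => u x i := by
  refine fun x => ?_
  obtain ⟨s, hs, hi⟩ := hu x
  exact ⟨s, hs, (EuclideanSpace.proj (𝕜 := ℝ) i).integrable_comp hi⟩

/-- Mollification preserves the divergence-free condition. -/
theorem IsDivFree.mollify {u : Plane → Plane} (hdiv : IsDivFree u) (hu : LocallyIntegrable u)
    (hη : ContDiff ℝ ∞ η) (hc : HasCompactSupport η) (x : Plane) :
    partialDeriv 0 (mollify η fun y => u y 0) x + partialDeriv 1 (mollify η fun y => u y 1) x
      = 0 := by
  rw [partialDeriv_mollify hη hc (locallyIntegrable_coord hu 0),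
    partialDeriv_mollify hη hc (locallyIntegrable_coord hu 1)]
  have h1 := hdiv (fun y => η (x - y)) (hη.comp (contDiff_const.sub contDiff_id))
    (hc.comp_homeomorph (Homeomorph.subLeft x))
  have hp : ∀ i y, partialDeriv i (fun y => η (x - y)) y = -partialDeriv i η (x - y) := by
    intro i y
    have := congrFun (partialDeriv_const_mul_comp_sub hη 1 x i) y
    simpa using this
  simp_rw [fderiv_eq_sum_partialDeriv, hp] at h1
  unfold _root_.mollify
  rw [← integral_add (integrable_mollify_integrand (contDiff_partialDeriv hη 0).continuous
      (hasCompactSupport_partialDeriv hc 0) (locallyIntegrable_coord hu 0) x)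
    (integrable_mollify_integrand (contDiff_partialDeriv hη 1).continuous
      (hasCompactSupport_partialDeriv hc 1) (locallyIntegrable_coord hu 1) x)]
  rw [← neg_eq_zero, ← integral_neg, ← h1]
  congr 1
  funext y
  ring

end Mollification

/-! ### Cells, cell averages and grid differences. -/

section Discretization

open Function

/-- The index of the cell of the grid of mesh `1 / N` that contains `x`. -/
noncomputable def cellIndex (N : ℕ) (x : Plane) : ℤ × ℤ := (⌊N * x 0⌋, ⌊N * x 1⌋)

/-- The cell `[i / N, (i + 1) / N) × [j / N, (j + 1) / N)`. -/
def cell (N : ℕ) (z : ℤ × ℤ) : Set Plane := {x | cellIndex N x = z}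

/-- The step of length `1 / N` in the direction of the `i`-th basis vector. -/
noncomputable def gridStep (N : ℕ) (i : Fin 2) : Plane := EuclideanSpace.single i (N : ℝ)⁻¹

/-- The step of the lattice corresponding to `gridStep`. -/
def latticeDir : Fin 2 → ℤ × ℤ := ![dirX, dirY]

/-- The average of `F` over a cell. -/
noncomputable def cellAvg (N : ℕ) (F : Plane → ℝ) (z : ℤ × ℤ) : ℝ := N ^ 2 * ∫ x in cell N z, F x

variable {N : ℕ} {F G : Plane → ℝ}

theorem plane_norm_le (x : Plane) : ‖x‖ ≤ |x 0| + |x 1| := by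
  rw [EuclideanSpace.norm_eq, Fin.sum_univ_two]
  refine Real.sqrt_le_iff.2 ⟨by positivity, ?_⟩
  simp only [Real.norm_eq_abs]
  nlinarith [abs_nonneg (x 0), abs_nonneg (x 1)]

theorem plane_norm_sq (x : Plane) : ‖x‖ ^ 2 = x 0 ^ 2 + x 1 ^ 2 := by
  rw [EuclideanSpace.norm_sq_eq, Fin.sum_univ_two]
  simp only [Real.norm_eq_abs, sq_abs]

theorem abs_coord_le_norm (x : Plane) (i : Fin 2) : |x i| ≤ ‖x‖ :=
  PiLp.norm_apply_le x i

theorem measurable_cellIndex (N : ℕ) : Measurable (cellIndex N) := by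
  unfold cellIndex
  exact (Int.measurable_floor.comp (by fun_prop)).prodMk (Int.measurable_floor.comp (by fun_prop))

theorem measurableSet_cell (N : ℕ) (z : ℤ × ℤ) : MeasurableSet (cell N z) :=
  measurable_cellIndex N (measurableSet_singleton z)

theorem cellIndex_add_gridStep (hN : 1 ≤ N) (x : Plane) (i : Fin 2) :
    cellIndex N (x + gridStep N i) = cellIndex N x + latticeDir i := by
  have hN0 : (N : ℝ) ≠ 0 := by positivity
  unfold cellIndex gridStep latticeDir
  fin_cases i <;> simp [mul_add, hN0]

theorem mem_cell_iff (hN : 1 ≤ N) {x : Plane} {z : ℤ × ℤ} : x ∈ cell N z ↔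
    (z.1 / N ≤ x 0 ∧ x 0 < (z.1 + 1) / N) ∧ z.2 / N ≤ x 1 ∧ x 1 < (z.2 + 1) / N := by
  have hN0 : (0 : ℝ) < N := by exact_mod_cast hN
  unfold cell cellIndex
  rw [mem_ofPred_eq, Prod.ext_iff, Int.floor_eq_iff, Int.floor_eq_iff, div_le_iff₀ hN0,
    lt_div_iff₀ hN0, div_le_iff₀ hN0, lt_div_iff₀ hN0, mul_comm (N : ℝ), mul_comm (N : ℝ)]

theorem dist_le_of_cellIndex_eq (hN : 1 ≤ N) {x y : Plane} (h : cellIndex N x = cellIndex N y) :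
    dist x y ≤ 2 / N := by
  have hx := (mem_cell_iff hN (x := x) (z := cellIndex N y)).1 h
  have hy := (mem_cell_iff hN (x := y) (z := cellIndex N y)).1 rfl
  have hN0 : (0 : ℝ) < N := by exact_mod_cast hN
  rw [dist_eq_norm]
  refine (plane_norm_le _).trans ?_
  simp only [PiLp.sub_apply]
  rw [add_div, add_div] at hx hy
  have h0 : |x 0 - y 0| ≤ 1 / N := abs_le.2 ⟨by linarith [hx.1.1, hy.1.2], by linarith [hx.1.2, hy.1.1]⟩
  have h1 : |x 1 - y 1| ≤ 1 / N := abs_le.2 ⟨by linarith [hx.2.1, hy.2.2], by linarith [hx.2.2, hy.2.1]⟩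
  calc _ ≤ 1 / (N : ℝ) + 1 / N := add_le_add h0 h1
    _ = 2 / N := by ring

theorem volume_cell (hN : 1 ≤ N) (z : ℤ × ℤ) :
    volume (cell N z) = ENNReal.ofReal (1 / (N : ℝ) ^ 2) := by
  have hN0 : (0 : ℝ) < N := by exact_mod_cast hN
  have h : cell N z = (WithLp.ofLp : Plane → Fin 2 → ℝ) ⁻¹'
      (Set.pi univ fun i => Ico ((![(z.1 : ℝ), z.2] i) / N) ((![(z.1 : ℝ), z.2] i + 1) / N)) := by
    ext x
    rw [mem_cell_iff hN]
    simp [Set.mem_pi, Fin.forall_fin_two]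
  rw [h, (PiLp.volume_preserving_ofLp (Fin 2)).measure_preimage
    (MeasurableSet.univ_pi fun i => measurableSet_Ico).nullMeasurableSet, Real.volume_pi_Ico,
    Fin.prod_univ_two, ← ENNReal.ofReal_mul (by rw [← sub_div]; simp)]
  congr 1
  simp only [← sub_div, add_sub_cancel_left]
  field_simp

theorem volume_real_cell (hN : 1 ≤ N) (z : ℤ × ℤ) : volume.real (cell N z) = 1 / (N : ℝ) ^ 2 := by
  rw [Measure.real, volume_cell hN, ENNReal.toReal_ofReal (by positivity)]

theorem volume_cell_lt_top (hN : 1 ≤ N) (z : ℤ × ℤ) : volume (cell N z) < ⊤ := by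
  rw [volume_cell hN]
  exact ENNReal.ofReal_lt_top

theorem cell_subset_closedBall (hN : 1 ≤ N) (z : ℤ × ℤ) :
    ∃ R : ℝ, cell N z ⊆ Metric.closedBall 0 R := by
  by_cases h : (cell N z).Nonempty
  · obtain ⟨x, hx⟩ := h
    refine ⟨2 / N + ‖x‖, fun y hy => ?_⟩
    have hxy : cellIndex N y = cellIndex N x := Eq.trans hy (Eq.symm hx)
    have := dist_le_of_cellIndex_eq hN hxy
    rw [mem_closedBall_zero_iff]
    rw [dist_eq_norm] at this
    have := norm_add_le (y - x) x
    rw [sub_add_cancel] at this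
    linarith
  · exact ⟨0, by rw [not_nonempty_iff_eq_empty.1 h]; exact empty_subset _⟩

theorem integrableOn_cell (hN : 1 ≤ N) (hF : Continuous F) (z : ℤ × ℤ) :
    IntegrableOn F (cell N z) := by
  obtain ⟨R, hR⟩ := cell_subset_closedBall hN z
  exact (hF.locallyIntegrable.integrableOn_isCompact (isCompact_closedBall 0 R)).mono_set hR

theorem cellAvg_const (hN : 1 ≤ N) (a : ℝ) (z : ℤ × ℤ) : cellAvg N (fun _ => a) z = a := by
  have hN0 : (0 : ℝ) < N := by exact_mod_cast hN
  unfold cellAvg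
  rw [setIntegral_const, volume_real_cell hN, smul_eq_mul]
  field_simp

theorem cellAvg_sub (hN : 1 ≤ N) (hF : Continuous F) (hG : Continuous G) (z : ℤ × ℤ) :
    cellAvg N (fun x => F x - G x) z = cellAvg N F z - cellAvg N G z := by
  unfold cellAvg
  rw [integral_sub (integrableOn_cell hN hF z) (integrableOn_cell hN hG z)]
  ring

theorem abs_cellAvg_le (hN : 1 ≤ N) {A : ℝ} {z : ℤ × ℤ} (hA : ∀ x ∈ cell N z, |F x| ≤ A) :
    |cellAvg N F z| ≤ A := by
  have hN0 : (0 : ℝ) < N := by exact_mod_cast hN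
  unfold cellAvg
  have h := norm_setIntegral_le_of_norm_le_const (f := F) (volume_cell_lt_top hN z)
    fun x hx => (Real.norm_eq_abs (F x)).trans_le (hA x hx)
  rw [volume_real_cell hN, Real.norm_eq_abs] at h
  rw [abs_mul, abs_of_pos (by positivity)]
  calc (N : ℝ) ^ 2 * |∫ x in cell N z, F x| ≤ N ^ 2 * (A * (1 / N ^ 2)) := by gcongr
    _ = A := by field_simp

theorem abs_cellAvg_cellIndex_sub_le (hN : 1 ≤ N) (hF : Continuous F) {x : Plane} {a δ : ℝ}
    (h : ∀ y, dist y x ≤ 2 / N → |F y - a| ≤ δ) : |cellAvg N F (cellIndex N x) - a| ≤ δ := by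
  rw [← cellAvg_const hN a (cellIndex N x), ← cellAvg_sub hN hF continuous_const]
  exact abs_cellAvg_le hN fun y hy => h y (dist_le_of_cellIndex_eq hN hy)

theorem cellAvg_add_latticeDir (hN : 1 ≤ N) (F : Plane → ℝ) (z : ℤ × ℤ) (i : Fin 2) :
    cellAvg N F (z + latticeDir i) = cellAvg N (fun x => F (x + gridStep N i)) z := by
  unfold cellAvg
  rw [← integral_indicator (measurableSet_cell _ _), ← integral_indicator (measurableSet_cell _ _),
    ← integral_add_right_eq_self _ (gridStep N i)]
  congr 2
  funext x
  have : x + gridStep N i ∈ cell N (z + latticeDir i) ↔ x ∈ cell N z := by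
    unfold cell
    rw [mem_ofPred_eq, mem_ofPred_eq, cellIndex_add_gridStep hN, add_left_inj]
  by_cases hx : x ∈ cell N z
  · rw [indicator_of_mem hx, indicator_of_mem (this.2 hx)]
  · rw [indicator_of_notMem hx, indicator_of_notMem fun hc => hx (this.1 hc)]

/-- The forward difference at distance `1 / N`. -/
noncomputable def gridDiff (N : ℕ) (i : Fin 2) (F : Plane → ℝ) (x : Plane) : ℝ :=
  F (x + gridStep N i) - F x

theorem cellAvg_gridDiff (hN : 1 ≤ N) (hF : Continuous F) (z : ℤ × ℤ) (i : Fin 2) :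
    cellAvg N (gridDiff N i F) z = cellAvg N F (z + latticeDir i) - cellAvg N F z := by
  rw [cellAvg_add_latticeDir hN, ← cellAvg_sub hN (by fun_prop) hF]
  rfl

theorem tsum_enorm_cellAvg_le (N : ℕ) (F : Plane → ℝ) :
    ∑' z, ‖cellAvg N F z‖ₑ ≤ N ^ 2 * ∫⁻ x, ‖F x‖ₑ := by
  have h1 : ∀ z, ‖cellAvg N F z‖ₑ ≤ N ^ 2 * ∫⁻ x in cell N z, ‖F x‖ₑ := fun z => by
    unfold cellAvg
    rw [enorm_mul, enorm_pow]
    refine mul_le_mul' (le_of_eq ?_) (enorm_integral_le_lintegral_enorm _)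
    rw [Real.enorm_natCast]
  have h2 : ∑' z, ∫⁻ x in cell N z, ‖F x‖ₑ = ∫⁻ x, ‖F x‖ₑ := by
    rw [← lintegral_iUnion (measurableSet_cell N)]
    · rw [show (⋃ z, cell N z) = univ from eq_univ_of_forall fun x =>
        mem_iUnion.2 ⟨cellIndex N x, rfl⟩, Measure.restrict_univ]
    · intro z w hzw
      rw [Function.onFun, Set.disjoint_left]
      intro x hx hy
      exact hzw (Eq.trans (Eq.symm hx) hy)
  calc _ ≤ ∑' z, N ^ 2 * ∫⁻ x in cell N z, ‖F x‖ₑ := ENNReal.tsum_le_tsum h1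
    _ = _ := by rw [ENNReal.tsum_mul_left, h2]

theorem contDiff_gridDiff (hF : ContDiff ℝ ∞ F) (i : Fin 2) : ContDiff ℝ ∞ (gridDiff N i F) := by
  unfold gridDiff
  fun_prop

theorem partialDeriv_gridDiff (hF : ContDiff ℝ ∞ F) (i j : Fin 2) :
    partialDeriv i (gridDiff N j F) = gridDiff N j (partialDeriv i F) := by
  funext x
  have hd : ∀ y, DifferentiableAt ℝ F y := fun y =>
    (hF.differentiable (by simp)).differentiableAt
  unfold partialDeriv gridDiff
  have hd1 : DifferentiableAt ℝ (fun x => F (x + gridStep N j)) x := (hd _).comp x (by fun_prop)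
  rw [fderiv_fun_sub hd1 (hd x), fderiv_comp_add_right]
  rfl

/-- `N` times the difference is the integral of the derivative along the step; Tonelli and
translation invariance conclude. -/
theorem lintegral_enorm_gridDiff_le (hN : 1 ≤ N) (hF : ContDiff ℝ ∞ F) (i : Fin 2) :
    N * ∫⁻ x, ‖gridDiff N i F x‖ₑ ≤ ∫⁻ x, ‖partialDeriv i F x‖ₑ := by
  have hN0 : (0 : ℝ) < N := by exact_mod_cast hN
  have hc : Continuous (partialDeriv i F) := (contDiff_partialDeriv hF i).continuous
  have h1 : ∀ x, N * ‖gridDiff N i F x‖ₑ ≤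
      ∫⁻ s in Ioc (0 : ℝ) 1, ‖partialDeriv i F (x + s • gridStep N i)‖ₑ := by
    intro x
    have hd : ∀ s ∈ uIcc (0 : ℝ) 1, HasDerivAt (fun s : ℝ => N * F (x + s • gridStep N i))
        (partialDeriv i F (x + s • gridStep N i)) s := by
      intro s _
      have hF1 : HasFDerivAt F (fderiv ℝ F (x + s • gridStep N i)) (x + s • gridStep N i) :=
        (hF.differentiable (by simp)).differentiableAt.hasFDerivAt
      have hl : HasDerivAt (fun s : ℝ => x + s • gridStep N i) ((1 : ℝ) • gridStep N i) s :=
        ((hasDerivAt_id s).smul_const _).const_add x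
      have h3 := (hF1.comp_hasDerivAt s hl).const_mul (N : ℝ)
      refine h3.congr_deriv ?_
      unfold partialDeriv gridStep
      rw [one_smul, ← smul_eq_mul, ← map_smul]
      congr 1
      ext j
      simp [hN0.ne']
    have h2 := intervalIntegral.integral_eq_sub_of_hasDerivAt hd
      (Continuous.intervalIntegrable (by fun_prop) 0 1)
    have h4 : (N : ℝ) * gridDiff N i F x =
        ∫ s in (0 : ℝ)..1, partialDeriv i F (x + s • gridStep N i) := by
      rw [h2]
      unfold gridDiff
      simp
      ring
    rw [← Real.enorm_natCast, ← enorm_mul, h4, intervalIntegral.integral_of_le zero_le_one]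
    exact enorm_integral_le_lintegral_enorm _
  calc N * ∫⁻ x, ‖gridDiff N i F x‖ₑ = ∫⁻ x, N * ‖gridDiff N i F x‖ₑ :=
        (lintegral_const_mul' _ _ (by simp)).symm
    _ ≤ ∫⁻ x, ∫⁻ s in Ioc (0 : ℝ) 1, ‖partialDeriv i F (x + s • gridStep N i)‖ₑ :=
        lintegral_mono h1
    _ = ∫⁻ s in Ioc (0 : ℝ) 1, ∫⁻ x, ‖partialDeriv i F (x + s • gridStep N i)‖ₑ := by
        refine lintegral_lintegral_swap (Continuous.aemeasurable ?_)
        exact continuous_enorm.comp (hc.comp (by fun_prop))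
    _ = ∫⁻ s in Ioc (0 : ℝ) 1, ∫⁻ x, ‖partialDeriv i F x‖ₑ := by
        refine lintegral_congr fun s => ?_
        exact lintegral_add_right_eq_self (fun x => ‖partialDeriv i F x‖ₑ) _
    _ = _ := by simp

end Discretization

/-! ### Face fluxes of a smooth divergence-free field. -/

section LatticeFlux

/-- The lower left corner of a cell. -/
noncomputable def gridPoint (N : ℕ) (z : ℤ × ℤ) : Plane :=
  (z.1 : ℝ) • gridStep N 0 + (z.2 : ℝ) • gridStep N 1

/-- Half the flux of a vector field with `i`-th component `v`, at scale `N`, through the face of a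
cell that contains the lower left corner and is orthogonal to the `i`-th basis vector. -/
noncomputable def gridFlux (N : ℕ) (i : Fin 2) (v : Plane → ℝ) (z : ℤ × ℤ) : ℝ :=
  1 / (2 * N) * ∫ s in (0 : ℝ)..1, v (gridPoint N z + s • gridStep N (1 - i))

variable {N : ℕ} {v v₀ v₁ : Plane → ℝ}

theorem gridPoint_add_latticeDir (N : ℕ) (z : ℤ × ℤ) (i : Fin 2) :
    gridPoint N (z + latticeDir i) = gridPoint N z + gridStep N i := by
  unfold gridPoint latticeDir
  fin_cases i
  · simp [add_smul]; abel
  · simp [add_smul]; abel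

theorem dist_gridPoint_le (hN : 1 ≤ N) {z : ℤ × ℤ} {w : Plane} (hw : w ∈ cell N z) {s t : ℝ}
    (hs : s ∈ Icc (0 : ℝ) 1) (ht : t ∈ Icc (0 : ℝ) 1) :
    dist (gridPoint N z + s • gridStep N 0 + t • gridStep N 1) w ≤ 2 / N := by
  have hN0 : (0 : ℝ) < N := by exact_mod_cast hN
  obtain ⟨⟨h1, h2⟩, h3, h4⟩ := (mem_cell_iff hN).1 hw
  rw [dist_eq_norm]
  refine (plane_norm_le _).trans ?_
  have e0 : (gridPoint N z + s • gridStep N 0 + t • gridStep N 1 - w) 0 =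
      z.1 / N + s / N - w 0 := by
    simp [gridPoint, gridStep]; ring
  have e1 : (gridPoint N z + s • gridStep N 0 + t • gridStep N 1 - w) 1 =
      z.2 / N + t / N - w 1 := by
    simp [gridPoint, gridStep]; ring
  rw [e0, e1]
  rw [add_div] at h2 h4
  have a1 : 0 ≤ s / N := div_nonneg hs.1 hN0.le
  have a2 : s / N ≤ 1 / N := by gcongr; exact hs.2
  have a3 : 0 ≤ t / N := div_nonneg ht.1 hN0.le
  have a4 : t / N ≤ 1 / N := by gcongr; exact ht.2
  calc _ ≤ 1 / (N : ℝ) + 1 / N :=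
        add_le_add (abs_le.2 ⟨by linarith, by linarith⟩) (abs_le.2 ⟨by linarith, by linarith⟩)
    _ = 2 / N := by ring

theorem dist_face_le (hN : 1 ≤ N) {z : ℤ × ℤ} {w : Plane} (hw : w ∈ cell N z) (i : Fin 2) {s : ℝ}
    (hs : s ∈ Icc (0 : ℝ) 1) : dist (gridPoint N z + s • gridStep N (1 - i)) w ≤ 2 / N ∧
      dist (gridPoint N (z + latticeDir i) + s • gridStep N (1 - i)) w ≤ 2 / N := by
  have h0 : (0 : ℝ) ∈ Icc (0 : ℝ) 1 := by simp
  have h1 : (1 : ℝ) ∈ Icc (0 : ℝ) 1 := by simp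
  rw [gridPoint_add_latticeDir]
  fin_cases i
  · have e1 := dist_gridPoint_le hN hw h0 hs
    have e2 := dist_gridPoint_le hN hw h1 hs
    simp only [zero_smul, one_smul, add_zero] at e1 e2
    exact ⟨e1, e2⟩
  · have e1 := dist_gridPoint_le hN hw hs h0
    have e2 := dist_gridPoint_le hN hw hs h1
    simp only [zero_smul, one_smul, add_zero] at e1 e2
    rw [add_right_comm] at e2
    exact ⟨e1, e2⟩

theorem abs_gridFlux_sub_le (hN : 1 ≤ N) (hv : Continuous v) {z : ℤ × ℤ} {i : Fin 2} {a δ : ℝ}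
    (h : ∀ s ∈ Icc (0 : ℝ) 1, |v (gridPoint N z + s • gridStep N (1 - i)) - a| ≤ δ) :
    |2 * N * gridFlux N i v z - a| ≤ δ := by
  have hN0 : (0 : ℝ) < N := by exact_mod_cast hN
  have e : 2 * N * gridFlux N i v z - a =
      ∫ s in (0 : ℝ)..1, (v (gridPoint N z + s • gridStep N (1 - i)) - a) := by
    rw [intervalIntegral.integral_sub (Continuous.intervalIntegrable (by fun_prop) _ _) (by simp)]
    unfold gridFlux
    simp
    field_simp
  rw [e]
  have := intervalIntegral.norm_integral_le_of_norm_le_const (a := (0 : ℝ)) (b := 1) (C := δ)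
    (f := fun s => v (gridPoint N z + s • gridStep N (1 - i)) - a) fun s hs => by
      rw [uIoc_of_le zero_le_one] at hs
      exact h s ⟨hs.1.le, hs.2⟩
  simpa using this

theorem abs_gridFlux_sub_le_of_mem_cell (hN : 1 ≤ N) (hv : Continuous v) {δ : ℝ}
    (hδ : ∀ x y, dist x y ≤ 2 / N → |v x - v y| ≤ δ) {z : ℤ × ℤ} {w : Plane} (hw : w ∈ cell N z)
    (i : Fin 2) : |2 * N * gridFlux N i v z - v w| ≤ δ ∧
      |2 * N * gridFlux N i v (z + latticeDir i) - v w| ≤ δ :=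
  ⟨abs_gridFlux_sub_le hN hv fun _ hs => hδ _ _ (dist_face_le hN hw i hs).1,
    abs_gridFlux_sub_le hN hv fun _ hs => hδ _ _ (dist_face_le hN hw i hs).2⟩

theorem abs_gridFlux_le (hN : 1 ≤ N) (hv : Continuous v) {B : ℝ} (hB : ∀ x, |v x| ≤ B)
    (hBN : B ≤ N) (i : Fin 2) (z : ℤ × ℤ) : |gridFlux N i v z| ≤ 1 / 2 := by
  have hN0 : (0 : ℝ) < N := by exact_mod_cast hN
  have h := abs_gridFlux_sub_le (z := z) (i := i) (a := 0) (δ := B) hN hv fun s _ => by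
    rw [sub_zero]
    exact hB _
  rw [sub_zero, abs_mul, abs_of_pos (by positivity)] at h
  nlinarith

/-- This is the divergence theorem on one cell, in coordinates rescaled to the unit square.
Integrating over faces, instead of sampling the field, makes the discrete divergence vanish exactly.
-/
theorem gridFlux_div_free (hv₀ : ContDiff ℝ ∞ v₀) (hv₁ : ContDiff ℝ ∞ v₁)
    (hdiv : ∀ x, partialDeriv 0 v₀ x + partialDeriv 1 v₁ x = 0) (z : ℤ × ℤ) :
    gridFlux N 0 v₀ (z + dirX) - gridFlux N 0 v₀ z
      + (gridFlux N 1 v₁ (z + dirY) - gridFlux N 1 v₁ z) = 0 := by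
  set L : ℝ × ℝ →L[ℝ] Plane := (ContinuousLinearMap.fst ℝ ℝ ℝ).smulRight (gridStep N 0) +
    (ContinuousLinearMap.snd ℝ ℝ ℝ).smulRight (gridStep N 1) with hL
  have hLa : ∀ r s, L (r, s) = r • gridStep N 0 + s • gridStep N 1 := fun r s => by simp [hL]
  have hd : ∀ {v : Plane → ℝ}, ContDiff ℝ ∞ v → ∀ x : ℝ × ℝ,
      HasFDerivAt (fun x => v (gridPoint N z + L x))
        ((fderiv ℝ v (gridPoint N z + L x)).comp L) x := fun {v} hv x =>
    ((hv.differentiable (by simp)).differentiableAt.hasFDerivAt).comp x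
      (L.hasFDerivAt.const_add _)
  have hstep : ∀ i, gridStep N i = (N : ℝ)⁻¹ • EuclideanSpace.single i (1 : ℝ) := fun i => by
    ext j
    simp [gridStep]
  have hzero : ∀ x : ℝ × ℝ, ((fderiv ℝ v₀ (gridPoint N z + L x)).comp L) (1, 0) +
      ((fderiv ℝ v₁ (gridPoint N z + L x)).comp L) (0, 1) = 0 := fun x => by
    have := hdiv (gridPoint N z + L x)
    unfold partialDeriv at this
    rw [ContinuousLinearMap.comp_apply, ContinuousLinearMap.comp_apply, hLa 1 0, hLa 0 1, zero_smul,
      zero_smul, one_smul, one_smul, add_zero, zero_add, hstep, hstep, map_smul, map_smul,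
      ← smul_add, this, smul_zero]
  have key := integral2_divergence_prod_of_hasFDerivAt (fun x => v₀ (gridPoint N z + L x))
    (fun x => v₁ (gridPoint N z + L x)) (fun x => (fderiv ℝ v₀ (gridPoint N z + L x)).comp L)
    (fun x => (fderiv ℝ v₁ (gridPoint N z + L x)).comp L) 0 0 1 1
    (fun x _ => (hd hv₀ x).continuousAt.continuousWithinAt)
    (fun x _ => (hd hv₁ x).continuousAt.continuousWithinAt) (fun x _ => hd hv₀ x)
    (fun x _ => hd hv₁ x) (by simp only [hzero]; exact integrableOn_zero)
  simp only [hzero, intervalIntegral.integral_zero] at key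
  simp only [hLa] at key
  have ex : (dirX : ℤ × ℤ) = latticeDir 0 := rfl
  have ey : (dirY : ℤ × ℤ) = latticeDir 1 := rfl
  unfold gridFlux
  rw [ex, ey, gridPoint_add_latticeDir, gridPoint_add_latticeDir]
  simp only [zero_smul, one_smul, zero_add, add_zero, ← add_assoc, sub_zero, sub_self] at key ⊢
  rw [← mul_sub, ← mul_sub, ← mul_add]
  simp only [add_right_comm _ (gridStep N 1)]
  rw [mul_eq_zero]
  right
  linarith

theorem isLatticeFlux_gridFlux (hN : 1 ≤ N) (hv₀ : ContDiff ℝ ∞ v₀) (hv₁ : ContDiff ℝ ∞ v₁)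
    (hdiv : ∀ x, partialDeriv 0 v₀ x + partialDeriv 1 v₁ x = 0) {B : ℝ} (h₀ : ∀ x, |v₀ x| ≤ B)
    (h₁ : ∀ x, |v₁ x| ≤ B) (hBN : B ≤ N) : IsLatticeFlux (gridFlux N 0 v₀) (gridFlux N 1 v₁) where
  div_free := gridFlux_div_free hv₀ hv₁ hdiv
  abs_left_le := abs_gridFlux_le hN hv₀.continuous h₀ hBN 0
  abs_right_le := abs_gridFlux_le hN hv₁.continuous h₁ hBN 1

/-- The centre of the square `∪ y ∈ latticeBlock x N, cell N y`. -/
noncomputable def blockCenter (N : ℕ) (x : ℤ × ℤ) : Plane :=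
  gridPoint N x + (1 / N + 1 / 2 : ℝ) • (EuclideanSpace.single 0 1 + EuclideanSpace.single 1 1)

/-- A block has side length `1`, so a point of it is within `1/2` of the centre in each coordinate,
at squared distance at most `1/2`. -/
theorem cell_subset_ball {x y : ℤ × ℤ} (hN : 1 ≤ N) (hy : y ∈ latticeBlock x N) :
    cell N y ⊆ Metric.ball (blockCenter N x) 1 := by
  have hN0 : (0 : ℝ) < N := by exact_mod_cast hN
  intro w hw
  obtain ⟨⟨h1, h2⟩, h3, h4⟩ := (mem_cell_iff hN).1 hw
  simp only [latticeBlock, Finset.mem_product, Finset.mem_Ioc] at hy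
  rw [Metric.mem_ball, dist_eq_norm, ← sq_lt_one_iff₀ (norm_nonneg _), plane_norm_sq]
  have e0 : (w - blockCenter N x) 0 = w 0 - (x.1 / N + (1 / N + 1 / 2)) := by
    simp [blockCenter, gridPoint, gridStep, div_eq_mul_inv]
  have e1 : (w - blockCenter N x) 1 = w 1 - (x.2 / N + (1 / N + 1 / 2)) := by
    simp [blockCenter, gridPoint, gridStep, div_eq_mul_inv]
  have key : ∀ {a b : ℤ} {r : ℝ}, a < b → b ≤ a + N → b / N ≤ r → r < (b + 1) / N →
      (r - (a / N + (1 / N + 1 / 2))) ^ 2 ≤ 1 / 4 := by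
    intro a b r hab hba hr1 hr2
    have c1 : ((a : ℝ) + 1) / N ≤ b / N := by gcongr; exact_mod_cast hab
    have c2 : ((b : ℝ) + 1) / N ≤ (a + N + 1) / N := by gcongr; exact_mod_cast hba
    rw [add_div] at c1 hr2
    rw [add_div _ 1, add_div _ 1, add_div (a : ℝ), div_self hN0.ne'] at c2
    have d1 : -(1 / 2) ≤ r - (a / N + (1 / N + 1 / 2)) := by linarith
    have d2 : r - (a / N + (1 / N + 1 / 2)) ≤ 1 / 2 := by linarith
    nlinarith
  rw [e0, e1]
  have k0 := key hy.1.1 hy.1.2 h1 h2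
  have k1 := key hy.2.1 hy.2.2 h3 h4
  linarith

/-- On each cell `2N |flux| ≤ |v| + δ`. Integrating over the `N²` cells of area `1 / N²`, whose
union lies in a unit ball, gives `(2 / N) ∑ |flux| ≤ U + δ`. -/
theorem sum_abs_gridFlux_le (hN : 1 ≤ N) (hv : Continuous v) {δ U : ℝ} (hU0 : 0 ≤ U)
    (hδ : ∀ x y, dist x y ≤ 2 / N → |v x - v y| ≤ δ)
    (hU : ∀ x, ∫⁻ y in Metric.ball x 1, ‖v y‖ₑ ≤ ENNReal.ofReal U) (x : ℤ × ℤ) (i : Fin 2) :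
    ∑ y ∈ latticeBlock x N, |gridFlux N i v y| ≤ N * (U + δ) / 2 := by
  have hN0 : (0 : ℝ) < N := by exact_mod_cast hN
  have h1 : ∀ y, (2 * N * |gridFlux N i v y| - δ) / N ^ 2 ≤ ∫ w in cell N y, |v w| := by
    intro y
    have h2 : ∫ w in cell N y, (2 * N * |gridFlux N i v y| - δ) ≤ ∫ w in cell N y, |v w| := by
      refine setIntegral_mono_on (integrableOn_const (volume_cell_lt_top hN y).ne)
        (integrableOn_cell hN hv.abs y) (measurableSet_cell N y) fun w hw => ?_
      have h3 := (abs_gridFlux_sub_le_of_mem_cell hN hv hδ hw i).1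
      have h4 := abs_sub_abs_le_abs_sub (2 * N * gridFlux N i v y) (v w)
      rw [abs_mul, abs_of_pos (show (0 : ℝ) < 2 * N by positivity)] at h4
      linarith
    rw [setIntegral_const, volume_real_cell hN, smul_eq_mul, one_div_mul_eq_div] at h2
    exact h2
  have h2 : ∑ y ∈ latticeBlock x N, ∫ w in cell N y, |v w| ≤ U := by
    rw [← integral_biUnion_finset _ (fun y _ => measurableSet_cell N y) ?_
      fun y _ => integrableOn_cell hN hv.abs y]
    · have hsub : (⋃ y ∈ latticeBlock x N, cell N y) ⊆ Metric.ball (blockCenter N x) 1 :=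
        iUnion₂_subset fun y hy => cell_subset_ball hN hy
      have := (lintegral_mono_set (f := fun y => ‖v y‖ₑ) (μ := volume) hsub).trans (hU _)
      have h3 := (integral_norm_eq_lintegral_enorm (f := v)
        (μ := volume.restrict (⋃ y ∈ latticeBlock x N, cell N y))
        hv.aestronglyMeasurable)
      simp only [Real.norm_eq_abs] at h3
      rw [h3]
      exact ENNReal.toReal_le_of_le_ofReal hU0 this
    · intro a _ b _ hab
      rw [Function.onFun, Set.disjoint_left]
      intro w ha hb
      exact hab (Eq.trans (Eq.symm ha) hb)
  have h3 := (Finset.sum_le_sum fun y (_ : y ∈ latticeBlock x N) => h1 y).trans h2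
  rw [← Finset.sum_div, Finset.sum_sub_distrib, ← Finset.mul_sum, Finset.sum_const,
    div_le_iff₀ (by positivity)] at h3
  have hcard : (latticeBlock x N).card = N ^ 2 := by
    simp [latticeBlock, Finset.card_product, sq]
  rw [hcard, nsmul_eq_mul] at h3
  push_cast at h3
  have h4 : N * (2 * ∑ y ∈ latticeBlock x N, |gridFlux N i v y|) ≤ N * (N * (U + δ)) := by
    linarith
  have := le_of_mul_le_mul_left h4 hN0
  linarith

end LatticeFlux

/-! ### The generator applied to the initial value is bounded in `ℓ¹`. -/

section InitialGenerator

variable {N : ℕ} {p q : ℤ × ℤ → ℝ} {F : Plane → ℝ}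

theorem enorm_le_add_sum_enorm_sub (h : ℤ → ℝ) {a b : ℤ} (hab : a ≤ b) :
    ‖h b‖ₑ ≤ ‖h a‖ₑ + ∑ k ∈ Finset.Ico a b, ‖h (k + 1) - h k‖ₑ ∧
      ‖h a‖ₑ ≤ ‖h b‖ₑ + ∑ k ∈ Finset.Ico a b, ‖h (k + 1) - h k‖ₑ := by
  induction b, hab using Int.leInduction with
  | base => simp
  | succ b hab ih =>
    rw [← Finset.insert_Ico_right_eq_Ico_add_one hab, Finset.sum_insert (by simp)]
    constructor
    · calc ‖h (b + 1)‖ₑ = ‖(h (b + 1) - h b) + h b‖ₑ := by rw [sub_add_cancel]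
        _ ≤ ‖h (b + 1) - h b‖ₑ + ‖h b‖ₑ := enorm_add_le _ _
        _ ≤ ‖h (b + 1) - h b‖ₑ + (‖h a‖ₑ + ∑ k ∈ Finset.Ico a b, ‖h (k + 1) - h k‖ₑ) := by
          gcongr
          exact ih.1
        _ = _ := by ring
    · have h1 : ‖h b‖ₑ ≤ ‖h (b + 1)‖ₑ + ‖h (b + 1) - h b‖ₑ := by
        calc ‖h b‖ₑ = ‖h (b + 1) - (h (b + 1) - h b)‖ₑ := by rw [sub_sub_cancel]
          _ ≤ _ := enorm_sub_le
      calc ‖h a‖ₑ ≤ _ := ih.2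
        _ ≤ (‖h (b + 1)‖ₑ + ‖h (b + 1) - h b‖ₑ) + ∑ k ∈ Finset.Ico a b, ‖h (k + 1) - h k‖ₑ := by
          gcongr
        _ = _ := by ring

/-- One-dimensional Sobolev inequality: `h i` is compared with each `h j` of the interval, up to the
total variation, and the result is summed over `j`. -/
theorem natCast_mul_enorm_le_sum_Ioc (h : ℤ → ℝ) {a i : ℤ} (hi : i ∈ Finset.Ioc a (a + N)) :
    N * ‖h i‖ₑ ≤ ∑ j ∈ Finset.Ioc a (a + N), (‖h j‖ₑ + N * ‖h (j + 1) - h j‖ₑ) := by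
  have key : ∀ j ∈ Finset.Ioc a (a + N),
      ‖h i‖ₑ ≤ ‖h j‖ₑ + ∑ k ∈ Finset.Ioc a (a + N), ‖h (k + 1) - h k‖ₑ := by
    intro j hj
    rw [Finset.mem_Ioc] at hi hj
    rcases le_total i j with hij | hij
    · refine (enorm_le_add_sum_enorm_sub h hij).2.trans ?_
      gcongr
      intro k
      simp only [Finset.mem_Ico, Finset.mem_Ioc]
      omega
    · refine (enorm_le_add_sum_enorm_sub h hij).1.trans ?_
      gcongr
      intro k
      simp only [Finset.mem_Ico, Finset.mem_Ioc]
      omega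
  have := Finset.sum_le_sum key
  rw [Finset.sum_const, Finset.sum_add_distrib, Finset.sum_const] at this
  simp only [Int.card_Ioc, add_sub_cancel_left, Int.toNat_natCast, nsmul_eq_mul] at this
  rw [Finset.sum_add_distrib, ← Finset.mul_sum]
  exact this

/-- The one-dimensional inequality is used in each variable in turn. Only the mixed second
difference occurs. -/
theorem natCast_sq_mul_enorm_le_sum_latticeBlock (g : ℤ × ℤ → ℝ) {x y : ℤ × ℤ}
    (hx : x ∈ latticeBlock y N) :
    (N : ℝ≥0∞) ^ 2 * ‖g x‖ₑ ≤ ∑ z ∈ latticeBlock y N, ((‖g z‖ₑ + N * ‖g (z + dirY) - g z‖ₑ) +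
      N * (‖g (z + dirX) - g z‖ₑ +
        N * ‖g (z + dirY + dirX) - g (z + dirY) - (g (z + dirX) - g z)‖ₑ)) := by
  unfold latticeBlock at *
  rw [Finset.mem_product] at hx
  rw [Finset.sum_product]
  have h1 := natCast_mul_enorm_le_sum_Ioc (fun i => g (i, x.2)) hx.1
  have h2 := fun i => natCast_mul_enorm_le_sum_Ioc (fun j => g (i, j)) hx.2
  have h3 := fun i => natCast_mul_enorm_le_sum_Ioc (fun j => g (i + 1, j) - g (i, j)) hx.2
  calc (N : ℝ≥0∞) ^ 2 * ‖g x‖ₑ = N * (N * ‖g (x.1, x.2)‖ₑ) := by ring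
    _ ≤ N * ∑ i ∈ Finset.Ioc y.1 (y.1 + N), (‖g (i, x.2)‖ₑ + N * ‖g (i + 1, x.2) - g (i, x.2)‖ₑ) := by
      gcongr
    _ = ∑ i ∈ Finset.Ioc y.1 (y.1 + N),
        (N * ‖g (i, x.2)‖ₑ + N * (N * ‖g (i + 1, x.2) - g (i, x.2)‖ₑ)) := by
      rw [Finset.mul_sum]
      simp only [mul_add]
    _ ≤ _ := by
      refine Finset.sum_le_sum fun i _ => (add_le_add (h2 i) (mul_le_mul_right (h3 i) _)).trans ?_
      rw [Finset.mul_sum, ← Finset.sum_add_distrib]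
      refine Finset.sum_le_sum fun j _ => ?_
      simp

/-- Each lattice point belongs to exactly `N²` blocks. -/
theorem tsum_sum_latticeBlock (f : ℤ × ℤ → ℝ≥0∞) :
    ∑' y, ∑ x ∈ latticeBlock y N, f x = N ^ 2 * ∑' x, f x := by
  have h1 : ∀ y, ∑ x ∈ latticeBlock y N, f x = ∑ v ∈ latticeBlock 0 N, f (y + v) := by
    intro y
    refine (Finset.sum_bij (fun v _ => y + v) ?_ ?_ ?_ fun _ _ => rfl).symm
    · intro v hv
      simp only [latticeBlock, Finset.mem_product, Finset.mem_Ioc, Prod.fst_add, Prod.snd_add,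
        Prod.fst_zero, Prod.snd_zero] at hv ⊢
      omega
    · intro v _ w _ h
      exact add_left_cancel h
    · intro x hx
      refine ⟨x - y, ?_, by abel⟩
      simp only [latticeBlock, Finset.mem_product, Finset.mem_Ioc, Prod.fst_sub, Prod.snd_sub,
        Prod.fst_zero, Prod.snd_zero] at hx ⊢
      omega
  have h2 : ∀ v, ∑' y, f (y + v) = ∑' y, f y := fun v => (Equiv.addRight v).tsum_eq f
  simp only [h1]
  rw [Summable.tsum_finsetSum fun _ _ => ENNReal.summable]
  simp only [h2]
  rw [Finset.sum_const, nsmul_eq_mul]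
  congr 1
  simp [latticeBlock, Finset.card_product, sq]

/-- A weight whose sums over blocks are bounded satisfies a Sobolev trace inequality. -/
theorem natCast_sq_mul_tsum_mul_enorm_le (hN : 1 ≤ N) {w : ℤ × ℤ → ℝ≥0∞} {K : ℝ≥0∞}
    (hw : ∀ y, ∑ x ∈ latticeBlock y N, w x ≤ K) (g : ℤ × ℤ → ℝ) :
    N ^ 2 * ∑' x, w x * ‖g x‖ₑ ≤ K * ∑' z, ((‖g z‖ₑ + N * ‖g (z + dirY) - g z‖ₑ) +
      N * (‖g (z + dirX) - g z‖ₑ +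
        N * ‖g (z + dirY + dirX) - g (z + dirY) - (g (z + dirX) - g z)‖ₑ)) := by
  set T : ℤ × ℤ → ℝ≥0∞ := fun z => (‖g z‖ₑ + N * ‖g (z + dirY) - g z‖ₑ) +
      N * (‖g (z + dirX) - g z‖ₑ +
        N * ‖g (z + dirY + dirX) - g (z + dirY) - (g (z + dirX) - g z)‖ₑ) with hT
  have h1 : ∀ y, ∑ x ∈ latticeBlock y N, N ^ 2 * (w x * ‖g x‖ₑ) ≤
      K * ∑ z ∈ latticeBlock y N, T z := fun y =>
    calc ∑ x ∈ latticeBlock y N, N ^ 2 * (w x * ‖g x‖ₑ)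
        ≤ ∑ x ∈ latticeBlock y N, w x * ∑ z ∈ latticeBlock y N, T z := by
          refine Finset.sum_le_sum fun x hx => ?_
          rw [mul_left_comm]
          gcongr
          exact natCast_sq_mul_enorm_le_sum_latticeBlock g hx
      _ ≤ _ := by
          rw [← Finset.sum_mul]
          gcongr
          exact hw y
  -- Summing over all blocks counts each point `N²` times on both sides, and one factor `N²`
  -- cancels.
  have h2 := ENNReal.tsum_le_tsum h1
  rw [tsum_sum_latticeBlock, ENNReal.tsum_mul_left, ENNReal.tsum_mul_left, tsum_sum_latticeBlock,
    mul_left_comm K] at h2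
  exact (ENNReal.mul_le_mul_iff_right (by simp; omega) (by simp)).1 h2

theorem partialDeriv_comm (hF : ContDiff ℝ ∞ F) (i j : Fin 2) :
    partialDeriv i (partialDeriv j F) = partialDeriv j (partialDeriv i F) := by
  funext x
  have h1 : ∀ i j, partialDeriv i (partialDeriv j F) x =
      fderiv ℝ (fderiv ℝ F) x (EuclideanSpace.single i 1) (EuclideanSpace.single j 1) := by
    intro i j
    have hd : DifferentiableAt ℝ (fderiv ℝ F) x :=
      ((hF.fderiv_right (m := ∞) (by simp)).differentiable (by simp)).differentiableAt
    unfold partialDeriv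
    rw [fderiv_clm_apply hd (differentiableAt_const _)]
    simp
  rw [h1, h1]
  exact (hF.contDiffAt.isSymmSndFDerivAt
    (minSmoothness_of_isRCLikeNormedField.trans_le (WithTop.coe_le_coe.2 le_top))).eq _ _

/-- The sum of the `L¹` norms of `F`, `∂₀F`, `∂₁F` and `∂₀∂₁F`. -/
noncomputable def mixedNorm (F : Plane → ℝ) : ℝ≥0∞ :=
  (∫⁻ x, ‖F x‖ₑ) + (∫⁻ x, ‖partialDeriv 0 F x‖ₑ) + (∫⁻ x, ‖partialDeriv 1 F x‖ₑ) +
    (∫⁻ x, ‖partialDeriv 0 (partialDeriv 1 F) x‖ₑ)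

/-- Differences of cell averages are averages of grid differences, and each factor `N` turns a grid
difference into a derivative. This is how the product of `∇θ₀` with a drift that is only uniformly
locally integrable is seen to be summable. -/
theorem tsum_mul_enorm_cellAvg_le (hN : 1 ≤ N) {w : ℤ × ℤ → ℝ≥0∞} {K : ℝ≥0∞}
    (hw : ∀ y, ∑ x ∈ latticeBlock y N, w x ≤ K) (hF : ContDiff ℝ ∞ F) :
    ∑' x, w x * ‖cellAvg N F x‖ₑ ≤ K * mixedNorm F := by
  have hN0 : (N : ℝ≥0∞) ≠ 0 := by simp; omega
  have hNt : (N : ℝ≥0∞) ≠ ⊤ := by simp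
  have hc := hF.continuous
  have ex : (dirX : ℤ × ℤ) = latticeDir 0 := rfl
  have ey : (dirY : ℤ × ℤ) = latticeDir 1 := rfl
  have h := natCast_sq_mul_tsum_mul_enorm_le hN hw (cellAvg N F)
  rw [ex, ey] at h
  have hd0 : ContDiff ℝ ∞ (gridDiff N 0 F) := contDiff_gridDiff hF 0
  simp only [add_right_comm _ (latticeDir 1), ← cellAvg_gridDiff hN hc] at h
  have hxy : ∀ z, cellAvg N F (z + latticeDir 0 + latticeDir 1) - cellAvg N F (z + latticeDir 1) -
      cellAvg N (gridDiff N 0 F) z = cellAvg N (gridDiff N 1 (gridDiff N 0 F)) z := fun z => by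
    rw [cellAvg_gridDiff hN hd0.continuous, add_right_comm, ← cellAvg_gridDiff hN hc]
  simp only [hxy] at h
  have hpt : ∑' z, ((‖cellAvg N F z‖ₑ + N * ‖cellAvg N (gridDiff N 1 F) z‖ₑ) +
      N * (‖cellAvg N (gridDiff N 0 F) z‖ₑ + N * ‖cellAvg N (gridDiff N 1 (gridDiff N 0 F)) z‖ₑ)) ≤
      N ^ 2 * mixedNorm F := by
    rw [ENNReal.tsum_add, ENNReal.tsum_add, ENNReal.tsum_mul_left, ENNReal.tsum_mul_left,
      ENNReal.tsum_add, ENNReal.tsum_mul_left]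
    have i1 : N * (∫⁻ x, ‖gridDiff N 1 F x‖ₑ) ≤ (∫⁻ x, ‖partialDeriv 1 F x‖ₑ) :=
      lintegral_enorm_gridDiff_le hN hF 1
    have i0 : N * (∫⁻ x, ‖gridDiff N 0 F x‖ₑ) ≤ (∫⁻ x, ‖partialDeriv 0 F x‖ₑ) :=
      lintegral_enorm_gridDiff_le hN hF 0
    have i2 : N * (N * (∫⁻ x, ‖gridDiff N 1 (gridDiff N 0 F) x‖ₑ)) ≤
        (∫⁻ x, ‖partialDeriv 0 (partialDeriv 1 F) x‖ₑ) := by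
      refine (mul_le_mul_right (lintegral_enorm_gridDiff_le hN hd0 1) _).trans ?_
      rw [partialDeriv_gridDiff hF]
      exact lintegral_enorm_gridDiff_le hN (contDiff_partialDeriv hF 1) 0
    calc _ ≤ (N ^ 2 * (∫⁻ x, ‖F x‖ₑ) + N * (N ^ 2 * (∫⁻ x, ‖gridDiff N 1 F x‖ₑ))) +
          N * (N ^ 2 * (∫⁻ x, ‖gridDiff N 0 F x‖ₑ) +
            N * (N ^ 2 * (∫⁻ x, ‖gridDiff N 1 (gridDiff N 0 F) x‖ₑ))) := by
          gcongr <;> exact tsum_enorm_cellAvg_le _ _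
      _ = N ^ 2 * ((∫⁻ x, ‖F x‖ₑ) + N * (∫⁻ x, ‖gridDiff N 0 F x‖ₑ) + N * (∫⁻ x, ‖gridDiff N 1 F x‖ₑ) +
            N * (N * (∫⁻ x, ‖gridDiff N 1 (gridDiff N 0 F) x‖ₑ))) := by ring
      _ ≤ _ := by
          unfold mixedNorm
          gcongr
  have h2 := h.trans (mul_le_mul_right hpt K)
  rw [mul_left_comm] at h2
  exact (ENNReal.mul_le_mul_iff_right (pow_ne_zero 2 hN0) (ENNReal.pow_ne_top hNt)).1 h2

theorem natCast_mul_mixedNorm_gridDiff_le (hN : 1 ≤ N) (hF : ContDiff ℝ ∞ F) (i : Fin 2) :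
    N * mixedNorm (gridDiff N i F) ≤ mixedNorm (partialDeriv i F) := by
  have h0 := contDiff_partialDeriv hF 0
  have h1 := contDiff_partialDeriv hF 1
  have h01 := contDiff_partialDeriv h1 0
  unfold mixedNorm
  rw [mul_add, mul_add, mul_add, partialDeriv_gridDiff hF, partialDeriv_gridDiff hF,
    partialDeriv_gridDiff h1, partialDeriv_comm hF 1 i,
    partialDeriv_comm hF 0 i, partialDeriv_comm h1 0 i]
  gcongr
  · exact lintegral_enorm_gridDiff_le hN hF i
  · exact lintegral_enorm_gridDiff_le hN h0 i
  · exact lintegral_enorm_gridDiff_le hN h1 i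
  · exact lintegral_enorm_gridDiff_le hN h01 i

theorem mixedNorm_partialDeriv_le (hF : ContDiff ℝ ∞ F) {W : ℝ≥0∞}
    (hW : ∀ α : ℕ × ℕ, α.1 + α.2 ≤ 3 → ∫⁻ x, ‖multiDeriv α F x‖ₑ ≤ W) (i : Fin 2) :
    mixedNorm (partialDeriv i F) ≤ 4 * W := by
  have e : (4 : ℝ≥0∞) * W = W + W + W + W := by ring
  rw [e]
  have h1 := contDiff_partialDeriv hF 1
  unfold mixedNorm
  have k := fun a b hab => hW (a, b) hab
  fin_cases i
  · dsimp only [Fin.zero_eta, Fin.isValue]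
    rw [partialDeriv_comm hF 1 0]
    exact add_le_add (add_le_add (add_le_add (k 1 0 (by simp)) (k 2 0 (by simp)))
      (k 1 1 (by simp))) (k 2 1 (by simp))
  · dsimp only [Fin.mk_one, Fin.isValue]
    exact add_le_add (add_le_add (add_le_add (k 0 1 (by simp)) (k 1 1 (by simp)))
      (k 0 2 (by simp))) (k 1 2 (by simp))

theorem sum_latticeBlock_add (w : ℤ × ℤ → ℝ≥0∞) (y v : ℤ × ℤ) :
    ∑ x ∈ latticeBlock y N, w (x + v) = ∑ x ∈ latticeBlock (y + v) N, w x := by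
  refine Finset.sum_bij (fun x _ => x + v) ?_ ?_ ?_ fun _ _ => rfl
  · intro x hx
    simp only [latticeBlock, Finset.mem_product, Finset.mem_Ioc, Prod.fst_add, Prod.snd_add] at hx ⊢
    omega
  · intro x _ w _ h
    exact add_right_cancel h
  · intro x hx
    refine ⟨x - v, ?_, by abel⟩
    simp only [latticeBlock, Finset.mem_product, Finset.mem_Ioc, Prod.fst_sub, Prod.snd_sub,
      Prod.fst_add, Prod.snd_add] at hx ⊢
    omega

theorem tsum_enorm_latticeGenerator_le (p q f : ℤ × ℤ → ℝ) :
    ∑' x, ‖latticeGenerator p q f x‖ₑ ≤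
      (∑' x, ‖f (x + dirX + dirX) - f (x + dirX) - (f (x + dirX) - f x)‖ₑ +
        ∑' x, ‖f (x + dirY + dirY) - f (x + dirY) - (f (x + dirY) - f x)‖ₑ) +
      2 * (∑' x, ‖p (x + dirX)‖ₑ * ‖f (x + dirX) - f x‖ₑ +
        ∑' x, ‖q (x + dirY)‖ₑ * ‖f (x + dirY) - f x‖ₑ) := by
  have hpt : ∀ x, ‖latticeGenerator p q f x‖ₑ ≤
      (‖f (x - dirX + dirX + dirX) - f (x - dirX + dirX) - (f (x - dirX + dirX) - f (x - dirX))‖ₑ +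
        ‖f (x - dirY + dirY + dirY) - f (x - dirY + dirY) - (f (x - dirY + dirY) - f (x - dirY))‖ₑ) +
      ((‖p (x + dirX)‖ₑ * ‖f (x + dirX) - f x‖ₑ +
        ‖p (x - dirX + dirX)‖ₑ * ‖f (x - dirX + dirX) - f (x - dirX)‖ₑ) +
      (‖q (x + dirY)‖ₑ * ‖f (x + dirY) - f x‖ₑ +
        ‖q (x - dirY + dirY)‖ₑ * ‖f (x - dirY + dirY) - f (x - dirY)‖ₑ)) := by
    intro x
    simp only [sub_add_cancel]
    have : latticeGenerator p q f x = ((f (x + dirX) - f x - (f x - f (x - dirX))) +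
        (f (x + dirY) - f x - (f x - f (x - dirY)))) -
        ((p (x + dirX) * (f (x + dirX) - f x) + p x * (f x - f (x - dirX))) +
        (q (x + dirY) * (f (x + dirY) - f x) + q x * (f x - f (x - dirY)))) := by
      unfold latticeGenerator
      ring
    rw [this]
    simp only [← enorm_mul]
    refine enorm_sub_le.trans (add_le_add (enorm_add_le _ _) ((enorm_add_le _ _).trans ?_))
    exact add_le_add (enorm_add_le _ _) (enorm_add_le _ _)
  have hs : ∀ (g : ℤ × ℤ → ℝ≥0∞) v, ∑' x, g (x - v) = ∑' x, g x := fun g v =>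
    (Equiv.subRight v).tsum_eq g
  refine (ENNReal.tsum_le_tsum hpt).trans (le_of_eq ?_)
  simp only [ENNReal.tsum_add]
  rw [hs (fun x => ‖f (x + dirX + dirX) - f (x + dirX) - (f (x + dirX) - f x)‖ₑ),
    hs (fun x => ‖f (x + dirY + dirY) - f (x + dirY) - (f (x + dirY) - f x)‖ₑ),
    hs (fun x => ‖p (x + dirX)‖ₑ * ‖f (x + dirX) - f x‖ₑ),
    hs (fun x => ‖q (x + dirY)‖ₑ * ‖f (x + dirY) - f x‖ₑ)]
  ring

/-- The sum does not depend on the scale: the unscaled generator is of size `N⁻²`, and there are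
`N²` cells per unit area. The two pure second derivatives give `2W`. In each direction the weight `N
U`, the factor `1 / N` of a first difference and the four terms of `mixedNorm` give `4 U W`; two
directions and the factor `2` make `16 U W`. -/
theorem tsum_enorm_latticeGenerator_cellAvg_le (hN : 1 ≤ N) (hF : ContDiff ℝ ∞ F) {W U : ℝ≥0∞}
    (hW : ∀ α : ℕ × ℕ, α.1 + α.2 ≤ 3 → ∫⁻ x, ‖multiDeriv α F x‖ₑ ≤ W)
    (hp : ∀ y, ∑ x ∈ latticeBlock y N, ‖p x‖ₑ ≤ N * U)
    (hq : ∀ y, ∑ x ∈ latticeBlock y N, ‖q x‖ₑ ≤ N * U) :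
    ∑' x, ‖latticeGenerator p q (cellAvg N F) x‖ₑ ≤ 2 * W + 16 * U * W := by
  have hc := hF.continuous
  have ex : (dirX : ℤ × ℤ) = latticeDir 0 := rfl
  have ey : (dirY : ℤ × ℤ) = latticeDir 1 := rfl
  have hd := fun i => contDiff_gridDiff (N := N) hF i
  have h2 : ∀ i, ∑' x, ‖cellAvg N F (x + latticeDir i + latticeDir i) -
      cellAvg N F (x + latticeDir i) - (cellAvg N F (x + latticeDir i) - cellAvg N F x)‖ₑ ≤
      ∫⁻ x, ‖partialDeriv i (partialDeriv i F) x‖ₑ := by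
    intro i
    simp only [← cellAvg_gridDiff hN hc, ← cellAvg_gridDiff hN (hd i).continuous]
    refine (tsum_enorm_cellAvg_le _ _).trans ?_
    rw [sq, mul_assoc]
    refine (mul_le_mul_right (lintegral_enorm_gridDiff_le hN (hd i) i) _).trans ?_
    rw [partialDeriv_gridDiff hF]
    exact lintegral_enorm_gridDiff_le hN (contDiff_partialDeriv hF i) i
  have h1 : ∀ (i : Fin 2) (w : ℤ × ℤ → ℝ≥0∞), (∀ y, ∑ x ∈ latticeBlock y N, w x ≤ N * U) →
      ∑' x, w (x + latticeDir i) * ‖cellAvg N F (x + latticeDir i) - cellAvg N F x‖ₑ ≤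
        4 * U * W := by
    intro i w hw
    simp only [← cellAvg_gridDiff hN hc]
    refine (tsum_mul_enorm_cellAvg_le hN (w := fun x => w (x + latticeDir i)) (K := N * U)
      (fun y => ?_) (hd i)).trans ?_
    · rw [sum_latticeBlock_add]
      exact hw _
    · rw [mul_comm (N : ℝ≥0∞), mul_assoc, mul_comm 4 U, mul_assoc]
      exact mul_le_mul_right ((natCast_mul_mixedNorm_gridDiff_le hN hF i).trans
        (mixedNorm_partialDeriv_le hF hW i)) U
  refine (tsum_enorm_latticeGenerator_le p q _).trans ?_
  rw [ex, ey]
  calc _ ≤ (W + W) + 2 * (4 * U * W + 4 * U * W) := by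
        refine add_le_add (add_le_add ((h2 0).trans (hW (2, 0) (by simp)))
          ((h2 1).trans (hW (0, 2) (by simp)))) (mul_le_mul_right (add_le_add ?_ ?_) _)
        · exact h1 0 (fun x => ‖p x‖ₑ) hp
        · exact h1 1 (fun x => ‖q x‖ₑ) hq
    _ = _ := by ring

/-- Truncation of a summable function to a large finite set hardly changes the total variation of
its image under the generator. -/
theorem IsLatticeFlux.exists_truncation (h : IsLatticeFlux p q) {f : ℤ × ℤ → ℝ} {W κ : ℝ}
    (hf : ∑' x, ‖f x‖ₑ ≠ ⊤) (hW0 : 0 ≤ W)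
    (hW : ∑' x, ‖latticeGenerator p q f x‖ₑ ≤ ENNReal.ofReal W) (hκ : 0 < κ)
    (S₀ : Finset (ℤ × ℤ)) :
    ∃ S, S₀ ⊆ S ∧ ∀ g : ℤ × ℤ → ℝ, (∀ x ∈ S, g x = f x) → (∀ x ∉ S, g x = 0) →
      ∑' x, |latticeGenerator p q g x| ≤ W + κ := by
  have hlim := ENNReal.tendsto_tsum_compl_atTop_zero hf
  -- The jump rates are at most `3/2`, and the four neighbours together with four copies of the
  -- centre make eight terms: `12 = 8 · 3/2`.
  have hκ' : (0 : ℝ≥0∞) < ENNReal.ofReal (κ / 12) := by simpa using by linarith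
  obtain ⟨S, hS0, hS⟩ := ((Filter.eventually_ge_atTop S₀).and (hlim.eventually_lt_const hκ')).exists
  refine ⟨S, hS0, fun g hg hg0 => ?_⟩
  have hfg : ∑' x, ‖g x - f x‖ₑ ≤ ENNReal.ofReal (κ / 12) := by
    refine le_trans (le_of_eq ?_) hS.le
    rw [← tsum_subtype_eq_of_support_subset (s := {x | x ∉ S})]
    · refine tsum_congr fun x => ?_
      rw [hg0 _ x.2, zero_sub, enorm_neg]
    · intro x hx hxS
      exact hx (by simp [hg x hxS])
  have hsh : ∀ v, ∑' x, ‖g (x + v) - f (x + v)‖ₑ ≤ ENNReal.ofReal (κ / 12) := fun v =>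
    ((Equiv.addRight v).tsum_eq fun x => ‖g x - f x‖ₑ).trans_le hfg
  have hb : ∀ {a : ℝ}, |a| ≤ 1 / 2 → ‖1 - a‖ₑ ≤ 3 / 2 ∧ ‖1 + a‖ₑ ≤ 3 / 2 := by
    intro a ha
    have e : (3 / 2 : ℝ≥0∞) = ENNReal.ofReal (3 / 2) := by
      rw [ENNReal.ofReal_div_of_pos (by norm_num)]
      norm_num
    rw [Real.enorm_eq_ofReal_abs, Real.enorm_eq_ofReal_abs, e]
    rw [abs_le] at ha
    exact ⟨ENNReal.ofReal_le_ofReal (abs_le.2 ⟨by linarith, by linarith⟩),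
      ENNReal.ofReal_le_ofReal (abs_le.2 ⟨by linarith, by linarith⟩)⟩
  have hpt : ∀ x, ‖latticeGenerator p q g x‖ₑ ≤ ‖latticeGenerator p q f x‖ₑ +
      3 / 2 * (‖g (x + dirX) - f (x + dirX)‖ₑ + ‖g (x + -dirX) - f (x + -dirX)‖ₑ +
        ‖g (x + dirY) - f (x + dirY)‖ₑ + ‖g (x + -dirY) - f (x + -dirY)‖ₑ +
        4 * ‖g (x + 0) - f (x + 0)‖ₑ) := by
    intro x
    have e : latticeGenerator p q g x = latticeGenerator p q f x +
        ((1 - p (x + dirX)) * ((g (x + dirX) - f (x + dirX)) - (g (x + 0) - f (x + 0))) +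
        (1 + p x) * ((g (x + -dirX) - f (x + -dirX)) - (g (x + 0) - f (x + 0))) +
        (1 - q (x + dirY)) * ((g (x + dirY) - f (x + dirY)) - (g (x + 0) - f (x + 0))) +
        (1 + q x) * ((g (x + -dirY) - f (x + -dirY)) - (g (x + 0) - f (x + 0)))) := by
      unfold latticeGenerator
      simp only [← sub_eq_add_neg, add_zero]
      ring
    rw [e]
    refine (enorm_add_le _ _).trans (add_le_add le_rfl ?_)
    refine ((enorm_add_le _ _).trans (add_le_add ((enorm_add_le _ _).trans (add_le_add
      (enorm_add_le _ _) le_rfl)) le_rfl)).trans ?_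
    simp only [enorm_mul]
    refine (add_le_add (add_le_add (add_le_add
      (mul_le_mul' (hb (h.abs_left_le _)).1 enorm_sub_le)
      (mul_le_mul' (hb (h.abs_left_le _)).2 enorm_sub_le))
      (mul_le_mul' (hb (h.abs_right_le _)).1 enorm_sub_le))
      (mul_le_mul' (hb (h.abs_right_le _)).2 enorm_sub_le)).trans (le_of_eq (by ring))
  have hκ12 : (3 / 2 : ℝ≥0∞) * (ENNReal.ofReal (κ / 12) + ENNReal.ofReal (κ / 12) +
      ENNReal.ofReal (κ / 12) + ENNReal.ofReal (κ / 12) + 4 * ENNReal.ofReal (κ / 12)) =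
      ENNReal.ofReal κ := by
    have e : (3 / 2 : ℝ≥0∞) = ENNReal.ofReal (3 / 2) := by
      rw [ENNReal.ofReal_div_of_pos (by norm_num)]
      norm_num
    have e4 : (4 : ℝ≥0∞) = ENNReal.ofReal 4 := by norm_num
    have hp : 0 ≤ κ / 12 := by positivity
    rw [e, e4, ← ENNReal.ofReal_mul (by norm_num), ← ENNReal.ofReal_add hp hp,
      ← ENNReal.ofReal_add (by positivity) hp, ← ENNReal.ofReal_add (by positivity) hp,
      ← ENNReal.ofReal_add (by positivity) (by positivity), ← ENNReal.ofReal_mul (by norm_num)]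
    congr 1
    ring
  have hfin : g.HasFiniteSupport := S.finite_toSet.subset fun x hx => by
    by_contra hxS
    exact hx (hg0 x hxS)
  have hsum : Summable fun x => |latticeGenerator p q g x| :=
    (summable_of_hasFiniteSupport (hasFiniteSupport_latticeGenerator hfin)).abs
  have htot : ∑' x, ‖latticeGenerator p q g x‖ₑ ≤ ENNReal.ofReal (W + κ) := by
    refine (ENNReal.tsum_le_tsum hpt).trans ?_
    rw [ENNReal.tsum_add, ENNReal.tsum_mul_left, ENNReal.ofReal_add hW0 hκ.le, ← hκ12]
    simp only [ENNReal.tsum_add, ENNReal.tsum_mul_left]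
    gcongr <;> apply hsh
  simp only [Real.enorm_eq_ofReal_abs] at htot
  rw [← ENNReal.ofReal_tsum_of_nonneg (fun _ => abs_nonneg _) hsum] at htot
  exact (ENNReal.ofReal_le_ofReal_iff (by positivity)).1 htot

end InitialGenerator

/-! ### Construction of the lattice approximation. -/

section Scheme

/-- Data of a lattice approximation, at scale `ε`, of the Cauchy problem with drift `v` and initial
value `θ₀`. -/
structure LatticeScheme (U A W : ℝ) (v : Fin 2 → Plane → ℝ) (θ₀ : Plane → ℝ) (ε : ℝ) where
  /-- A quarter of the inverse mesh. -/
  M : ℕ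
  /-- The horizontal flux. -/
  p : ℤ × ℤ → ℝ
  /-- The vertical flux. -/
  q : ℤ × ℤ → ℝ
  /-- The initial value. -/
  f : ℤ × ℤ → ℝ
  /-- The set on which the equation is solved. -/
  S : Finset (ℤ × ℤ)
  one_le : 1 ≤ M
  inv_le : 1 / ((4 * M : ℕ) : ℝ) ≤ ε
  flux : IsLatticeFlux p q
  sum_le : ∀ x, ∑ y ∈ latticeBlock x (4 * M), (|p y| + |q y|) ≤ (4 * M : ℕ) * (U + 1)
  abs_initial_le : ∀ x, |f x| ≤ A
  eq_zero : ∀ x ∉ S, f x = 0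
  tsum_le : ∑' x, |latticeGenerator p q f x| ≤ W
  -- The Dirichlet boundary recedes to infinity as `ε → 0`, so it leaves no trace in the limit.
  mem : ∀ x : Plane, ‖x‖ ≤ 1 / ε → cellIndex (4 * M) x ∈ S
  left : ∀ x, |2 * (4 * M : ℕ) * p (cellIndex (4 * M) x) - v 0 x| ≤ ε ∧
    |2 * (4 * M : ℕ) * p (cellIndex (4 * M) x + dirX) - v 0 x| ≤ ε
  right : ∀ x, |2 * (4 * M : ℕ) * q (cellIndex (4 * M) x) - v 1 x| ≤ ε ∧
    |2 * (4 * M : ℕ) * q (cellIndex (4 * M) x + dirY) - v 1 x| ≤ ε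
  initial : ∀ x, ‖x‖ ≤ 1 / ε → ∀ δ, (∀ y, dist y x < 3 * ε → |θ₀ y - θ₀ x| ≤ δ) →
    |f (cellIndex (4 * M) x) - θ₀ x| ≤ δ

variable {u : Plane → Plane} {θ₀ η : Plane → ℝ} {ε : ℝ}

theorem lintegral_ball_le_uniformLocL1Norm (hU : uniformLocL1Norm u < ⊤) (x : Plane) (i : Fin 2) :
    ∫⁻ y in Metric.ball x 1, ‖u y i‖ₑ ≤ ENNReal.ofReal (uniformLocL1Norm u).toReal := by
  rw [ENNReal.ofReal_toReal hU.ne]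
  refine le_trans (lintegral_mono fun y => ?_)
    (le_iSup (fun x => ∫⁻ y in Metric.ball x 1, ‖u y‖ₑ) x)
  rw [enorm_le_iff_norm_le]
  exact PiLp.norm_apply_le (u y) i

theorem lintegral_closedBall_le_uniformLocL1Norm (hU : uniformLocL1Norm u < ⊤) (x : Plane)
    (i : Fin 2) : ∫⁻ y in Metric.closedBall x 1, ‖u y i‖ₑ ≤
      ENNReal.ofReal (uniformLocL1Norm u).toReal := by
  have h : (Metric.closedBall x 1 : Set Plane) =ᵐ[volume] Metric.ball x 1 := by
    rw [← Metric.ball_union_sphere]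
    exact union_ae_eq_left_of_ae_eq_empty 
      (ae_eq_empty.2 (Measure.addHaar_sphere _ _ _))
  rw [Measure.restrict_congr_set h]
  exact lintegral_ball_le_uniformLocL1Norm hU x i

theorem exists_abs_le_of_hasCompactSupport (hη : Continuous η) (hc : HasCompactSupport η) :
    ∃ B, ∀ x, |η x| ≤ B := by
  simpa using hη.bounded_above_of_compact_support hc

theorem exists_abs_mollify_le (hη : Continuous η) (h1 : ∀ x, 1 < ‖x‖ → η x = 0)
    (hU : uniformLocL1Norm u < ⊤) : ∃ B, ∀ (i : Fin 2) x, |mollify η (fun y => u y i) x| ≤ B := by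
  obtain ⟨B, hB⟩ := exists_abs_le_of_hasCompactSupport hη
    (HasCompactSupport.intro (isCompact_closedBall (0 : Plane) 1) fun x hx =>
      h1 x (by simpa using hx))
  exact ⟨_, fun i x => abs_mollify_le hB h1 x (lintegral_closedBall_le_uniformLocL1Norm hU x i)
    ENNReal.toReal_nonneg⟩

/-- The Lipschitz constant may degenerate as `ε → 0`; this is harmless because the mesh is chosen
after the mollifier. -/
theorem exists_abs_mollify_sub_le (h : IsMollifier η ε) (hε : ε ≤ 1) (hu : LocallyIntegrable u)
    (hU : uniformLocL1Norm u < ⊤) : ∃ B, 0 ≤ B ∧ ∀ (i : Fin 2) x y,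
      |mollify η (fun y => u y i) x - mollify η (fun y => u y i) y| ≤ B * dist x y := by
  have hb : ∀ j, ∃ B, ∀ (i : Fin 2) x, |partialDeriv j (mollify η fun y => u y i) x| ≤ B := by
    intro j
    obtain ⟨B, hB⟩ := exists_abs_mollify_le (contDiff_partialDeriv h.contDiff j).continuous
      (fun x hx => partialDeriv_eq_zero h.eq_zero (hε.trans_lt hx) j) hU
    refine ⟨B, fun i x => ?_⟩
    rw [partialDeriv_mollify h.contDiff h.hasCompactSupport (locallyIntegrable_coord hu i)]
    exact hB i x
  obtain ⟨B0, hB0⟩ := hb 0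
  obtain ⟨B1, hB1⟩ := hb 1
  have h0 : 0 ≤ B0 := (abs_nonneg _).trans (hB0 0 0)
  have h1 : 0 ≤ B1 := (abs_nonneg _).trans (hB1 0 0)
  refine ⟨B0 + B1, by positivity, fun i x y => ?_⟩
  have hsm := contDiff_mollify h.contDiff h.hasCompactSupport (locallyIntegrable_coord hu i)
  have := Convex.norm_image_sub_le_of_norm_fderiv_le (𝕜 := ℝ) (s := univ) (C := B0 + B1)
    (f := mollify η fun y => u y i) (x := y) (y := x)
    (fun z _ => (hsm.differentiable (by simp)).differentiableAt) (fun z _ => ?_) convex_univ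
    (mem_univ _) (mem_univ _)
  · rwa [Real.norm_eq_abs, ← dist_eq_norm] at this
  · refine ContinuousLinearMap.opNorm_le_bound _ (by positivity) fun w => ?_
    rw [fderiv_eq_sum_partialDeriv, Real.norm_eq_abs, add_mul]
    refine (abs_add_le _ _).trans ?_
    rw [abs_mul, abs_mul]
    have := hB0 i z
    have := hB1 i z
    have := abs_coord_le_norm w 0
    have := abs_coord_le_norm w 1
    gcongr

theorem abs_le_c2w41Norm (h2 : MemC2 θ₀) (h4 : MemW41 θ₀) (x : Plane) :
    |θ₀ x| ≤ c2w41Norm θ₀ := by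
  have h : ‖θ₀ x‖ₑ ≤ c2Norm θ₀ + w41Norm θ₀ := by
    refine le_trans ?_ le_self_add
    unfold c2Norm
    refine le_trans ?_ (Finset.single_le_sum (fun _ _ => zero_le) (Finset.mem_range.2
      (show 0 < 3 by norm_num)))
    refine le_trans ?_ (Finset.single_le_sum (fun _ _ => zero_le)
      (Finset.HasAntidiagonal.mem_antidiagonal.2 (show (0, 0).1 + (0, 0).2 = 0 from rfl)))
    exact le_iSup (fun x => ‖multiDeriv (0, 0) θ₀ x‖ₑ) x
  have := ENNReal.toReal_mono (ENNReal.add_lt_top.2 ⟨h2.2, h4⟩).ne h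
  rwa [toReal_enorm, Real.norm_eq_abs] at this

theorem weakDerivL1Norm_le (h2 : MemC2 θ₀) (h4 : MemW41 θ₀) {α : ℕ × ℕ} (hα : α.1 + α.2 ≤ 4) :
    weakDerivL1Norm α θ₀ ≤ ENNReal.ofReal (c2w41Norm θ₀) := by
  unfold c2w41Norm
  rw [ENNReal.ofReal_toReal (ENNReal.add_lt_top.2 ⟨h2.2, h4⟩).ne]
  refine le_trans ?_ le_add_self
  unfold w41Norm
  refine le_trans ?_ (Finset.single_le_sum (fun _ _ => zero_le) (Finset.mem_range.2
      (show α.1 + α.2 < 5 by omega)))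
  exact Finset.single_le_sum (f := fun α => weakDerivL1Norm α θ₀) (fun _ _ => zero_le)
    (Finset.HasAntidiagonal.mem_antidiagonal.2 rfl)

theorem lintegral_multiDeriv_mollify_le (h : IsMollifier η ε) (h2 : MemC2 θ₀) (h4 : MemW41 θ₀)
    (hA : 0 < c2w41Norm θ₀) {α : ℕ × ℕ} (hα : α.1 + α.2 ≤ 4) :
    ∫⁻ x, ‖multiDeriv α (mollify η θ₀) x‖ₑ ≤ ENNReal.ofReal (2 * c2w41Norm θ₀) := by
  -- The norm is an infimum, so some weak derivative is picked strictly below twice the bound; this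
  -- is where the positivity of the norm enters.
  have hlt : weakDerivL1Norm α θ₀ < ENNReal.ofReal (2 * c2w41Norm θ₀) :=
    (weakDerivL1Norm_le h2 h4 hα).trans_lt
      ((ENNReal.ofReal_lt_ofReal_iff (by linarith)).2 (by linarith))
  unfold weakDerivL1Norm at hlt
  simp only [iInf_lt_iff] at hlt
  obtain ⟨g, hg, hlt⟩ := hlt
  rw [multiDeriv_mollify_of_isWeakDeriv h.contDiff h.hasCompactSupport hg]
  exact (lintegral_enorm_mollify_le h hg.locallyIntegrable_right.aestronglyMeasurable).trans hlt.le

theorem exists_latticeScheme (h : IsMollifier η ε) (hε0 : 0 < ε) (hε1 : ε ≤ 1)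
    (hu : LocallyIntegrable u) (hU : uniformLocL1Norm u < ⊤) (hdiv : IsDivFree u) (h2 : MemC2 θ₀)
    (h4 : MemW41 θ₀) (hA : 0 < c2w41Norm θ₀) :
    Nonempty (LatticeScheme (uniformLocL1Norm u).toReal (c2w41Norm θ₀)
      (37 * (1 + (uniformLocL1Norm u).toReal) * c2w41Norm θ₀)
      (fun i => mollify η fun y => u y i) θ₀ ε) := by
  set U := (uniformLocL1Norm u).toReal with hUdef
  set A := c2w41Norm θ₀ with hAdef
  set v : Fin 2 → Plane → ℝ := fun i => mollify η fun y => u y i with hv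
  have hU0 : 0 ≤ U := ENNReal.toReal_nonneg
  have hvs : ∀ i, ContDiff ℝ ∞ (v i) := fun i =>
    contDiff_mollify h.contDiff h.hasCompactSupport (locallyIntegrable_coord hu i)
  obtain ⟨B, hB⟩ := exists_abs_mollify_le h.contDiff.continuous
    (fun x hx => h.eq_zero x (hε1.trans hx.le)) hU
  obtain ⟨K, hK0, hK⟩ := exists_abs_mollify_sub_le h hε1 hu hU
  -- The mesh is fine enough for the fluxes to be at most `1/2` (from `B`), for `1 / N ≤ ε`, and for
  -- the mollified drift to vary by at most `ε` over the distance `2 / N` (from `2K / ε`).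
  obtain ⟨M, hM⟩ := exists_nat_ge (max (max B 1) (max (1 / ε) (2 * K / ε)))
  have hMB : B ≤ M := ((le_max_left _ _).trans (le_max_left _ _)).trans hM
  have hM1 : 1 ≤ M := by
    have : (1 : ℝ) ≤ M := ((le_max_right _ _).trans (le_max_left _ _)).trans hM
    exact_mod_cast this
  have hMε : 1 / ε ≤ M := ((le_max_left _ _).trans (le_max_right _ _)).trans hM
  have hMK : 2 * K / ε ≤ M := ((le_max_right _ _).trans (le_max_right _ _)).trans hM
  obtain ⟨N, hNM⟩ : ∃ N, N = 4 * M := ⟨_, rfl⟩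
  have hN1 : 1 ≤ N := by omega
  have hMN : (M : ℝ) ≤ N := by
    have : M ≤ N := by omega
    exact_mod_cast this
  have hN0 : (0 : ℝ) < N := by exact_mod_cast hN1
  have hNinv : 1 / (N : ℝ) ≤ ε := by
    rw [div_le_iff₀ hN0]
    rw [div_le_iff₀ hε0] at hMε
    nlinarith
  have hδ : ∀ i x y, dist x y ≤ 2 / N → |v i x - v i y| ≤ ε := by
    intro i x y hxy
    refine (hK i x y).trans ((mul_le_mul_of_nonneg_left hxy hK0).trans ?_)
    rw [mul_div_assoc', div_le_iff₀ hN0]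
    rw [div_le_iff₀ hε0] at hMK
    nlinarith
  have hvU : ∀ i x, ∫⁻ y in Metric.ball x 1, ‖v i y‖ₑ ≤ ENNReal.ofReal U := by
    intro i x
    refine lintegral_mollify_le h (locallyIntegrable_coord hu i).aestronglyMeasurable fun t _ => ?_
    rw [setLIntegral_ball_comp_sub (fun y => ‖u y i‖ₑ)]
    exact lintegral_ball_le_uniformLocL1Norm hU _ i
  set p := gridFlux N 0 (v 0) with hp
  set q := gridFlux N 1 (v 1) with hq
  have hflux : IsLatticeFlux p q :=
    isLatticeFlux_gridFlux hN1 (hvs 0) (hvs 1) (hdiv.mollify hu h.contDiff h.hasCompactSupport)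
      (hB 0) (hB 1) (hMB.trans hMN)
  have hsum : ∀ x, ∑ y ∈ latticeBlock x N, |p y| ≤ N * (U + 1) / 2 ∧
      ∑ y ∈ latticeBlock x N, |q y| ≤ N * (U + 1) / 2 := by
    have hle : N * (U + ε) / 2 ≤ N * (U + 1) / 2 := by gcongr
    exact fun x => ⟨(sum_abs_gridFlux_le hN1 (hvs 0).continuous hU0 (hδ 0) (hvU 0) x 0).trans hle,
      (sum_abs_gridFlux_le hN1 (hvs 1).continuous hU0 (hδ 1) (hvU 1) x 1).trans hle⟩
  have hesum : ∀ {w : ℤ × ℤ → ℝ} {x}, ∑ y ∈ latticeBlock x N, |w y| ≤ N * (U + 1) / 2 →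
      ∑ y ∈ latticeBlock x N, ‖w y‖ₑ ≤ N * ENNReal.ofReal ((U + 1) / 2) := by
    intro w x hw
    simp only [Real.enorm_eq_ofReal_abs]
    rw [← ENNReal.ofReal_sum_of_nonneg fun _ _ => abs_nonneg _, ← ENNReal.ofReal_natCast,
      ← ENNReal.ofReal_mul (by positivity), ← mul_div_assoc]
    exact ENNReal.ofReal_le_ofReal hw
  set F := mollify η θ₀ with hF
  have hθc : Continuous θ₀ := h2.1.continuous
  have hFs : ContDiff ℝ ∞ F :=
    contDiff_mollify h.contDiff h.hasCompactSupport hθc.locallyIntegrable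
  have hgen := tsum_enorm_latticeGenerator_cellAvg_le (p := p) (q := q) hN1 hFs
    (fun α hα => lintegral_multiDeriv_mollify_le h h2 h4 hA (hα.trans (by norm_num)))
    (fun y => hesum (hsum y).1) (fun y => hesum (hsum y).2)
  rw [show (2 : ℝ≥0∞) = ENNReal.ofReal 2 by norm_num,
    show (16 : ℝ≥0∞) = ENNReal.ofReal 16 by norm_num, ← ENNReal.ofReal_mul (by norm_num),
    ← ENNReal.ofReal_mul (by norm_num), ← ENNReal.ofReal_mul (by positivity),
    ← ENNReal.ofReal_add (by positivity) (by positivity)] at hgen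
  have hfin : ∑' z, ‖cellAvg N F z‖ₑ ≠ ⊤ := by
    refine ne_top_of_le_ne_top (ENNReal.mul_ne_top (by simp) ?_) (tsum_enorm_cellAvg_le N F)
    exact ne_top_of_le_ne_top ENNReal.ofReal_ne_top
      (lintegral_multiDeriv_mollify_le h h2 h4 hA (α := (0, 0)) (by simp))
  obtain ⟨R, hR⟩ := exists_nat_ge (N * (1 / ε) + 1)
  obtain ⟨S, hS0, hS⟩ := hflux.exists_truncation hfin (by positivity) hgen hA (closedSquare 0 R)
  have hmem : ∀ x : Plane, ‖x‖ ≤ 1 / ε → cellIndex N x ∈ S := by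
    intro x hx
    refine hS0 (mem_closedSquare.2 ?_)
    have key : ∀ i, |⌊N * x i⌋| ≤ (R : ℤ) := by
      intro i
      have h1 : |N * x i| ≤ N * (1 / ε) := by
        rw [abs_mul, abs_of_pos hN0]
        gcongr
        exact (abs_coord_le_norm x i).trans hx
      rw [abs_le] at h1
      have h3 := Int.floor_le (N * x i)
      have h4 := Int.lt_floor_add_one (N * x i)
      have : |(⌊N * x i⌋ : ℝ)| ≤ R := abs_le.2 ⟨by linarith, by linarith⟩
      exact_mod_cast this
    simpa [cellIndex, abs_le] using And.intro (key 0) (key 1)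
  classical
  set f : ℤ × ℤ → ℝ := fun z => if z ∈ S then cellAvg N F z else 0 with hf
  have hfS : ∀ z ∈ S, f z = cellAvg N F z := fun z hz => if_pos hz
  have hfS0 : ∀ z ∉ S, f z = 0 := fun z hz => if_neg hz
  have hFA : ∀ x, |F x| ≤ A := fun x => by
    have := h.abs_mollify_sub_le (x := x) (a := 0) (δ := A) hθc.locallyIntegrable fun y _ => by
      rw [sub_zero]
      exact abs_le_c2w41Norm h2 h4 y
    rwa [sub_zero] at this
  subst hNM
  refine ⟨⟨M, p, q, f, S, hM1, hNinv, hflux, fun x => ?_, fun x => ?_, hfS0, ?_, hmem,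
    fun x => abs_gridFlux_sub_le_of_mem_cell hN1 (hvs 0).continuous (hδ 0) rfl 0,
    fun x => abs_gridFlux_sub_le_of_mem_cell hN1 (hvs 1).continuous (hδ 1) rfl 1,
    fun x hx δ hδ => ?_⟩⟩
  · rw [Finset.sum_add_distrib]
    linarith [(hsum x).1, (hsum x).2]
  · by_cases hx : x ∈ S
    · rw [hfS x hx]
      exact abs_cellAvg_le hN1 fun y _ => hFA y
    · rw [hfS0 x hx, abs_zero]
      exact hA.le
  · refine (hS f hfS hfS0).trans ?_
    -- Here `2 · 2A` comes from the second differences, `16 · (U + 1) / 2 · 2A` from the drift, and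
    -- `A` from the truncation; the total is below `37 (1 + U) A`.
    nlinarith
  · rw [hfS _ (hmem x hx)]
    -- The cell costs a distance `2 / N ≤ 2ε` and the mollifier less than `ε`, hence `3ε` in total.
    refine abs_cellAvg_cellIndex_sub_le hN1 hFs.continuous fun y hy => ?_
    refine h.abs_mollify_sub_le hθc.locallyIntegrable fun z hz => hδ z ?_
    have : 2 / ((4 * M : ℕ) : ℝ) = 2 * (1 / ((4 * M : ℕ) : ℝ)) := by ring
    have := dist_triangle z y x
    linarith

end Scheme

/-! ### An Arzelà–Ascoli argument for step functions. -/

section Compactness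

open Filter Topology

/-- A bounded, asymptotically equicontinuous sequence of functions on an open set of a separable
space has a subsequence that converges pointwise to a continuous function. -/
theorem exists_subseq_tendsto_continuousOn {X : Type*} [TopologicalSpace X]
    [TopologicalSpace.SeparableSpace X] {s : Set X} (hs : IsOpen s) {F : ℕ → X → ℝ} {A : ℝ}
    (hA : ∀ n, ∀ x ∈ s, |F n x| ≤ A)
    (h : ∀ x ∈ s, ∀ δ > 0, ∀ᶠ y in 𝓝 x, ∀ᶠ n in atTop, |F n y - F n x| ≤ δ) :
    ∃ (φ : ℕ → ℕ) (G : X → ℝ), StrictMono φ ∧ ContinuousOn G s ∧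
      (∀ x ∈ s, Tendsto (fun n => F (φ n) x) atTop (𝓝 (G x))) ∧ ∀ x ∉ s, G x = 0 := by
  obtain ⟨D, hDc, hDd⟩ := TopologicalSpace.exists_countable_dense X
  have : Countable ↥(D ∩ s) := (hDc.mono inter_subset_left).to_subtype
  -- The diagonal extraction is sequential compactness of a countable product of intervals.
  have hK : IsCompact (Set.pi univ fun _ : ↥(D ∩ s) => Icc (-A) A) :=
    isCompact_univ_pi fun _ => isCompact_Icc
  obtain ⟨g, -, φ, hφ, hg⟩ := hK.isSeqCompact (x := fun n (d : ↥(D ∩ s)) => F n d) fun n d _ =>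
    abs_le.1 (hA n d d.2.2)
  rw [tendsto_pi_nhds] at hg
  have hlim : ∀ x ∈ s, ∃ a, Tendsto (fun n => F (φ n) x) atTop (𝓝 a) := by
    intro x hx
    refine cauchySeq_tendsto_of_complete (Metric.cauchySeq_iff'.2 fun δ hδ => ?_)
    -- The functions need not be continuous. A point `d` of the dense set is chosen near `x`, and
    -- equicontinuity between `x` and `d` is used only for large indices.
    have hx1 := h x hx (δ / 4) (by positivity)
    obtain ⟨t, ht1, ht2, ht3⟩ := mem_nhds_iff.1 (hx1.and (hs.mem_nhds hx))
    obtain ⟨d, hd, hdD⟩ := hDd.inter_open_nonempty t ht2 ⟨x, ht3⟩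
    obtain ⟨hd1, hd2⟩ := ht1 hd
    obtain ⟨N, hN⟩ := Metric.cauchySeq_iff'.1 (hg ⟨d, hdD, hd2⟩).cauchySeq (δ / 4) (by positivity)
    obtain ⟨N', hN'⟩ := eventually_atTop.1 (hφ.tendsto_atTop.eventually hd1)
    refine ⟨max N N', fun n hn => ?_⟩
    have e1 := hN' n ((le_max_right _ _).trans hn)
    have e2 := hN' (max N N') (le_max_right _ _)
    have e3 := hN n ((le_max_left _ _).trans hn)
    have e4 := hN (max N N') (le_max_left _ _)
    rw [Real.dist_eq] at *
    simp only [Function.comp_apply] at e3 e4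
    rw [abs_le] at e1 e2
    rw [abs_lt] at e3 e4 ⊢
    constructor <;> linarith [e1.1, e1.2, e2.1, e2.2, e3.1, e3.2, e4.1, e4.2]
  classical
  choose! G hG using hlim
  refine ⟨φ, s.indicator G, hφ, ?_, fun x hx => ?_, fun x hx => indicator_of_notMem hx _⟩
  · refine ContinuousOn.congr (f := G) (fun x hx => ?_) fun x hx => indicator_of_mem hx _
    refine ContinuousAt.continuousWithinAt (Metric.tendsto_nhds.2 fun δ hδ => ?_)
    filter_upwards [h x hx (δ / 2) (by positivity), hs.mem_nhds hx] with y hy hys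
    have h1 := ((hG y hys).sub (hG x hx)).abs
    have := le_of_tendsto h1 (hφ.tendsto_atTop.eventually hy)
    rw [Real.dist_eq]
    linarith
  · rw [indicator_of_mem hx]
    exact hG x hx

end Compactness

/-! ### Regularity of the lattice solutions in the original variables. -/

namespace LatticeScheme

variable {U A W ε : ℝ} {v : Fin 2 → Plane → ℝ} {θ₀ : Plane → ℝ}

/-- The step function, in the original variables, of the solution of the lattice problem. -/
noncomputable def sol (D : LatticeScheme U A W v θ₀ ε) (t : ℝ) (x : Plane) : ℝ :=
  latticeSolution D.p D.q D.f D.S ((4 * D.M : ℕ) ^ 2 * t) (cellIndex (4 * D.M) x)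

variable (D : LatticeScheme U A W v θ₀ ε)

theorem mesh_pos : (0 : ℝ) < (4 * D.M : ℕ) := by
  have := D.one_le
  exact_mod_cast (by omega : 0 < 4 * D.M)

theorem one_le_mesh : 1 ≤ 4 * D.M := by
  have := D.one_le
  omega

theorem eps_pos (D : LatticeScheme U A W v θ₀ ε) : 0 < ε := (one_div_pos.2 D.mesh_pos).trans_le D.inv_le

theorem bound_nonneg (D : LatticeScheme U A W v θ₀ ε) : 0 ≤ A := (abs_nonneg _).trans (D.abs_initial_le 0)

theorem total_nonneg (D : LatticeScheme U A W v θ₀ ε) : 0 ≤ W := (tsum_nonneg fun _ => abs_nonneg _).trans D.tsum_le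

theorem hasFiniteSupport : D.f.HasFiniteSupport := D.S.finite_toSet.subset fun x hx => by
  by_contra hxS
  exact hx (D.eq_zero x hxS)

theorem abs_sol_le {t : ℝ} (ht : 0 ≤ t) (x : Plane) : |D.sol t x| ≤ A :=
  D.flux.abs_latticeSolution_le D.abs_initial_le (by positivity) _

theorem sol_zero {x : Plane} (hx : ‖x‖ ≤ 1 / ε) : D.sol 0 x = D.f (cellIndex (4 * D.M) x) := by
  unfold sol
  rw [mul_zero, latticeSolution_zero (D.mem x hx)]

/-- Lattice time is `N² t`, so the decay estimate carries the factor `N⁻²` that the unscaled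
generator needs. -/
theorem abs_latticeGenerator_le {t : ℝ} (ht : 0 < t) {z : ℤ × ℤ} (hz : z ∈ D.S) :
    |latticeGenerator D.p D.q (latticeSolution D.p D.q D.f D.S ((4 * D.M : ℕ) ^ 2 * t)) z| ≤
      4 * W / t / ((4 * D.M : ℕ) : ℝ) ^ 2 := by
  have hN := D.mesh_pos
  refine (D.flux.abs_latticeGenerator_latticeSolution_le D.hasFiniteSupport D.eq_zero
    (by positivity) hz).trans ((mul_le_mul_of_nonneg_left D.tsum_le (by positivity)).trans
      (le_of_eq ?_))
  field_simp

theorem hasDerivAt_sol {x : Plane} (hx : ‖x‖ ≤ 1 / ε) (t : ℝ) :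
    HasDerivAt (fun s => D.sol s x) ((4 * D.M : ℕ) ^ 2 * latticeGenerator D.p D.q
      (latticeSolution D.p D.q D.f D.S ((4 * D.M : ℕ) ^ 2 * t)) (cellIndex (4 * D.M) x)) t := by
  have h1 := hasDerivAt_latticeSolution D.p D.q D.f (D.mem x hx) ((4 * D.M : ℕ) ^ 2 * t)
  have h2 : HasDerivAt (fun s : ℝ => ((4 * D.M : ℕ) : ℝ) ^ 2 * s) (((4 * D.M : ℕ) : ℝ) ^ 2) t := by
    simpa using (hasDerivAt_id t).const_mul (((4 * D.M : ℕ) : ℝ) ^ 2)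
  rw [mul_comm]
  exact h1.comp t h2

theorem abs_sol_sub_le_time {x : Plane} (hx : ‖x‖ ≤ 1 / ε) {s t τ : ℝ} (hτ : 0 < τ) (hs : τ ≤ s)
    (ht : τ ≤ t) : |D.sol t x - D.sol s x| ≤ 4 * W / τ * |t - s| := by
  have hN := D.mesh_pos
  have hW := D.total_nonneg
  refine Convex.norm_image_sub_le_of_norm_hasDerivWithin_le (s := Ici τ)
    (fun r _ => (D.hasDerivAt_sol hx r).hasDerivWithinAt) (fun r hr => ?_) (convex_Ici τ) hs ht
  have hr0 : 0 < r := hτ.trans_le hr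
  rw [Real.norm_eq_abs, abs_mul, abs_of_pos (by positivity)]
  refine (mul_le_mul_of_nonneg_left (D.abs_latticeGenerator_le hr0 (D.mem x hx))
    (by positivity)).trans ?_
  rw [mul_div_cancel₀ _ (by positivity)]
  exact div_le_div_of_nonneg_left (by positivity) hτ hr

/-- Translating by whole mesh lengths shifts the index exactly. This lets `mem`, stated for points
of the plane, be used for lattice points. -/
theorem exists_cellIndex_eq {N : ℕ} (hN : 1 ≤ N) {x : Plane} {z : ℤ × ℤ} {k : ℕ}
    (h0 : |z.1 - (cellIndex N x).1| ≤ k) (h1 : |z.2 - (cellIndex N x).2| ≤ k) :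
    ∃ y, cellIndex N y = z ∧ ‖y‖ ≤ ‖x‖ + 2 * (k / N) := by
  have hN0 : (0 : ℝ) < N := by exact_mod_cast hN
  refine ⟨x + ((z.1 - (cellIndex N x).1 : ℤ) / N : ℝ) • EuclideanSpace.single 0 1 +
    ((z.2 - (cellIndex N x).2 : ℤ) / N : ℝ) • EuclideanSpace.single 1 1, ?_, ?_⟩
  · unfold cellIndex
    ext
    · simp [mul_add, mul_div_cancel₀ _ hN0.ne', -Int.cast_sub]
    · simp [mul_add, mul_div_cancel₀ _ hN0.ne', -Int.cast_sub]
  · refine (norm_add₃_le).trans ?_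
    have key : ∀ {a : ℤ} (i : Fin 2), |a| ≤ k →
        ‖((a : ℝ) / N) • EuclideanSpace.single i (1 : ℝ)‖ ≤ k / N := by
      intro a i ha
      rw [norm_smul, PiLp.norm_single, norm_one, mul_one, Real.norm_eq_abs, abs_div,
        abs_of_pos hN0]
      gcongr
      exact_mod_cast ha
    have a1 := key 0 h0
    have a2 := key 1 h1
    linarith

/-- The logarithmic modulus of continuity of the lattice solutions. -/
theorem abs_sol_sub_le_space (hU : 0 ≤ U) {t : ℝ} (ht : 0 < t) {x y : Plane}
    (hx : ‖x‖ + 1 ≤ 1 / ε) (hxy : dist x y + 2 * ε ≤ 1 / 16) :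
    |D.sol t x - D.sol t y| ≤ (128 * (4 * W / t) +
      √(128 * (A ^ 2 * (192 + 32 * (U + 1)) + 16 * A * (4 * W / t)))) /
        √(-Real.log (dist x y + 2 * ε)) := by
  have hN := D.mesh_pos
  have hN1 := D.one_le_mesh
  have hW := D.total_nonneg
  have hε := D.eps_pos
  set N : ℕ := 4 * D.M with hNdef
  set r := dist x y with hr
  have hr0 : 0 ≤ r := dist_nonneg
  -- Taking integer parts can increase an index distance by one, hence the extra `1`, which also
  -- makes `k` positive. Rounding costs at most `2 / N ≤ 2ε`.
  obtain ⟨k, hk⟩ : ∃ k, k = ⌈N * r⌉₊ + 1 := ⟨_, rfl⟩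
  have hk1 : 1 ≤ k := by omega
  have hkN : (k : ℝ) ≤ N * r + 2 := by
    have := Nat.ceil_lt_add_one (mul_nonneg hN.le hr0)
    rw [hk]
    push_cast
    linarith
  have hNε : 1 ≤ ε * N := by
    have := D.inv_le
    rwa [div_le_iff₀ hN] at this
  have hkr : (k : ℝ) / N ≤ r + 2 * ε := by
    rw [div_le_iff₀ hN]
    nlinarith
  have hkM : 4 * k ≤ D.M := by
    have h1 := hkr.trans hxy
    rw [div_le_iff₀ hN, hNdef] at h1
    push_cast at h1
    have : (4 : ℝ) * k ≤ D.M := by linarith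
    exact_mod_cast this
  have hy : cellIndex N y ∈ closedSquare (cellIndex N x) k := by
    have key : ∀ i, |⌊N * y i⌋ - ⌊N * x i⌋| ≤ (k : ℤ) := by
      intro i
      have h1 : |N * y i - N * x i| ≤ N * r := by
        rw [← mul_sub, abs_mul, abs_of_pos hN, hr, dist_comm, dist_eq_norm]
        gcongr
        exact abs_coord_le_norm (y - x) i
      have h2 : N * r ≤ (k : ℝ) - 1 := by
        rw [hk]
        push_cast
        linarith [Nat.le_ceil (N * r)]
      rw [abs_le] at h1
      have a1 := Int.floor_le (N * x i)
      have a2 := Int.lt_floor_add_one (N * x i)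
      have a3 := Int.floor_le (N * y i)
      have a4 := Int.lt_floor_add_one (N * y i)
      have : |((⌊N * y i⌋ : ℝ) - ⌊N * x i⌋)| ≤ k := abs_le.2 ⟨by linarith, by linarith⟩
      exact_mod_cast this
    have k0 := abs_le.1 (key 0)
    have k1 := abs_le.1 (key 1)
    rw [mem_closedSquare]
    unfold cellIndex
    refine ⟨⟨?_, ?_⟩, ?_, ?_⟩ <;> dsimp only <;> linarith [k0.1, k0.2, k1.1, k1.2]
  have hL : ∀ z ∈ openSquare (cellIndex N x) (2 * D.M),
      |latticeGenerator D.p D.q (latticeSolution D.p D.q D.f D.S (N ^ 2 * t)) z| ≤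
        4 * W / t / ((4 * D.M : ℕ) : ℝ) ^ 2 := by
    intro z hz
    rw [mem_openSquare] at hz
    -- The square of radius `2M = N / 2` corresponds to points of norm at most `‖x‖ + 1`, where the
    -- equation is solved.
    obtain ⟨w, hw, hwn⟩ := exists_cellIndex_eq (k := 2 * D.M) hN1 (x := x) (z := z)
      (abs_le.2 ⟨by linarith [hz.1.1], by linarith [hz.1.2]⟩)
      (abs_le.2 ⟨by linarith [hz.2.1], by linarith [hz.2.2]⟩)
    have h3 : 2 * (((2 * D.M : ℕ) : ℝ) / N) = 1 := by
      have : (D.M : ℝ) ≠ 0 := by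
        have := D.one_le
        positivity
      rw [hNdef]
      push_cast
      field_simp
      norm_num
    rw [h3] at hwn
    have := D.mem w (hwn.trans hx)
    rw [hw] at this
    exact D.abs_latticeGenerator_le ht this
  have key := D.flux.abs_sub_le_div_sqrt_log D.one_le (c := cellIndex N x) (y := cellIndex N y)
    (f := latticeSolution D.p D.q D.f D.S (N ^ 2 * t)) (A := A) (Φ := 4 * W / t) (U := U + 1)
    (by positivity) (by positivity)
    (fun z => D.flux.abs_latticeSolution_le D.abs_initial_le (by positivity) z) hL D.sum_le hk1 hkM hy
  refine key.trans ?_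
  have hlog : Real.log (k / N) ≤ Real.log (r + 2 * ε) :=
    Real.log_le_log (by positivity) hkr
  have hneg : Real.log (r + 2 * ε) < 0 := Real.log_neg (by positivity) (by linarith)
  refine div_le_div_of_nonneg_left ?_ (Real.sqrt_pos.2 (by linarith)) (Real.sqrt_le_sqrt (by linarith))
  positivity

end LatticeScheme

/-! ### Test functions and their difference quotients. -/

section TestFunction

/-- A smooth function of compact support on `ℝ × ℝ²`. -/
structure IsTestFunction (φ : ℝ → Plane → ℝ) : Prop where
  contDiff : ContDiff ℝ ∞ (fun p : ℝ × Plane => φ p.1 p.2)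
  hasCompactSupport : HasCompactSupport (fun p : ℝ × Plane => φ p.1 p.2)

variable {φ : ℝ → Plane → ℝ}

namespace IsTestFunction

theorem exists_abs_le (h : IsTestFunction φ) : ∃ C, 0 ≤ C ∧ ∀ t x, |φ t x| ≤ C := by
  obtain ⟨C, hC⟩ := h.contDiff.continuous.bounded_above_of_compact_support h.hasCompactSupport
  exact ⟨C, (norm_nonneg _).trans (hC 0), fun t x => hC (t, x)⟩

theorem exists_radius (h : IsTestFunction φ) :
    ∃ R, 0 < R ∧ ∀ t x, φ t x ≠ 0 → |t| ≤ R ∧ ‖x‖ ≤ R := by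
  obtain ⟨R, hR0, hR⟩ := h.hasCompactSupport.isCompact.isBounded.exists_pos_norm_le
  refine ⟨R, hR0, fun t x htx => ?_⟩
  have := hR (t, x) (subset_tsupport _ htx)
  rw [Prod.norm_def, max_le_iff] at this
  exact this

theorem contDiff_slice (h : IsTestFunction φ) (t : ℝ) : ContDiff ℝ ∞ (φ t) :=
  h.contDiff.comp (contDiff_const.prodMk contDiff_id)

theorem contDiff_time (h : IsTestFunction φ) (x : Plane) : ContDiff ℝ ∞ fun s => φ s x :=
  h.contDiff.comp (contDiff_id.prodMk contDiff_const)

theorem hasCompactSupport_slice (h : IsTestFunction φ) (t : ℝ) : HasCompactSupport (φ t) := by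
  obtain ⟨R, -, hR⟩ := h.exists_radius
  refine HasCompactSupport.intro (isCompact_closedBall (0 : Plane) R) fun x hx => ?_
  by_contra hc
  exact hx (by simpa using (hR t x hc).2)

theorem fderiv_apply (h : IsTestFunction φ) (w : ℝ × Plane) : IsTestFunction fun t x =>
    fderiv ℝ (fun p : ℝ × Plane => φ p.1 p.2) (t, x) w where
  contDiff := (h.contDiff.fderiv_right (m := ∞) (by simp)).clm_apply contDiff_const
  hasCompactSupport := (h.hasCompactSupport.fderiv ℝ).comp_left
    (g := fun L : ℝ × Plane →L[ℝ] ℝ => L w) (by simp)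

theorem partialDeriv (h : IsTestFunction φ) (i : Fin 2) :
    IsTestFunction fun t => _root_.partialDeriv i (φ t) := by
  have he : (fun t => _root_.partialDeriv i (φ t)) = fun t x =>
      fderiv ℝ (fun p : ℝ × Plane => φ p.1 p.2) (t, x) (0, EuclideanSpace.single i 1) := by
    funext t x
    have h1 : HasFDerivAt (fun p : ℝ × Plane => φ p.1 p.2) _ (t, x) :=
      (h.contDiff.differentiable (by simp)).differentiableAt.hasFDerivAt
    have h2 := h1.comp x ((hasFDerivAt_const t x).prodMk (hasFDerivAt_id x))
    unfold _root_.partialDeriv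
    rw [show φ t = (fun p : ℝ × Plane => φ p.1 p.2) ∘ fun y => (t, y) from rfl, h2.fderiv]
    simp
  rw [he]
  exact h.fderiv_apply _

theorem timeDeriv (h : IsTestFunction φ) :
    IsTestFunction fun t x => deriv (fun s => φ s x) t := by
  have he : (fun t x => deriv (fun s => φ s x) t) = fun t x =>
      fderiv ℝ (fun p : ℝ × Plane => φ p.1 p.2) (t, x) (1, 0) := by
    funext t x
    have h1 : HasFDerivAt (fun p : ℝ × Plane => φ p.1 p.2) _ (t, x) :=
      (h.contDiff.differentiable (by simp)).differentiableAt.hasFDerivAt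
    exact (h1.comp_hasDerivAt t ((hasDerivAt_id t).prodMk (hasDerivAt_const t x))).deriv
  rw [he]
  exact h.fderiv_apply _

theorem comp_add (h : IsTestFunction φ) (a : Plane) : IsTestFunction fun t x => φ t (x + a) where
  contDiff := h.contDiff.comp (contDiff_fst.prodMk (contDiff_snd.add contDiff_const))
  hasCompactSupport := h.hasCompactSupport.comp_homeomorph
    ((Homeomorph.refl ℝ).prodCongr (Homeomorph.addRight a))

theorem integrable (h : IsTestFunction φ) (μ : Measure (ℝ × Plane)) [IsFiniteMeasureOnCompacts μ] :
    Integrable (fun p : ℝ × Plane => φ p.1 p.2) μ :=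
  h.contDiff.continuous.integrable_of_hasCompactSupport h.hasCompactSupport

end IsTestFunction

theorem laplacian_eq_sum_partialDeriv {F : Plane → ℝ} (hF : ContDiff ℝ ∞ F) (x : Plane) :
    Laplacian.laplacian F x = partialDeriv 0 (partialDeriv 0 F) x +
      partialDeriv 1 (partialDeriv 1 F) x := by
  rw [InnerProductSpace.laplacian_eq_iteratedFDeriv_orthonormalBasis F
    (EuclideanSpace.basisFun (Fin 2) ℝ)]
  have hd : DifferentiableAt ℝ (fderiv ℝ F) x :=
    ((hF.fderiv_right (m := ∞) (by simp)).differentiable (by simp)).differentiableAt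
  have h1 : ∀ i, partialDeriv i (partialDeriv i F) x =
      fderiv ℝ (fderiv ℝ F) x (EuclideanSpace.single i 1) (EuclideanSpace.single i 1) := by
    intro i
    unfold partialDeriv
    rw [fderiv_clm_apply hd (differentiableAt_const _)]
    simp
  rw [h1, h1]
  simp [iteratedFDeriv_two_apply, Fin.sum_univ_two]

variable {N : ℕ} {F : Plane → ℝ} {a δ : ℝ}

theorem norm_gridStep (N : ℕ) (i : Fin 2) : ‖gridStep N i‖ = 1 / N := by
  unfold gridStep
  rw [PiLp.norm_single]
  simp

/-- Mean value inequality along the step. The number `a` is free: the derivative at `x` gives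
convergence of the quotients, and `a = 0` gives uniform bounds. -/
theorem abs_mul_gridDiff_sub_le (hN : 1 ≤ N) (hF : ContDiff ℝ ∞ F) (i : Fin 2) {x : Plane}
    (h : ∀ y, dist y x ≤ 1 / N → |partialDeriv i F y - a| ≤ δ) :
    |N * gridDiff N i F x - a| ≤ δ := by
  have hN0 : (0 : ℝ) < N := by exact_mod_cast hN
  have hd : ∀ s : ℝ, HasDerivAt (fun s : ℝ => N * F (x + s • gridStep N i) - s * a)
      (partialDeriv i F (x + s • gridStep N i) - a) s := by
    intro s
    have hF1 : HasFDerivAt F (fderiv ℝ F (x + s • gridStep N i)) (x + s • gridStep N i) :=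
      (hF.differentiable (by simp)).differentiableAt.hasFDerivAt
    have hl : HasDerivAt (fun s : ℝ => x + s • gridStep N i) ((1 : ℝ) • gridStep N i) s :=
      ((hasDerivAt_id s).smul_const _).const_add x
    have h3 := ((hF1.comp_hasDerivAt s hl).const_mul (N : ℝ)).sub
      ((hasDerivAt_id s).mul_const a)
    refine h3.congr_deriv ?_
    unfold partialDeriv gridStep
    rw [one_smul, one_mul, ← smul_eq_mul, ← map_smul]
    congr 2
    ext j
    simp [hN0.ne']
  have key := norm_image_sub_le_of_norm_deriv_le_segment_01'
    (fun s _ => (hd s).hasDerivWithinAt) (C := δ) fun s hs => by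
      refine h _ ?_
      rw [dist_eq_norm, add_sub_cancel_left, norm_smul, norm_gridStep, Real.norm_eq_abs,
        abs_of_nonneg hs.1]
      exact mul_le_of_le_one_left (by positivity) hs.2.le
  rw [Real.norm_eq_abs] at key
  refine le_trans (le_of_eq ?_) key
  unfold gridDiff
  simp
  ring_nf

theorem abs_mul_gridDiff_comp_sub_le (hN : 1 ≤ N) (hF : ContDiff ℝ ∞ F) (i : Fin 2) {x : Plane}
    (h : ∀ y, dist y x ≤ 2 / N → |partialDeriv i F y - a| ≤ δ) :
    |N * (F x - F (x - gridStep N i)) - a| ≤ δ := by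
  have := abs_mul_gridDiff_sub_le (x := x - gridStep N i) (a := a) (δ := δ) hN hF i fun y hy => by
    refine h y ((dist_triangle y (x - gridStep N i) x).trans ?_)
    rw [dist_eq_norm (x - gridStep N i), sub_sub_cancel_left, norm_neg, norm_gridStep]
    have e : 2 / (N : ℝ) = 1 / N + 1 / N := by ring
    rw [e]
    gcongr
  unfold gridDiff at this
  rwa [sub_add_cancel] at this

/-- The second quotient is the backward quotient of the forward quotient; their reaches `2 / N` and
`1 / N` add up to `3 / N`. -/
theorem abs_sq_mul_second_diff_sub_le (hN : 1 ≤ N) (hF : ContDiff ℝ ∞ F) (i : Fin 2) {x : Plane}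
    (h : ∀ y, dist y x ≤ 3 / N → |partialDeriv i (partialDeriv i F) y - a| ≤ δ) :
    |(N : ℝ) ^ 2 * (F (x + gridStep N i) + F (x - gridStep N i) - 2 * F x) - a| ≤ δ := by
  have hG : ContDiff ℝ ∞ fun y => (N : ℝ) * gridDiff N i F y :=
    contDiff_const.mul (contDiff_gridDiff hF i)
  have hpd : ∀ y, partialDeriv i (fun y => (N : ℝ) * gridDiff N i F y) y =
      N * gridDiff N i (partialDeriv i F) y := by
    intro y
    have hd : DifferentiableAt ℝ (gridDiff N i F) y :=
      ((contDiff_gridDiff hF i).differentiable (by simp)).differentiableAt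
    rw [← partialDeriv_gridDiff hF]
    unfold partialDeriv
    rw [fderiv_const_mul hd]
    rfl
  have key := abs_mul_gridDiff_comp_sub_le (x := x) (a := a) (δ := δ) hN hG i fun y hy => by
    rw [hpd]
    refine abs_mul_gridDiff_sub_le hN (contDiff_partialDeriv hF i) i fun z hz => h z ?_
    refine (dist_triangle z y x).trans ?_
    have e : 3 / (N : ℝ) = 1 / N + 2 / N := by ring
    rw [e]
    gcongr
  refine le_trans (le_of_eq ?_) key
  unfold gridDiff
  rw [sub_add_cancel]
  ring_nf

end TestFunction

/-! ### The generator on functions of the plane and its adjoint. -/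

section GridGenerator

variable {N : ℕ} {p q : ℤ × ℤ → ℝ} {F G : Plane → ℝ}

/-- The generator of the lattice, acting on functions on the plane. -/
noncomputable def gridGenerator (N : ℕ) (p q : ℤ × ℤ → ℝ) (F : Plane → ℝ) (x : Plane) : ℝ :=
  (1 - p (cellIndex N x + dirX)) * (F (x + gridStep N 0) - F x) +
  (1 + p (cellIndex N x)) * (F (x - gridStep N 0) - F x) +
  (1 - q (cellIndex N x + dirY)) * (F (x + gridStep N 1) - F x) +
  (1 + q (cellIndex N x)) * (F (x - gridStep N 1) - F x)

theorem cellIndex_sub_gridStep (hN : 1 ≤ N) (x : Plane) (i : Fin 2) :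
    cellIndex N (x - gridStep N i) = cellIndex N x - latticeDir i := by
  rw [eq_sub_iff_add_eq, ← cellIndex_add_gridStep hN, sub_add_cancel]

theorem latticeGenerator_cellIndex (hN : 1 ≤ N) (p q g : ℤ × ℤ → ℝ) (x : Plane) :
    latticeGenerator p q g (cellIndex N x) =
      gridGenerator N p q (fun y => g (cellIndex N y)) x := by
  unfold gridGenerator
  simp only [cellIndex_add_gridStep hN, cellIndex_sub_gridStep hN]
  rfl

theorem measurable_comp_cellIndex (g : ℤ × ℤ → ℝ) : Measurable fun x => g (cellIndex N x) :=
  (measurable_of_countable g).comp (measurable_cellIndex N)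

theorem IsLatticeFlux.abs_one_add_le (h : IsLatticeFlux p q) (z : ℤ × ℤ) :
    |1 - p z| ≤ 3 / 2 ∧ |1 + p z| ≤ 3 / 2 ∧ |1 - q z| ≤ 3 / 2 ∧ |1 + q z| ≤ 3 / 2 := by
  have h1 := abs_le.1 (h.abs_left_le z)
  have h2 := abs_le.1 (h.abs_right_le z)
  refine ⟨abs_le.2 ⟨?_, ?_⟩, abs_le.2 ⟨?_, ?_⟩, abs_le.2 ⟨?_, ?_⟩, abs_le.2 ⟨?_, ?_⟩⟩ <;>
    linarith [h1.1, h1.2, h2.1, h2.2]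

theorem IsLatticeFlux.abs_gridGenerator_le (h : IsLatticeFlux p q) {A : ℝ} (hF : ∀ x, |F x| ≤ A)
    (x : Plane) : |gridGenerator N p q F x| ≤ 12 * A := by
  have hd : ∀ a b, |F a - F b| ≤ 2 * A := fun a b => by
    have := abs_sub (F a) (F b)
    linarith [hF a, hF b]
  unfold gridGenerator
  refine (abs_add_le _ _).trans ((add_le_add ((abs_add_le _ _).trans (add_le_add
    (abs_add_le _ _) le_rfl)) le_rfl).trans ?_)
  simp only [abs_mul]
  refine (add_le_add (add_le_add (add_le_add
    (mul_le_mul (h.abs_one_add_le _).1 (hd _ _) (abs_nonneg _) (by norm_num))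
    (mul_le_mul (h.abs_one_add_le _).2.1 (hd _ _) (abs_nonneg _) (by norm_num)))
    (mul_le_mul (h.abs_one_add_le _).2.2.1 (hd _ _) (abs_nonneg _) (by norm_num)))
    (mul_le_mul (h.abs_one_add_le _).2.2.2 (hd _ _) (abs_nonneg _) (by norm_num))).trans
    (le_of_eq (by ring))

/-- The generator with reversed flux is the adjoint of the generator. -/
theorem IsLatticeFlux.integral_mul_gridGenerator (h : IsLatticeFlux p q) (hN : 1 ≤ N) {A : ℝ}
    (hFm : Measurable F) (hF : ∀ x, |F x| ≤ A) (hG : Continuous G) (hGc : HasCompactSupport G) :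
    ∫ x, F x * gridGenerator N (fun z => -p z) (fun z => -q z) G x =
      ∫ x, G x * gridGenerator N p q F x := by
  have hGi : ∀ a, Integrable fun x => G (x + a) := fun a =>
    (hG.integrable_of_hasCompactSupport hGc).comp_add_right a
  have hI : ∀ (c : ℤ × ℤ → ℝ) (a b : Plane), (∀ z, |c z| ≤ 3 / 2) →
      Integrable fun x => (c (cellIndex N x) * F (x + a)) * G (x + b) := by
    intro c a b hc
    refine (hGi b).bdd_mul (c := 3 / 2 * A) ?_ (Filter.Eventually.of_forall fun x => ?_)
    · exact ((measurable_comp_cellIndex c).mul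
        (hFm.comp (measurable_id.add_const a))).aestronglyMeasurable
    · rw [Real.norm_eq_abs, abs_mul]
      exact mul_le_mul (hc _) (hF _) (abs_nonneg _) (by norm_num)
  -- Discrete divergences integrate to zero by translation invariance. The two sides of the claim
  -- differ by four such terms and by `2 F G` times the divergence of the flux.
  have hshift : ∀ (T : Plane → ℝ) (a : Plane), Integrable T → Integrable (fun x => T (x + a) - T x) ∧
      ∫ x, (T (x + a) - T x) = 0 := fun T a hT => by
    refine ⟨(hT.comp_add_right a).sub hT, ?_⟩
    rw [integral_sub (hT.comp_add_right a) hT, integral_add_right_eq_self, sub_self]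
  obtain ⟨i1, e1⟩ := hshift _ (gridStep N 0)
    (hI (fun z => 1 - p z) 0 (-gridStep N 0) fun z => (h.abs_one_add_le z).1)
  obtain ⟨i2, e2⟩ := hshift _ (gridStep N 0)
    (hI (fun z => 1 + p z) (-gridStep N 0) 0 fun z => (h.abs_one_add_le z).2.1)
  obtain ⟨i3, e3⟩ := hshift _ (gridStep N 1)
    (hI (fun z => 1 - q z) 0 (-gridStep N 1) fun z => (h.abs_one_add_le z).2.2.1)
  obtain ⟨i4, e4⟩ := hshift _ (gridStep N 1)
    (hI (fun z => 1 + q z) (-gridStep N 1) 0 fun z => (h.abs_one_add_le z).2.2.2)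
  have ex : (dirX : ℤ × ℤ) = latticeDir 0 := rfl
  have ey : (dirY : ℤ × ℤ) = latticeDir 1 := rfl
  have hGg : Integrable fun x => G x * gridGenerator N p q F x := by
    refine (hG.integrable_of_hasCompactSupport hGc).mul_bdd (c := 12 * A) ?_
      (Filter.Eventually.of_forall fun x => h.abs_gridGenerator_le hF x)
    refine Measurable.aestronglyMeasurable ?_
    unfold gridGenerator
    have m1 := measurable_comp_cellIndex (N := N) fun z => 1 - p (z + dirX)
    have m2 := measurable_comp_cellIndex (N := N) fun z => 1 + p z
    have m3 := measurable_comp_cellIndex (N := N) fun z => 1 - q (z + dirY)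
    have m4 := measurable_comp_cellIndex (N := N) fun z => 1 + q z
    have mp : ∀ a, Measurable fun x => F (x + a) := fun a => hFm.comp (measurable_id.add_const a)
    have mm : ∀ a, Measurable fun x => F (x - a) := fun a => hFm.comp (measurable_id.sub_const a)
    exact (((m1.mul ((mp _).sub hFm)).add (m2.mul ((mm _).sub hFm))).add
      (m3.mul ((mp _).sub hFm))).add (m4.mul ((mm _).sub hFm))
  have hrest := ((i1.sub i2).add (i3.sub i4))
  have hzero : ∫ x, (((fun x => (1 - p (cellIndex N (x + gridStep N 0))) *
      F (x + gridStep N 0 + 0) * G (x + gridStep N 0 + -gridStep N 0) -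
      (1 - p (cellIndex N x)) * F (x + 0) * G (x + -gridStep N 0)) - fun x =>
      (1 + p (cellIndex N (x + gridStep N 0))) * F (x + gridStep N 0 + -gridStep N 0) *
      G (x + gridStep N 0 + 0) - (1 + p (cellIndex N x)) * F (x + -gridStep N 0) * G (x + 0)) +
      ((fun x => (1 - q (cellIndex N (x + gridStep N 1))) *
      F (x + gridStep N 1 + 0) * G (x + gridStep N 1 + -gridStep N 1) -
      (1 - q (cellIndex N x)) * F (x + 0) * G (x + -gridStep N 1)) - fun x =>
      (1 + q (cellIndex N (x + gridStep N 1))) * F (x + gridStep N 1 + -gridStep N 1) *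
      G (x + gridStep N 1 + 0) - (1 + q (cellIndex N x)) * F (x + -gridStep N 1) * G (x + 0))) x
      = 0 := by
    rw [integral_add' (i1.sub i2) (i3.sub i4), integral_sub' i1 i2, integral_sub' i3 i4, e1, e2, e3,
      e4]
    norm_num
  rw [← sub_eq_zero, ← neg_eq_zero, neg_sub]
  rw [← hzero]
  have hkey : ∀ x, F x * gridGenerator N (fun z => -p z) (fun z => -q z) G x =
      G x * gridGenerator N p q F x - (((fun x => (1 - p (cellIndex N (x + gridStep N 0))) *
      F (x + gridStep N 0 + 0) * G (x + gridStep N 0 + -gridStep N 0) -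
      (1 - p (cellIndex N x)) * F (x + 0) * G (x + -gridStep N 0)) - fun x =>
      (1 + p (cellIndex N (x + gridStep N 0))) * F (x + gridStep N 0 + -gridStep N 0) *
      G (x + gridStep N 0 + 0) - (1 + p (cellIndex N x)) * F (x + -gridStep N 0) * G (x + 0)) +
      ((fun x => (1 - q (cellIndex N (x + gridStep N 1))) *
      F (x + gridStep N 1 + 0) * G (x + gridStep N 1 + -gridStep N 1) -
      (1 - q (cellIndex N x)) * F (x + 0) * G (x + -gridStep N 1)) - fun x =>
      (1 + q (cellIndex N (x + gridStep N 1))) * F (x + gridStep N 1 + -gridStep N 1) *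
      G (x + gridStep N 1 + 0) - (1 + q (cellIndex N x)) * F (x + -gridStep N 1) * G (x + 0))) x := by
    intro x
    have hdiv := h.div_free (cellIndex N x)
    simp only [Pi.add_apply, Pi.sub_apply, cellIndex_add_gridStep hN, ← ex, ← ey, add_zero,
      add_neg_cancel_right]
    unfold gridGenerator
    simp only [← sub_eq_add_neg]
    linear_combination (-2 * F x * G x) * hdiv
  simp only [hkey]
  rw [integral_sub hGg hrest, sub_sub_cancel]

end GridGenerator

/-! ### Integrability and measurability for the discrete weak form. -/

section DiscreteWeakForm

variable {N : ℕ} {p q : ℤ × ℤ → ℝ} {φ : ℝ → Plane → ℝ}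

/-- The half space-time `(0, ∞) × ℝ²` carries the product measure. -/
theorem volume_restrict_Ioi_prod : (volume : Measure (ℝ × Plane)).restrict
    (Ioi (0 : ℝ) ×ˢ (univ : Set Plane)) = (volume.restrict (Ioi (0 : ℝ))).prod volume := by
  rw [Measure.volume_eq_prod, ← Measure.prod_restrict, Measure.restrict_univ]

theorem IsLatticeFlux.integrable_gridGenerator (h : IsLatticeFlux p q) (hφ : IsTestFunction φ)
    (μ : Measure (ℝ × Plane)) [IsFiniteMeasureOnCompacts μ] :
    Integrable (fun s : ℝ × Plane => gridGenerator N p q (φ s.1) s.2) μ := by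
  have hI : ∀ (c : ℤ × ℤ → ℝ) (a : Plane), (∀ z, |c z| ≤ 3 / 2) → Integrable
      (fun s : ℝ × Plane => c (cellIndex N s.2) * (φ s.1 (s.2 + a) - φ s.1 s.2)) μ := by
    intro c a hc
    refine (((hφ.comp_add a).integrable μ).sub (hφ.integrable μ)).bdd_mul (c := 3 / 2) ?_
      (Filter.Eventually.of_forall fun s => hc _)
    exact ((measurable_comp_cellIndex c).comp measurable_snd).aestronglyMeasurable
  have h1 := hI (fun z => 1 - p (z + dirX)) (gridStep N 0) fun z => (h.abs_one_add_le _).1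
  have h2 := hI (fun z => 1 + p z) (-gridStep N 0) fun z => (h.abs_one_add_le _).2.1
  have h3 := hI (fun z => 1 - q (z + dirY)) (gridStep N 1) fun z => (h.abs_one_add_le _).2.2.1
  have h4 := hI (fun z => 1 + q z) (-gridStep N 1) fun z => (h.abs_one_add_le _).2.2.2
  simp only [← sub_eq_add_neg] at h2 h4
  exact ((h1.add h2).add h3).add h4

theorem measurable_gridGenerator (p q : ℤ × ℤ → ℝ) {F : ℝ → Plane → ℝ}
    (hF : Measurable fun s : ℝ × Plane => F s.1 s.2) :
    Measurable fun s : ℝ × Plane => gridGenerator N p q (F s.1) s.2 := by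
  have m : ∀ c : ℤ × ℤ → ℝ, Measurable fun s : ℝ × Plane => c (cellIndex N s.2) :=
    fun c => (measurable_comp_cellIndex c).comp measurable_snd
  have mp : ∀ a, Measurable fun s : ℝ × Plane => F s.1 (s.2 + a) := fun a =>
    hF.comp (measurable_fst.prodMk (measurable_snd.add_const a))
  have mm : ∀ a, Measurable fun s : ℝ × Plane => F s.1 (s.2 - a) := fun a =>
    hF.comp (measurable_fst.prodMk (measurable_snd.sub_const a))
  unfold gridGenerator
  exact ((((m fun z => 1 - p (z + dirX)).mul ((mp _).sub hF)).add
    ((m fun z => 1 + p z).mul ((mm _).sub hF))).add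
    ((m fun z => 1 - q (z + dirY)).mul ((mp _).sub hF))).add
    ((m fun z => 1 + q z).mul ((mm _).sub hF))

end DiscreteWeakForm

/-! ### Weak form of the lattice problem. -/

namespace LatticeScheme

variable {U A W ε : ℝ} {v : Fin 2 → Plane → ℝ} {θ₀ : Plane → ℝ} {φ : ℝ → Plane → ℝ}

variable (D : LatticeScheme U A W v θ₀ ε)

theorem measurable_sol : Measurable fun s : ℝ × Plane => D.sol s.1 s.2 := by
  have h : Measurable fun s : ℝ × (ℤ × ℤ) =>
      latticeSolution D.p D.q D.f D.S ((4 * D.M : ℕ) ^ 2 * s.1) s.2 := by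
    refine measurable_from_prod_countable_left fun z => Continuous.measurable ?_
    by_cases hz : z ∈ D.S
    · have hc : Continuous fun t => latticeSolution D.p D.q D.f D.S t z :=
        continuous_iff_continuousAt.2 fun t =>
          (hasDerivAt_latticeSolution D.p D.q D.f hz t).continuousAt
      exact hc.comp (continuous_const.mul continuous_id)
    · simp only [latticeSolution_of_notMem hz]
      exact continuous_const
  exact h.comp (measurable_fst.prodMk ((measurable_cellIndex _).comp measurable_snd))

theorem measurable_sol_slice (t : ℝ) : Measurable (D.sol t) :=
  D.measurable_sol.comp measurable_prodMk_left

theorem measurable_gridGenerator_sol : Measurable fun s : ℝ × Plane =>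
    gridGenerator (4 * D.M) D.p D.q (D.sol s.1) s.2 :=
  measurable_gridGenerator D.p D.q D.measurable_sol

theorem ae_abs_sol_le : ∀ᵐ s ∂(volume.restrict (Ioi (0 : ℝ))).prod (volume : Measure Plane),
    |D.sol s.1 s.2| ≤ A := by
  rw [← volume_restrict_Ioi_prod]
  filter_upwards [ae_restrict_mem (measurableSet_Ioi.prod MeasurableSet.univ)] with s hs
  exact D.abs_sol_le (le_of_lt hs.1) _

/-- The weak form of the lattice problem, together with the integrability of the integrand. -/
theorem integral_sol (hφ : IsTestFunction φ) (hε : ∀ t x, 1 / ε < ‖x‖ → φ t x = 0) :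
    Integrable (fun s : ℝ × Plane => D.sol s.1 s.2 * (deriv (fun r => φ r s.2) s.1 +
      (4 * D.M : ℕ) ^ 2 * gridGenerator (4 * D.M) (fun z => -D.p z) (fun z => -D.q z) (φ s.1) s.2))
      ((volume.restrict (Ioi (0 : ℝ))).prod volume) ∧
    ∫ s : ℝ × Plane, D.sol s.1 s.2 * (deriv (fun r => φ r s.2) s.1 +
      (4 * D.M : ℕ) ^ 2 * gridGenerator (4 * D.M) (fun z => -D.p z) (fun z => -D.q z) (φ s.1) s.2)
      ∂((volume.restrict (Ioi (0 : ℝ))).prod volume) =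
      -∫ x, D.f (cellIndex (4 * D.M) x) * φ 0 x := by
  set N := 4 * D.M with hN
  set μ := (volume.restrict (Ioi (0 : ℝ))).prod (volume : Measure Plane) with hμ
  have hfin : IsFiniteMeasureOnCompacts μ := by
    rw [hμ, ← volume_restrict_Ioi_prod]
    infer_instance
  have hm : AEStronglyMeasurable (fun s : ℝ × Plane => D.sol s.1 s.2) μ :=
    D.measurable_sol.aestronglyMeasurable
  have hI1 : Integrable (fun s : ℝ × Plane => D.sol s.1 s.2 * deriv (fun r => φ r s.2) s.1) μ :=
    (hφ.timeDeriv.integrable μ).bdd_mul hm D.ae_abs_sol_le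
  have hI2 : Integrable (fun s : ℝ × Plane => D.sol s.1 s.2 * ((N : ℝ) ^ 2 *
      gridGenerator N (fun z => -D.p z) (fun z => -D.q z) (φ s.1) s.2)) μ :=
    ((D.flux.neg.integrable_gridGenerator hφ μ).const_mul _).bdd_mul hm D.ae_abs_sol_le
  have hI3 : Integrable (fun s : ℝ × Plane => φ s.1 s.2 * ((N : ℝ) ^ 2 *
      gridGenerator N D.p D.q (D.sol s.1) s.2)) μ := by
    refine (hφ.integrable μ).mul_bdd (c := (N : ℝ) ^ 2 * (12 * A))
      (D.measurable_gridGenerator_sol.const_mul _).aestronglyMeasurable ?_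
    rw [hμ, ← volume_restrict_Ioi_prod]
    filter_upwards [ae_restrict_mem (measurableSet_Ioi.prod MeasurableSet.univ)] with s hs
    rw [Real.norm_eq_abs, abs_mul, abs_of_nonneg (by positivity)]
    gcongr
    exact D.flux.abs_gridGenerator_le (D.abs_sol_le (le_of_lt hs.1)) _
  have hsp : ∀ t ∈ Ioi (0 : ℝ), ∫ x, D.sol t x * ((N : ℝ) ^ 2 *
      gridGenerator N (fun z => -D.p z) (fun z => -D.q z) (φ t) x) =
      ∫ x, φ t x * ((N : ℝ) ^ 2 * gridGenerator N D.p D.q (D.sol t) x) := by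
    intro t ht
    have := D.flux.integral_mul_gridGenerator D.one_le_mesh (D.measurable_sol_slice t)
      (D.abs_sol_le (le_of_lt ht)) (hφ.contDiff_slice t).continuous (hφ.hasCompactSupport_slice t)
    simp only [mul_left_comm _ ((N : ℝ) ^ 2)]
    rw [integral_const_mul, integral_const_mul, this]
  have h23 : ∫ s : ℝ × Plane, D.sol s.1 s.2 * ((N : ℝ) ^ 2 *
      gridGenerator N (fun z => -D.p z) (fun z => -D.q z) (φ s.1) s.2) ∂μ =
      ∫ s : ℝ × Plane, φ s.1 s.2 * ((N : ℝ) ^ 2 *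
      gridGenerator N D.p D.q (D.sol s.1) s.2) ∂μ := by
    rw [integral_prod _ hI2, integral_prod _ hI3]
    exact setIntegral_congr_fun measurableSet_Ioi hsp
  have hI13 : Integrable (fun s : ℝ × Plane => D.sol s.1 s.2 * deriv (fun r => φ r s.2) s.1 +
      φ s.1 s.2 * ((N : ℝ) ^ 2 * gridGenerator N D.p D.q (D.sol s.1) s.2)) μ := hI1.add hI3
  simp only [mul_add]
  refine ⟨hI1.add hI2, ?_⟩
  -- The generator now acts on the solution. Integrating in time first, the integrand at fixed `x`
  -- is the time derivative of `sol · φ`, whose integral over `(0, ∞)` is minus its value at time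
  -- `0`.
  rw [integral_add hI1 hI2, h23, ← integral_add hI1 hI3, integral_prod_symm _ hI13, ← integral_neg]
  refine integral_congr_ae ?_
  filter_upwards [hI13.prod_left_ae] with x hx
  by_cases hxε : ‖x‖ ≤ 1 / ε
  · obtain ⟨R, -, hR⟩ := hφ.exists_radius
    have hd : ∀ t ∈ Ici (0 : ℝ), HasDerivAt (fun t => D.sol t x * φ t x)
        (D.sol t x * deriv (fun r => φ r x) t + φ t x * ((N : ℝ) ^ 2 *
          gridGenerator N D.p D.q (D.sol t) x)) t := by
      intro t _
      have h1 := D.hasDerivAt_sol hxε t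
      rw [latticeGenerator_cellIndex D.one_le_mesh] at h1
      have h2 : HasDerivAt (fun r => φ r x) (deriv (fun r => φ r x) t) t :=
        ((hφ.contDiff_time x).differentiable (by simp)).differentiableAt.hasDerivAt
      refine (h1.mul h2).congr_deriv ?_
      rw [mul_comm (φ t x), add_comm]
      rfl
    have htend : Filter.Tendsto (fun t => D.sol t x * φ t x) Filter.atTop (nhds 0) := by
      refine tendsto_const_nhds.congr' ?_
      filter_upwards [Filter.eventually_gt_atTop R] with t ht
      have : φ t x = 0 := by
        by_contra hc
        exact absurd ((le_abs_self t).trans (hR t x hc).1) (not_le.2 ht)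
      rw [this, mul_zero]
    have := integral_Ioi_of_hasDerivAt_of_tendsto' hd hx htend
    rw [this, D.sol_zero hxε, zero_sub]
  · have hz : ∀ t, φ t x = 0 := fun t => hε t x (not_le.1 hxε)
    simp [hz]

end LatticeScheme

/-! ### Domination and convergence of difference quotients. -/

section DifferenceQuotients

open Filter Topology

variable {φ : ℝ → Plane → ℝ} {F : Plane → ℝ}

/-- A bounded function of compact support that dominates others: `C` on the ball of radius `R`. -/
noncomputable def plateau (R C : ℝ) (s : ℝ × Plane) : ℝ :=
  (Icc (-R) R).indicator (fun _ => C) s.1 * (Metric.closedBall (0 : Plane) R).indicator 1 s.2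

theorem abs_le_plateau {R C a : ℝ} {s : ℝ × Plane} (hC : 0 ≤ C) (ha : |a| ≤ C)
    (h : a ≠ 0 → |s.1| ≤ R ∧ ‖s.2‖ ≤ R) : |a| ≤ plateau R C s := by
  by_cases ha0 : a = 0
  · rw [ha0, abs_zero]
    exact mul_nonneg (indicator_nonneg (fun _ _ => hC) _)
      (indicator_nonneg (fun _ _ => zero_le_one) _)
  · obtain ⟨h1, h2⟩ := h ha0
    unfold plateau
    rw [indicator_of_mem (mem_Icc.2 (abs_le.1 h1)), indicator_of_mem (by simpa using h2), Pi.one_apply, mul_one]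
    exact ha

theorem abs_mul_gridDiff_le {N : ℕ} (hN : 1 ≤ N) (hF : ContDiff ℝ ∞ F) (i : Fin 2) {C : ℝ}
    (h : ∀ y, |partialDeriv i F y| ≤ C) (x : Plane) : |N * gridDiff N i F x| ≤ C := by
  have := abs_mul_gridDiff_sub_le (x := x) (a := 0) (δ := C) hN hF i fun y _ => by
    rw [sub_zero]
    exact h y
  rwa [sub_zero] at this

theorem abs_mul_sub_comp_sub_le {N : ℕ} (hN : 1 ≤ N) (hF : ContDiff ℝ ∞ F) (i : Fin 2) {C : ℝ}
    (h : ∀ y, |partialDeriv i F y| ≤ C) (x : Plane) : |N * (F x - F (x - gridStep N i))| ≤ C := by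
  have := abs_mul_gridDiff_comp_sub_le (x := x) (a := 0) (δ := C) hN hF i fun y _ => by
    rw [sub_zero]
    exact h y
  rwa [sub_zero] at this

theorem abs_sq_mul_second_diff_le {N : ℕ} (hN : 1 ≤ N) (hF : ContDiff ℝ ∞ F) (i : Fin 2) {C : ℝ}
    (h : ∀ y, |partialDeriv i (partialDeriv i F) y| ≤ C) (x : Plane) :
    |(N : ℝ) ^ 2 * (F (x + gridStep N i) + F (x - gridStep N i) - 2 * F x)| ≤ C := by
  have := abs_sq_mul_second_diff_sub_le (x := x) (a := 0) (δ := C) hN hF i fun y _ => by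
    rw [sub_zero]
    exact h y
  rwa [sub_zero] at this

/-- The difference quotients of a test function, and its time derivative, have a common bound. -/
theorem exists_plateau (h : IsTestFunction φ) : ∃ R C, 0 ≤ C ∧
    (∀ s : ℝ × Plane, |deriv (fun r => φ r s.2) s.1| ≤ plateau R C s) ∧
    ∀ (N : ℕ), 1 ≤ N → ∀ (i : Fin 2) (s : ℝ × Plane),
      |N * gridDiff N i (φ s.1) s.2| ≤ plateau R C s ∧
      |N * (φ s.1 s.2 - φ s.1 (s.2 - gridStep N i))| ≤ plateau R C s ∧
      |(N : ℝ) ^ 2 * (φ s.1 (s.2 + gridStep N i) + φ s.1 (s.2 - gridStep N i) - 2 * φ s.1 s.2)| ≤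
        plateau R C s := by
  obtain ⟨R, -, hR⟩ := h.exists_radius
  obtain ⟨R', -, hR'⟩ := h.timeDeriv.exists_radius
  obtain ⟨C', hC'0, hC'⟩ := h.timeDeriv.exists_abs_le
  obtain ⟨C0, hC00, hC0⟩ := (h.partialDeriv 0).exists_abs_le
  obtain ⟨C1, hC10, hC1⟩ := (h.partialDeriv 1).exists_abs_le
  obtain ⟨C2, hC20, hC2⟩ := ((h.partialDeriv 0).partialDeriv 0).exists_abs_le
  obtain ⟨C3, hC30, hC3⟩ := ((h.partialDeriv 1).partialDeriv 1).exists_abs_le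
  set C := C' + C0 + C1 + C2 + C3 with hC
  have hp1 : ∀ i t x, |partialDeriv i (φ t) x| ≤ C := by
    intro i t x
    fin_cases i
    · exact (hC0 t x).trans (by linarith)
    · exact (hC1 t x).trans (by linarith)
  have hp2 : ∀ i t x, |partialDeriv i (partialDeriv i (φ t)) x| ≤ C := by
    intro i t x
    fin_cases i
    · exact (hC2 t x).trans (by linarith)
    · exact (hC3 t x).trans (by linarith)
  -- A step has length at most `1`, so quotients vanish outside the support enlarged by `1`.
  refine ⟨max (R + 1) R', C, by positivity, fun s => ?_, fun N hN i s => ?_⟩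
  · refine abs_le_plateau (by positivity) ((hC' s.1 s.2).trans (by linarith)) fun hs => ?_
    have := hR' s.1 s.2 hs
    exact ⟨this.1.trans (le_max_right _ _), this.2.trans (le_max_right _ _)⟩
  · have hN0 : (0 : ℝ) < N := by exact_mod_cast hN
    have hg : ‖gridStep N i‖ ≤ 1 := by
      rw [norm_gridStep, div_le_one hN0]
      exact_mod_cast hN
    have hs : ∀ w : Plane, ‖w‖ ≤ 1 → φ s.1 (s.2 + w) ≠ 0 →
        |s.1| ≤ max (R + 1) R' ∧ ‖s.2‖ ≤ max (R + 1) R' := by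
      intro w hw hne
      obtain ⟨h1, h2⟩ := hR _ _ hne
      have h3 : ‖s.2‖ ≤ ‖s.2 + w‖ + ‖w‖ := by
        have := norm_sub_le (s.2 + w) w
        rwa [add_sub_cancel_right] at this
      exact ⟨(h1.trans (by linarith)).trans (le_max_left _ _),
        (h3.trans (by linarith)).trans (le_max_left _ _)⟩
    have hz : ∀ w : Plane, ‖w‖ ≤ 1 → ¬ (|s.1| ≤ max (R + 1) R' ∧ ‖s.2‖ ≤ max (R + 1) R') →
        φ s.1 (s.2 + w) = 0 := fun w hw hn => by
      by_contra hc
      exact hn (hs w hw hc)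
    have z0 := hz 0 (by simp)
    have z1 := hz (gridStep N i) hg
    have z2 := hz (-gridStep N i) (by rwa [norm_neg])
    rw [add_zero] at z0
    rw [← sub_eq_add_neg] at z2
    refine ⟨abs_le_plateau (by positivity)
      (abs_mul_gridDiff_le hN (h.contDiff_slice _) i (hp1 i s.1) s.2) fun hne => ?_,
      abs_le_plateau (by positivity)
      (abs_mul_sub_comp_sub_le hN (h.contDiff_slice _) i (hp1 i s.1) s.2) fun hne => ?_,
      abs_le_plateau (by positivity)
      (abs_sq_mul_second_diff_le hN (h.contDiff_slice _) i (hp2 i s.1) s.2) fun hne => ?_⟩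
    · by_contra hc
      exact hne (by rw [gridDiff, z0 hc, z1 hc]; simp)
    · by_contra hc
      exact hne (by rw [z0 hc, z2 hc]; simp)
    · by_contra hc
      exact hne (by rw [z0 hc, z1 hc, z2 hc]; simp)

theorem tendsto_difference_quotients (hF : ContDiff ℝ ∞ F) {N : ℕ → ℕ} (hN1 : ∀ n, 1 ≤ N n)
    (hN : Tendsto (fun n => 1 / (N n : ℝ)) atTop (𝓝 0)) (i : Fin 2) (x : Plane) :
    Tendsto (fun n => N n * gridDiff (N n) i F x) atTop (𝓝 (partialDeriv i F x)) ∧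
    Tendsto (fun n => N n * (F x - F (x - gridStep (N n) i))) atTop (𝓝 (partialDeriv i F x)) ∧
    Tendsto (fun n => (N n : ℝ) ^ 2 *
      (F (x + gridStep (N n) i) + F (x - gridStep (N n) i) - 2 * F x)) atTop
      (𝓝 (partialDeriv i (partialDeriv i F) x)) := by
  have h1 := contDiff_partialDeriv hF i
  have h2 := contDiff_partialDeriv h1 i
  have key : ∀ {g : Plane → ℝ}, Continuous g → ∀ δ > 0, ∀ᶠ n in atTop,
      ∀ y, dist y x ≤ 3 / N n → |g y - g x| ≤ δ / 2 := by
    intro g hg δ hδ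
    obtain ⟨r, hr, hgr⟩ := Metric.continuous_iff.1 hg x (δ / 2) (by positivity)
    filter_upwards [hN.eventually_lt_const (show 0 < r / 3 by positivity)] with n hn y hy
    refine (hgr y (hy.trans_lt ?_)).le
    have e : 3 / (N n : ℝ) = 3 * (1 / N n) := by ring
    rw [e]
    linarith
  refine ⟨Metric.tendsto_nhds.2 fun δ hδ => ?_, Metric.tendsto_nhds.2 fun δ hδ => ?_,
    Metric.tendsto_nhds.2 fun δ hδ => ?_⟩
  · filter_upwards [key h1.continuous δ hδ] with n hn
    rw [Real.dist_eq]
    refine (abs_mul_gridDiff_sub_le (hN1 n) hF i fun y hy => hn y (hy.trans ?_)).trans_lt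
      (half_lt_self hδ)
    gcongr
    norm_num
  · filter_upwards [key h1.continuous δ hδ] with n hn
    rw [Real.dist_eq]
    refine (abs_mul_gridDiff_comp_sub_le (hN1 n) hF i fun y hy => hn y (hy.trans ?_)).trans_lt
      (half_lt_self hδ)
    gcongr
    norm_num
  · filter_upwards [key h2.continuous δ hδ] with n hn
    rw [Real.dist_eq]
    exact (abs_sq_mul_second_diff_sub_le (hN1 n) hF i fun y hy => hn y hy).trans_lt
      (half_lt_self hδ)

/-- A pure identity, with `w₀` and `w₁` arbitrary. It shows why the flux is normalised as half of
the physical one: `2 N p` plays the role of the velocity. The first bracket is consistent with `Δ +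
w · ∇`, and the second collects the mismatch between flux and `w`. -/
theorem gridGenerator_neg_eq (N : ℕ) (p q : ℤ × ℤ → ℝ) (F w₀ w₁ : Plane → ℝ) (x : Plane) :
    (N : ℝ) ^ 2 * gridGenerator N (fun z => -p z) (fun z => -q z) F x =
      ((N : ℝ) ^ 2 * (F (x + gridStep N 0) + F (x - gridStep N 0) - 2 * F x) +
        (N : ℝ) ^ 2 * (F (x + gridStep N 1) + F (x - gridStep N 1) - 2 * F x) +
        w₀ x * ((N * gridDiff N 0 F x + N * (F x - F (x - gridStep N 0))) / 2) +
        w₁ x * ((N * gridDiff N 1 F x + N * (F x - F (x - gridStep N 1))) / 2)) +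
      ((2 * N * p (cellIndex N x + dirX) - w₀ x) * (N * gridDiff N 0 F x) / 2 +
        (2 * N * p (cellIndex N x) - w₀ x) * (N * (F x - F (x - gridStep N 0))) / 2 +
        (2 * N * q (cellIndex N x + dirY) - w₁ x) * (N * gridDiff N 1 F x) / 2 +
        (2 * N * q (cellIndex N x) - w₁ x) * (N * (F x - F (x - gridStep N 1))) / 2) := by
  unfold gridGenerator gridDiff
  ring

end DifferenceQuotients

/-! ### Passage to the limit in the weak form. -/

section Limit

open Filter Topology

variable {U A W : ℝ} {u : Plane → Plane} {θ₀ : Plane → ℝ} {η : ℕ → Plane → ℝ} {ε : ℕ → ℝ}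
  {φ : ℝ → Plane → ℝ} {θ : ℝ → Plane → ℝ}

theorem integrable_plateau_mul (R C : ℝ) {g : Plane → ℝ} (hg : LocallyIntegrable g) :
    Integrable (fun s : ℝ × Plane => plateau R C s * g s.2)
      ((volume.restrict (Ioi (0 : ℝ))).prod volume) := by
  have h1 : Integrable ((Icc (-R) R).indicator fun _ : ℝ => C) (volume.restrict (Ioi (0 : ℝ))) :=
    ((integrable_indicator_iff measurableSet_Icc).2
      (integrableOn_const isCompact_Icc.measure_lt_top.ne)).restrict
  have h2 : Integrable ((Metric.closedBall (0 : Plane) R).indicator g) :=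
    (integrable_indicator_iff measurableSet_closedBall).2
      (hg.integrableOn_isCompact (isCompact_closedBall _ _))
  refine (h1.mul_prod h2).congr (Eventually.of_forall fun s => ?_)
  unfold plateau
  by_cases hs : s.2 ∈ Metric.closedBall (0 : Plane) R
  · simp [indicator_of_mem hs]
  · simp [indicator_of_notMem hs]

theorem tendsto_lintegral_plateau_mul (R C : ℝ) {g : ℕ → Plane → ℝ}
    (hgm : ∀ n, AEStronglyMeasurable (g n) volume)
    (hg : Tendsto (fun n => ∫⁻ x in Metric.ball 0 (R + 1), ‖g n x‖ₑ) atTop (𝓝 0)) :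
    Tendsto (fun n => ∫⁻ s : ℝ × Plane, ‖plateau R C s * g n s.2‖ₑ
      ∂((volume.restrict (Ioi (0 : ℝ))).prod volume)) atTop (𝓝 0) := by
  set K : ℝ≥0∞ := ∫⁻ t in Ioi (0 : ℝ), ‖(Icc (-R) R).indicator (fun _ => C) t‖ₑ with hK
  have hKt : K ≠ ⊤ := by
    have h1 : Integrable ((Icc (-R) R).indicator fun _ : ℝ => C) (volume.restrict (Ioi (0 : ℝ))) :=
      ((integrable_indicator_iff measurableSet_Icc).2
        (integrableOn_const isCompact_Icc.measure_lt_top.ne)).restrict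
    exact h1.hasFiniteIntegral.ne
  have hle : ∀ n, ∫⁻ s : ℝ × Plane, ‖plateau R C s * g n s.2‖ₑ
      ∂((volume.restrict (Ioi (0 : ℝ))).prod volume) ≤
      K * ∫⁻ x in Metric.ball 0 (R + 1), ‖g n x‖ₑ := by
    intro n
    have e : ∀ s : ℝ × Plane, ‖plateau R C s * g n s.2‖ₑ =
        ‖(Icc (-R) R).indicator (fun _ => C) s.1‖ₑ *
          ‖(Metric.closedBall (0 : Plane) R).indicator (g n) s.2‖ₑ := by
      intro s
      rw [← enorm_mul]
      unfold plateau
      by_cases hs : s.2 ∈ Metric.closedBall (0 : Plane) R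
      · simp [indicator_of_mem hs]
      · simp [indicator_of_notMem hs]
    simp only [e]
    rw [lintegral_prod_mul
      (f := fun t => ‖(Icc (-R) R).indicator (fun _ => C) t‖ₑ)
      (g := fun x => ‖(Metric.closedBall (0 : Plane) R).indicator (g n) x‖ₑ)
      (measurable_const.indicator measurableSet_Icc).enorm.aemeasurable
      ((hgm n).indicator measurableSet_closedBall).enorm]
    refine mul_le_mul' le_rfl ?_
    simp only [enorm_indicator_eq_indicator_enorm]
    rw [lintegral_indicator measurableSet_closedBall]
    exact lintegral_mono_set (Metric.closedBall_subset_ball (by linarith))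
  have h0 : Tendsto (fun n => K * ∫⁻ x in Metric.ball 0 (R + 1), ‖g n x‖ₑ) atTop (𝓝 0) := by
    have := ENNReal.Tendsto.const_mul hg (Or.inr hKt)
    rwa [mul_zero] at this
  exact tendsto_of_tendsto_of_tendsto_of_le_of_le tendsto_const_nhds h0 (fun _ => zero_le) hle

theorem eventually_le_one_div (hε : Tendsto ε atTop (𝓝 0)) (hpos : ∀ n, 0 < ε n) (r : ℝ) :
    ∀ᶠ n in atTop, r ≤ 1 / ε n := by
  have h1 : ∀ᶠ n in atTop, ε n < 1 / (|r| + 1) :=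
    hε.eventually_lt_const (by positivity)
  filter_upwards [h1] with n hn
  have h2 := hpos n
  rw [lt_div_iff₀ (by positivity)] at hn
  rw [le_div_iff₀ h2]
  nlinarith [le_abs_self r]

theorem abs_flux_error_le {P e w₀ w₁ v₀ v₁ c₁ c₂ c₃ c₄ x₁ x₂ x₃ x₄ : ℝ}
    (h₁ : |c₁ - v₀| ≤ e) (h₂ : |c₂ - v₀| ≤ e) (h₃ : |c₃ - v₁| ≤ e) (h₄ : |c₄ - v₁| ≤ e)
    (k₁ : |x₁| ≤ P) (k₂ : |x₂| ≤ P) (k₃ : |x₃| ≤ P) (k₄ : |x₄| ≤ P) :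
    |(c₁ - w₀) * x₁ / 2 + (c₂ - w₀) * x₂ / 2 + (c₃ - w₁) * x₃ / 2 + (c₄ - w₁) * x₄ / 2| ≤
      P * (2 * e + ‖v₀ - w₀‖ + ‖v₁ - w₁‖) := by
  have hP : 0 ≤ P := (abs_nonneg _).trans k₁
  have key : ∀ {c w v x : ℝ}, |c - v| ≤ e → |x| ≤ P →
      |(c - w) * x / 2| ≤ (e + ‖v - w‖) * P / 2 := by
    intro c w v x hc hx
    rw [abs_div, abs_two, abs_mul]
    have h3 : |c - w| ≤ e + ‖v - w‖ := by
      have := abs_sub_le c v w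
      rw [Real.norm_eq_abs]
      linarith
    have h4 := (abs_nonneg _).trans h3
    gcongr
  refine (abs_add_le _ _).trans ((add_le_add ((abs_add_le _ _).trans (add_le_add
    ((abs_add_le _ _).trans (add_le_add (key h₁ k₁) (key h₂ k₂))) (key h₃ k₃)))
    (key h₄ k₄)).trans (le_of_eq (by ring)))

theorem tendsto_lintegral_mollify_error (hε : Tendsto ε atTop (𝓝 0))
    (hη : ∀ n, IsMollifier (η n) (ε n)) (hu : LocallyIntegrable u) (A R : ℝ) :
    Tendsto (fun n => ∫⁻ x in Metric.ball 0 R, ‖A * (2 * ε n +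
      ‖mollify (η n) (fun y => u y 0) x - u x 0‖ +
      ‖mollify (η n) (fun y => u y 1) x - u x 1‖)‖ₑ) atTop (𝓝 0) := by
  have hui := locallyIntegrable_coord hu
  have t0 := tendsto_lintegral_mollify_sub hη hε (hui 0) R
  have t1 := tendsto_lintegral_mollify_sub hη hε (hui 1) R
  have t2 : Tendsto (fun n => ‖2 * ε n‖ₑ * volume (Metric.ball (0 : Plane) R)) atTop
      (𝓝 0) := by
    have h1 : Tendsto (fun n => ‖2 * ε n‖ₑ) atTop (𝓝 0) := by
      have := (hε.const_mul 2).enorm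
      rwa [mul_zero, enorm_zero] at this
    have := ENNReal.Tendsto.mul_const h1 (Or.inr (measure_ball_lt_top (μ := volume)
      (x := (0 : Plane)) (r := R)).ne)
    rwa [zero_mul] at this
  have t3 := ENNReal.Tendsto.const_mul ((t2.add t0).add t1) (Or.inr (enorm_ne_top (x := A)))
  rw [add_zero, add_zero, mul_zero] at t3
  refine tendsto_of_tendsto_of_tendsto_of_le_of_le tendsto_const_nhds t3 (fun _ => zero_le)
    fun n => ?_
  have hm : ∀ i, AEStronglyMeasurable (fun x => mollify (η n) (fun y => u y i) x - u x i)
      (volume.restrict (Metric.ball (0 : Plane) R)) := fun i =>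
    ((contDiff_mollify (hη n).contDiff (hη n).hasCompactSupport
      (hui i)).continuous.aestronglyMeasurable.sub (hui i).aestronglyMeasurable).restrict
  simp only
  rw [← setLIntegral_const, ← lintegral_add_left' aemeasurable_const,
    ← lintegral_add_right' _ (hm 1).enorm,
    ← lintegral_const_mul' _ _ enorm_ne_top]
  refine lintegral_mono fun x => ?_
  rw [enorm_mul]
  refine mul_le_mul' le_rfl ((enorm_add_le _ _).trans (add_le_add ((enorm_add_le _ _).trans ?_) ?_))
  · rw [enorm_norm]
  · rw [enorm_norm]

theorem tendsto_integral_initial (hε : Tendsto ε atTop (𝓝 0)) {v : ℕ → Fin 2 → Plane → ℝ}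
    (D : ∀ n, LatticeScheme U A W (v n) θ₀ (ε n)) (hθ₀ : Continuous θ₀) (hφ : IsTestFunction φ) :
    Tendsto (fun n => -∫ x, (D n).f (cellIndex (4 * (D n).M) x) * φ 0 x) atTop
      (𝓝 (-∫ x, θ₀ x * φ 0 x)) := by
  have hεinf := eventually_le_one_div hε fun n => (D n).eps_pos
  refine (tendsto_integral_of_dominated_convergence (fun x => A * ‖φ 0 x‖) (fun n => ?_) ?_
    (fun n => Eventually.of_forall fun x => ?_) (Eventually.of_forall fun x => ?_)).neg
  · exact (measurable_comp_cellIndex _).aestronglyMeasurable.mul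
      (hφ.contDiff_slice 0).continuous.aestronglyMeasurable
  · exact (((hφ.contDiff_slice 0).continuous.integrable_of_hasCompactSupport
      (hφ.hasCompactSupport_slice 0)).norm).const_mul A
  · rw [norm_mul]
    exact mul_le_mul_of_nonneg_right ((D n).abs_initial_le _) (norm_nonneg _)
  · refine Tendsto.mul_const _ (Metric.tendsto_nhds.2 fun δ hδ => ?_)
    obtain ⟨r, hr, hθr⟩ := Metric.continuous_iff.1 hθ₀ x (δ / 2) (by positivity)
    filter_upwards [hεinf ‖x‖, hε.eventually_lt_const (show 0 < r / 3 by positivity)] with n h1 h2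
    rw [Real.dist_eq]
    exact ((D n).initial x h1 (δ / 2) fun y hy => (hθr y (by linarith)).le).trans_lt
      (half_lt_self hδ)

/-- The limit of lattice solutions satisfies the weak form of the equation. -/
theorem integral_eq_of_tendsto_sol (hε : Tendsto ε atTop (𝓝 0)) (hη : ∀ n, IsMollifier (η n) (ε n))
    (D : ∀ n, LatticeScheme U A W (fun i => mollify (η n) fun y => u y i) θ₀ (ε n))
    (hu : LocallyIntegrable u) (hθ₀ : Continuous θ₀)
    (hθ : ∀ t > 0, ∀ x, Tendsto (fun n => (D n).sol t x) atTop (𝓝 (θ t x)))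
    (hφ : IsTestFunction φ) :
    ∫ s : ℝ × Plane in Ioi (0 : ℝ) ×ˢ univ, θ s.1 s.2 * (deriv (fun r => φ r s.2) s.1 +
      fderiv ℝ (φ s.1) s.2 (u s.2) + Laplacian.laplacian (φ s.1) s.2) = -∫ x, θ₀ x * φ 0 x := by
  rw [volume_restrict_Ioi_prod]
  set μ := (volume.restrict (Ioi (0 : ℝ))).prod (volume : Measure Plane) with hμ
  have hA := (D 0).bound_nonneg
  obtain ⟨R, C, hC, hP0, hP⟩ := exists_plateau hφ
  have hN1 : ∀ n, 1 ≤ 4 * (D n).M := fun n => (D n).one_le_mesh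
  have hNinv : Tendsto (fun n => 1 / ((4 * (D n).M : ℕ) : ℝ)) atTop (𝓝 0) :=
    squeeze_zero (fun n => by positivity) (fun n => (D n).inv_le) hε
  have hui := locallyIntegrable_coord hu
  have hεinf := eventually_le_one_div hε fun n => (D n).eps_pos
  -- The integrand with the limit drift `u` in place of the lattice flux. It converges pointwise
  -- under a fixed integrable bound, whereas the flux itself converges only in local `L¹` and is
  -- treated separately.
  set a : ℕ → ℝ × Plane → ℝ := fun n s => (D n).sol s.1 s.2 * (deriv (fun r => φ r s.2) s.1 +
    (((4 * (D n).M : ℕ) : ℝ) ^ 2 * (φ s.1 (s.2 + gridStep (4 * (D n).M) 0) +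
      φ s.1 (s.2 - gridStep (4 * (D n).M) 0) - 2 * φ s.1 s.2) +
    ((4 * (D n).M : ℕ) : ℝ) ^ 2 * (φ s.1 (s.2 + gridStep (4 * (D n).M) 1) +
      φ s.1 (s.2 - gridStep (4 * (D n).M) 1) - 2 * φ s.1 s.2) +
    u s.2 0 * ((((4 * (D n).M : ℕ) : ℝ) * gridDiff (4 * (D n).M) 0 (φ s.1) s.2 +
      ((4 * (D n).M : ℕ) : ℝ) * (φ s.1 s.2 - φ s.1 (s.2 - gridStep (4 * (D n).M) 0))) / 2) +
    u s.2 1 * ((((4 * (D n).M : ℕ) : ℝ) * gridDiff (4 * (D n).M) 1 (φ s.1) s.2 +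
      ((4 * (D n).M : ℕ) : ℝ) * (φ s.1 s.2 - φ s.1 (s.2 - gridStep (4 * (D n).M) 1))) / 2)))
    with ha
  set tot : ℕ → ℝ × Plane → ℝ := fun n s => (D n).sol s.1 s.2 * (deriv (fun r => φ r s.2) s.1 +
    ((4 * (D n).M : ℕ) : ℝ) ^ 2 * gridGenerator (4 * (D n).M) (fun z => -(D n).p z)
      (fun z => -(D n).q z) (φ s.1) s.2) with htot
  have hpos : ∀ᵐ s ∂μ, s ∈ Ioi (0 : ℝ) ×ˢ (univ : Set Plane) := by
    rw [hμ, ← volume_restrict_Ioi_prod]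
    exact ae_restrict_mem (measurableSet_Ioi.prod MeasurableSet.univ)
  have hφc := hφ.contDiff.continuous
  have hφa : ∀ w : Plane, Continuous fun s : ℝ × Plane => φ s.1 (s.2 + w) := fun w =>
    (hφ.comp_add w).contDiff.continuous
  have hφs : ∀ w : Plane, Continuous fun s : ℝ × Plane => φ s.1 (s.2 - w) := fun w => by
    simp only [sub_eq_add_neg]
    exact hφa (-w)
  have hφt : Continuous fun s : ℝ × Plane => deriv (fun r => φ r s.2) s.1 :=
    hφ.timeDeriv.contDiff.continuous
  have hum : ∀ i, AEStronglyMeasurable (fun s : ℝ × Plane => u s.2 i) μ := fun i =>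
    (hui i).aestronglyMeasurable.comp_snd
  have ham : ∀ n, AEStronglyMeasurable (a n) μ := by
    intro n
    have hg : ∀ i, Continuous fun s : ℝ × Plane => gridDiff (4 * (D n).M) i (φ s.1) s.2 := fun i =>
      (hφa _).sub hφc
    have h2 : ∀ i, AEStronglyMeasurable (fun s : ℝ × Plane => ((4 * (D n).M : ℕ) : ℝ) ^ 2 *
        (φ s.1 (s.2 + gridStep (4 * (D n).M) i) + φ s.1 (s.2 - gridStep (4 * (D n).M) i) -
          2 * φ s.1 s.2)) μ := fun i =>
      (continuous_const.mul (((hφa _).add (hφs _)).sub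
        (continuous_const.mul hφc))).aestronglyMeasurable
    have h1 : ∀ i, AEStronglyMeasurable (fun s : ℝ × Plane =>
        (((4 * (D n).M : ℕ) : ℝ) * gridDiff (4 * (D n).M) i (φ s.1) s.2 +
        ((4 * (D n).M : ℕ) : ℝ) * (φ s.1 s.2 - φ s.1 (s.2 - gridStep (4 * (D n).M) i))) / 2) μ :=
      fun i => (((continuous_const.mul (hg i)).add
        (continuous_const.mul (hφc.sub (hφs _)))).div_const 2).aestronglyMeasurable
    exact (D n).measurable_sol.aestronglyMeasurable.mul (hφt.aestronglyMeasurable.add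
      ((((h2 0).add (h2 1)).add ((hum 0).mul (h1 0))).add ((hum 1).mul (h1 1))))
  -- The `3` counts the time derivative and the two second difference quotients.
  set bd : ℝ × Plane → ℝ := fun s => plateau R C s * (A * (3 + ‖u s.2 0‖ + ‖u s.2 1‖)) with hbd
  have hbdi : Integrable bd μ := by
    refine integrable_plateau_mul R C (g := fun x => A * (3 + ‖u x 0‖ + ‖u x 1‖)) ?_
    have hn : ∀ i, LocallyIntegrable fun x => ‖u x i‖ := fun i x => by
      obtain ⟨t, ht, hti⟩ := hui i x
      exact ⟨t, ht, hti.norm⟩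
    exact (((locallyIntegrable_const 3).add (hn 0)).add (hn 1)).smul A
  have habd : ∀ n, ∀ᵐ s ∂μ, ‖a n s‖ ≤ bd s := by
    intro n
    filter_upwards [hpos] with s hs
    have hsol := (D n).abs_sol_le (le_of_lt hs.1) s.2
    obtain ⟨f0, b0, s0⟩ := hP _ (hN1 n) 0 s
    obtain ⟨f1, b1, s1⟩ := hP _ (hN1 n) 1 s
    have hP0s := hP0 s
    have hpl : 0 ≤ plateau R C s := (abs_nonneg _).trans hP0s
    have hav : ∀ {x y w : ℝ}, |x| ≤ plateau R C s → |y| ≤ plateau R C s →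
        |w * ((x + y) / 2)| ≤ plateau R C s * ‖w‖ := by
      intro x y w hx hy
      rw [abs_mul, mul_comm, Real.norm_eq_abs]
      refine mul_le_mul_of_nonneg_right ?_ (abs_nonneg _)
      rw [abs_div, abs_two]
      linarith [abs_add_le x y]
    rw [Real.norm_eq_abs, ha, hbd]
    simp only
    rw [abs_mul, mul_left_comm]
    refine mul_le_mul hsol ?_ (abs_nonneg _) hA
    refine (abs_add_le _ _).trans ((add_le_add hP0s ((abs_add_le _ _).trans (add_le_add
      ((abs_add_le _ _).trans (add_le_add ((abs_add_le _ _).trans (add_le_add s0 s1))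
        (hav f0 b0))) (hav f1 b1)))).trans (le_of_eq (by ring)))
  have hai : ∀ n, Integrable (a n) μ := fun n => hbdi.mono' (ham n) (habd n)
  have hlim_a : Tendsto (fun n => ∫ s, a n s ∂μ) atTop (𝓝 (∫ s : ℝ × Plane, θ s.1 s.2 *
      (deriv (fun r => φ r s.2) s.1 + fderiv ℝ (φ s.1) s.2 (u s.2) +
        Laplacian.laplacian (φ s.1) s.2) ∂μ)) := by
    refine tendsto_integral_of_dominated_convergence bd ham hbdi habd ?_
    filter_upwards [hpos] with s hs
    have hF := hφ.contDiff_slice s.1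
    obtain ⟨f0, b0, s0⟩ := tendsto_difference_quotients hF hN1 hNinv 0 s.2
    obtain ⟨f1, b1, s1⟩ := tendsto_difference_quotients hF hN1 hNinv 1 s.2
    have := (hθ s.1 hs.1 s.2).mul ((tendsto_const_nhds (x := deriv (fun r => φ r s.2) s.1)).add
      (((s0.add s1).add (((f0.add b0).div_const 2).const_mul (u s.2 0))).add
        (((f1.add b1).div_const 2).const_mul (u s.2 1))))
    refine this.trans_eq ?_
    rw [laplacian_eq_sum_partialDeriv hF, fderiv_eq_sum_partialDeriv]
    congr 1
    ring
  have hdiff : ∀ n, ∀ᵐ s ∂μ, ‖tot n s - a n s‖ ≤ ‖plateau R C s * (A * (2 * ε n +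
      ‖mollify (η n) (fun y => u y 0) s.2 - u s.2 0‖ +
      ‖mollify (η n) (fun y => u y 1) s.2 - u s.2 1‖))‖ := by
    intro n
    filter_upwards [hpos] with s hs
    have hsol := (D n).abs_sol_le (le_of_lt hs.1) s.2
    obtain ⟨f0, b0, -⟩ := hP _ (hN1 n) 0 s
    obtain ⟨f1, b1, -⟩ := hP _ (hN1 n) 1 s
    have hpl : 0 ≤ plateau R C s := (abs_nonneg _).trans (hP0 s)
    have hεn := (D n).eps_pos
    obtain ⟨l1, l2⟩ := (D n).left s.2
    obtain ⟨r1, r2⟩ := (D n).right s.2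
    have he : tot n s - a n s = (D n).sol s.1 s.2 *
        ((2 * ((4 * (D n).M : ℕ) : ℝ) * (D n).p (cellIndex (4 * (D n).M) s.2 + dirX) - u s.2 0) *
            (((4 * (D n).M : ℕ) : ℝ) * gridDiff (4 * (D n).M) 0 (φ s.1) s.2) / 2 +
          (2 * ((4 * (D n).M : ℕ) : ℝ) * (D n).p (cellIndex (4 * (D n).M) s.2) - u s.2 0) *
            (((4 * (D n).M : ℕ) : ℝ) * (φ s.1 s.2 - φ s.1 (s.2 - gridStep (4 * (D n).M) 0))) / 2 +
          (2 * ((4 * (D n).M : ℕ) : ℝ) * (D n).q (cellIndex (4 * (D n).M) s.2 + dirY) - u s.2 1) *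
            (((4 * (D n).M : ℕ) : ℝ) * gridDiff (4 * (D n).M) 1 (φ s.1) s.2) / 2 +
          (2 * ((4 * (D n).M : ℕ) : ℝ) * (D n).q (cellIndex (4 * (D n).M) s.2) - u s.2 1) *
            (((4 * (D n).M : ℕ) : ℝ) * (φ s.1 s.2 - φ s.1 (s.2 - gridStep (4 * (D n).M) 1))) / 2) := by
      simp only [htot, ha]
      rw [gridGenerator_neg_eq _ _ _ _ (fun x => u x 0) (fun x => u x 1), ← mul_sub,
        add_sub_add_left_eq_sub, add_sub_cancel_left]
    rw [he, norm_mul]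
    refine le_trans ?_ (le_abs_self _)
    rw [mul_left_comm (plateau R C s)]
    exact mul_le_mul hsol (abs_flux_error_le l2 l1 r2 r1 f0 b0 f1 b1) (abs_nonneg _) hA
  -- The mismatch between flux and `u` is at most `ε` plus the mollification error, multiplied by
  -- bounded quotients of compact support, so it tends to zero in `L¹`.
  have hlim_b : Tendsto (fun n => ∫ s, (tot n s - a n s) ∂μ) atTop (𝓝 0) := by
    have hgl := tendsto_lintegral_mollify_error hε hη hu A (R + 1)
    have hb := tendsto_lintegral_plateau_mul R C (fun n => ?_) hgl
    · rw [tendsto_zero_iff_enorm_tendsto_zero]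
      refine tendsto_of_tendsto_of_tendsto_of_le_of_le tendsto_const_nhds hb (fun _ => zero_le)
        fun n => ?_
      refine (enorm_integral_le_lintegral_enorm _).trans (lintegral_mono_ae ?_)
      filter_upwards [hdiff n] with s hs
      exact enorm_le_iff_norm_le.2 hs
    · have hm : ∀ i, AEStronglyMeasurable (fun x => ‖mollify (η n) (fun y => u y i) x - u x i‖)
          volume := fun i =>
        ((contDiff_mollify (hη n).contDiff (hη n).hasCompactSupport
          (hui i)).continuous.aestronglyMeasurable.sub (hui i).aestronglyMeasurable).norm
      exact aestronglyMeasurable_const.mul ((aestronglyMeasurable_const.add (hm 0)).add (hm 1))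
  have hlim_r := tendsto_integral_initial hε D hθ₀ hφ
  have hlim_t := hlim_a.add hlim_b
  rw [add_zero] at hlim_t
  refine tendsto_nhds_unique hlim_t (hlim_r.congr' ?_)
  obtain ⟨R', -, hR'⟩ := hφ.exists_radius
  filter_upwards [hεinf R'] with n hn
  obtain ⟨hti, ht⟩ := (D n).integral_sol hφ fun t x hx => by
    by_contra hc
    exact absurd (hR' t x hc).2 (not_le.2 (hn.trans_lt hx))
  rw [← ht, integral_sub hti (hai n), add_sub_cancel]

end Limit

/-! ### The logarithmic modulus of continuity. -/

section LogModulus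

open Filter Topology

theorem tendsto_div_sqrt_neg_log (K : ℝ) :
    Tendsto (fun r => K / √(-Real.log r)) (𝓝[>] 0) (𝓝 0) :=
  (Real.tendsto_sqrt_atTop.comp
    (tendsto_neg_atBot_atTop.comp Real.tendsto_log_nhdsGT_zero)).const_div_atTop K

theorem neg_log_pos {r : ℝ} (h0 : 0 < r) (h1 : r < 1) : 0 < -Real.log r := by
  have := Real.log_neg h0 h1
  linarith

theorem div_sqrt_neg_log_le {K a b : ℝ} (hK : 0 ≤ K) (ha : 0 < a) (hab : a ≤ b) (hb : b < 1) :
    K / √(-Real.log a) ≤ K / √(-Real.log b) :=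
  div_le_div_of_nonneg_left hK (Real.sqrt_pos.2 (neg_log_pos (ha.trans_le hab) hb))
    (Real.sqrt_le_sqrt (neg_le_neg (Real.log_le_log ha hab)))

theorem continuousAt_div_sqrt_neg_log (K : ℝ) {r : ℝ} (h0 : 0 < r) (h1 : r < 1) :
    ContinuousAt (fun r => K / √(-Real.log r)) r :=
  continuousAt_const.div (Real.continuousAt_log h0.ne').neg.sqrt
    (Real.sqrt_pos.2 (neg_log_pos h0 h1)).ne'

/-- The logarithmic modulus of continuity, constant from `1 / 2` on. -/
theorem isModulusOfContinuity_log {K : ℝ} (hK : 0 ≤ K) :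
    IsModulusOfContinuity fun r => K / √(-Real.log (min r (1 / 2))) where
  -- By the conventions `log 0 = 0` and division by `√0` gives `0`, the formula takes the right
  -- value at the origin.
  map_zero := by simp
  monotoneOn a ha b hb hab := by
    rcases (mem_Ici.1 ha).eq_or_lt with h0 | h0
    · rw [← h0]
      simp only [one_div, min_eq_left (show (0 : ℝ) ≤ 2⁻¹ by norm_num), Real.log_zero, neg_zero,
        Real.sqrt_zero, div_zero]
      positivity
    · exact div_sqrt_neg_log_le hK (lt_min h0 (by norm_num)) (min_le_min_right _ hab)
        ((min_le_right _ _).trans_lt (by norm_num))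
  continuousOn r hr := by
    rcases (mem_Ici.1 hr).eq_or_lt with h0 | h0
    · rw [← h0, ← continuousWithinAt_Ioi_iff_Ici]
      have hz : K / √(-Real.log (min 0 (1 / 2))) = 0 := by simp
      rw [ContinuousWithinAt, hz]
      refine (tendsto_div_sqrt_neg_log K).congr' ?_
      filter_upwards [Ioo_mem_nhdsGT (show (0 : ℝ) < 1 / 2 by norm_num)] with s hs
      rw [min_eq_left hs.2.le]
    · refine ContinuousAt.continuousWithinAt ?_
      have h1 : 0 < min r (1 / 2) := lt_min h0 (by norm_num)
      have h2 : min r (1 / 2) < 1 := (min_le_right _ _).trans_lt (by norm_num)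
      exact ContinuousAt.comp (f := fun r : ℝ => min r (1 / 2))
        (continuousAt_div_sqrt_neg_log K h1 h2) (by fun_prop)

end LogModulus

/-! ### Explicit constants and the conclusion. -/

section Main

open Filter Topology

/-- The constant in the modulus of continuity of the lattice solutions. -/
noncomputable def logConstant (U A W t : ℝ) : ℝ :=
  128 * (4 * W / t) + √(128 * (A ^ 2 * (192 + 32 * (U + 1)) + 16 * A * (4 * W / t)))

theorem logConstant_nonneg {U A W t : ℝ} (hW : 0 ≤ W) (ht : 0 < t) : 0 ≤ logConstant U A W t := by
  unfold logConstant
  positivity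

theorem logConstant_anti {U A W s t : ℝ} (hA : 0 ≤ A) (hW : 0 ≤ W) (hs : 0 < s) (hst : s ≤ t) :
    logConstant U A W t ≤ logConstant U A W s := by
  unfold logConstant
  gcongr

theorem logConstant_le {U A t : ℝ} (hU : 0 ≤ U) (hA : 0 ≤ A) (ht : 0 < t) :
    logConstant U A (37 * (1 + U) * A) t ≤ 20000 * (1 + U) * A * (1 + 1 / t) := by
  unfold logConstant
  set τ := 1 / t with hτ
  have hτ0 : 0 ≤ τ := by positivity
  have e : 4 * (37 * (1 + U) * A) / t = 148 * ((1 + U) * A * τ) := by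
    rw [hτ]
    ring
  rw [e]
  have hUτ : 0 ≤ U * τ := by positivity
  have h1 : 1 ≤ (1 + U) * (1 + τ) := by nlinarith
  -- `551²` just exceeds the leading coefficient `128 · 16 · 148 = 303104`, and altogether `128 ·
  -- 148 + 551 ≤ 20000`.
  have h2 : √(128 * (A ^ 2 * (192 + 32 * (U + 1)) + 16 * A * (148 * ((1 + U) * A * τ)))) ≤
      551 * (A * ((1 + U) * (1 + τ))) := by
    refine Real.sqrt_le_iff.2 ⟨by positivity, ?_⟩
    have h3 : 128 * (A ^ 2 * (192 + 32 * (U + 1)) + 16 * A * (148 * ((1 + U) * A * τ))) =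
        A ^ 2 * (128 * (224 + 32 * U + 2368 * ((1 + U) * τ))) := by ring
    have h4 : 128 * (224 + 32 * U + 2368 * ((1 + U) * τ)) ≤
        551 ^ 2 * ((1 + U) * (1 + τ)) := by nlinarith
    have h5 : (1 + U) * (1 + τ) ≤ ((1 + U) * (1 + τ)) ^ 2 := by nlinarith
    calc _ = A ^ 2 * (128 * (224 + 32 * U + 2368 * ((1 + U) * τ))) := h3
      _ ≤ A ^ 2 * (551 ^ 2 * ((1 + U) * (1 + τ)) ^ 2) := by
        refine mul_le_mul_of_nonneg_left ?_ (sq_nonneg A)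
        linarith
      _ = _ := by ring
  have h3 : 0 ≤ A * (1 + U) := by positivity
  have h4 : 0 ≤ A * (1 + U) * τ := by positivity
  linarith

variable {U A W : ℝ} {θ₀ : Plane → ℝ} {ε : ℕ → ℝ} {v : ℕ → Fin 2 → Plane → ℝ}

/-- The lattice solutions are asymptotically equicontinuous at positive times. -/
theorem eventually_abs_sol_sub_le (hε : Tendsto ε atTop (𝓝 0))
    (D : ∀ n, LatticeScheme U A W (v n) θ₀ (ε n)) (hU : 0 ≤ U) {t : ℝ} (ht : 0 < t) (x : Plane)
    {δ : ℝ} (hδ : 0 < δ) :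
    ∀ᶠ s in 𝓝 (t, x), ∀ᶠ n in atTop, |(D n).sol s.1 s.2 - (D n).sol t x| ≤ δ := by
  have hA := (D 0).bound_nonneg
  have hW := (D 0).total_nonneg
  -- The constant decreases in time, so its value at `t / 2` serves for all times near `t`.
  set K := logConstant U A W (t / 2) with hK
  have hK0 : 0 ≤ K := logConstant_nonneg hW (half_pos ht)
  obtain ⟨ρ, hρ, hρ1⟩ := (((tendsto_div_sqrt_neg_log K).eventually_lt_const
    (half_pos hδ)).and (Ioo_mem_nhdsGT (show (0 : ℝ) < 1 / 16 by norm_num))).exists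
  have hnb : ∀ᶠ s : ℝ × Plane in 𝓝 (t, x),
      |s.1 - t| < t / 2 ∧ 4 * W / (t / 2) * |s.1 - t| < δ / 2 ∧ dist x s.2 < ρ / 2 := by
    have c1 : Continuous fun s : ℝ × Plane => |s.1 - t| := by fun_prop
    have c2 : Continuous fun s : ℝ × Plane => 4 * W / (t / 2) * |s.1 - t| := by fun_prop
    have c3 : Continuous fun s : ℝ × Plane => dist x s.2 := by fun_prop
    refine (c1.continuousAt.eventually_lt_const ?_).and
      ((c2.continuousAt.eventually_lt_const ?_).and (c3.continuousAt.eventually_lt_const ?_))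
    · simpa using ht
    · simpa using hδ
    · simpa using hρ1.1
  filter_upwards [hnb] with s ⟨h1, h2, h3⟩
  have hs : t / 2 < s.1 := by linarith [(abs_lt.1 h1).1]
  have hs0 : 0 < s.1 := (half_pos ht).trans hs
  filter_upwards [eventually_le_one_div hε (fun n => (D n).eps_pos) (‖x‖ + 1),
    hε.eventually_lt_const (show 0 < ρ / 4 by linarith [hρ1.1])] with n hn hn2
  have hεn := (D n).eps_pos
  have hr0 : 0 ≤ dist x s.2 := dist_nonneg
  have hle : dist x s.2 + 2 * ε n ≤ ρ := by linarith
  have e1 := (D n).abs_sol_sub_le_space hU hs0 hn (y := s.2) (hle.trans hρ1.2.le)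
  have e2 := (D n).abs_sol_sub_le_time (x := x) (by linarith) (half_pos ht) hs.le
    (by linarith : t / 2 ≤ t)
  have e3 : logConstant U A W s.1 / √(-Real.log (dist x s.2 + 2 * ε n)) < δ / 2 := by
    refine lt_of_le_of_lt ?_ hρ
    refine le_trans ?_ (div_sqrt_neg_log_le hK0 (by linarith) hle (hρ1.2.trans (by norm_num)))
    gcongr
    exact logConstant_anti hA hW (half_pos ht) hs.le
  have e4 := e1.trans_lt e3
  have e5 := e2.trans_lt (by rwa [abs_sub_comm] : _ < δ / 2)
  have := abs_sub_le ((D n).sol s.1 s.2) ((D n).sol s.1 x) ((D n).sol t x)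
  rw [abs_sub_comm] at e4 e5
  linarith

/-- A limit of lattice solutions has a logarithmic modulus of continuity. -/
theorem abs_sub_le_of_tendsto_sol (hε : Tendsto ε atTop (𝓝 0))
    (D : ∀ n, LatticeScheme U A W (v n) θ₀ (ε n)) (hU : 0 ≤ U) {t : ℝ} (ht : 0 < t)
    {θ : Plane → ℝ} (hθ : ∀ x, Tendsto (fun n => (D n).sol t x) atTop (𝓝 (θ x))) {x y : Plane}
    (hxy : 0 < dist x y) (hxy' : dist x y < 1 / 16) :
    |θ x - θ y| ≤ logConstant U A W t / √(-Real.log (dist x y)) := by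
  have h1 : Tendsto (fun n => dist x y + 2 * ε n) atTop (𝓝 (dist x y)) := by
    simpa using (hε.const_mul 2).const_add (dist x y)
  refine le_of_tendsto_of_tendsto ((hθ x).sub (hθ y)).abs
    ((continuousAt_div_sqrt_neg_log (logConstant U A W t) hxy
      (hxy'.trans (by norm_num))).tendsto.comp h1) ?_
  filter_upwards [eventually_le_one_div hε (fun n => (D n).eps_pos) (‖x‖ + 1),
    h1.eventually_lt_const hxy'] with n hn hn2
  exact (D n).abs_sol_sub_le_space hU ht hn hn2.le

theorem abs_sub_le_log {U A t : ℝ} (hU : 0 ≤ U) (hA : 0 ≤ A) (ht : 0 < t) {θ : Plane → ℝ}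
    (hθ : ∀ x, |θ x| ≤ A) (hlog : ∀ x y, 0 < dist x y → dist x y < 1 / 16 →
      |θ x - θ y| ≤ logConstant U A (37 * (1 + U) * A) t / √(-Real.log (dist x y))) (x y : Plane) :
    |θ x - θ y| ≤
      20000 * (1 + U) * A * (1 + 1 / t) / √(-Real.log (min (dist x y) (1 / 2))) := by
  have hC0 : 0 ≤ 20000 * (1 + U) * A * (1 + 1 / t) := by positivity
  rcases eq_or_ne x y with rfl | hne
  · rw [sub_self, abs_zero]
    positivity
  have hr : 0 < dist x y := dist_pos.2 hne
  rcases lt_or_ge (dist x y) (1 / 16) with h | h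
  · rw [min_eq_left (h.le.trans (by norm_num))]
    refine (hlog x y hr h).trans ?_
    gcongr
    exact logConstant_le hU hA ht
  · have h1 : 1 / 16 ≤ min (dist x y) (1 / 2) := le_min h (by norm_num)
    have h2 : min (dist x y) (1 / 2) < 1 := (min_le_right _ _).trans_lt (by norm_num)
    -- At distances of at least `1/16` no regularity is needed: `4 log 2 ≤ 4` bounds the root by
    -- `2`, and the trivial estimate `2A` suffices.
    have h3 : √(-Real.log (min (dist x y) (1 / 2))) ≤ 2 := by
      refine Real.sqrt_le_iff.2 ⟨by norm_num, ?_⟩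
      have h4 := Real.log_le_log (by norm_num) h1
      have h5 : Real.log (1 / 16) = -(4 * Real.log 2) := by
        rw [one_div, Real.log_inv, show (16 : ℝ) = 2 ^ 4 by norm_num, Real.log_pow]
        norm_num
      have := Real.log_two_lt_d9
      linarith
    rw [le_div_iff₀ (Real.sqrt_pos.2 (neg_log_pos (by linarith) h2))]
    have h4 : |θ x - θ y| ≤ 2 * A := by
      have := abs_sub (θ x) (θ y)
      linarith [hθ x, hθ y]
    have h5 : 0 ≤ A * U := by positivity
    have h6 : 0 ≤ A * (1 + U) * (1 / t) := by positivity
    calc _ ≤ 2 * A * 2 := mul_le_mul h4 h3 (Real.sqrt_nonneg _) (by positivity)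
      _ ≤ _ := by linarith

theorem exists_solution {u : Plane → Plane} (hu : LocallyIntegrable u)
    (hU : uniformLocL1Norm u < ⊤) (hdiv : IsDivFree u) (h2 : MemC2 θ₀) (h4 : MemW41 θ₀)
    (hA : 0 < c2w41Norm θ₀) :
    ∃ θ : ℝ → Plane → ℝ, IsDistributionalSolution u θ₀ θ ∧
      ContinuousOn (fun p : ℝ × Plane => θ p.1 p.2) (Ioi (0 : ℝ) ×ˢ (univ : Set Plane)) ∧
      ∀ t, 0 < t → ∀ x y, |θ t x - θ t y| ≤
        20000 * (1 + (uniformLocL1Norm u).toReal) * c2w41Norm θ₀ * (1 + 1 / t) /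
          √(-Real.log (min (dist x y) (1 / 2))) := by
  have hU0 : 0 ≤ (uniformLocL1Norm u).toReal := ENNReal.toReal_nonneg
  set ε : ℕ → ℝ := fun n => 1 / ((n : ℝ) + 1) with hεdef
  have hε : Tendsto ε atTop (𝓝 0) := tendsto_one_div_add_atTop_nhds_zero_nat
  have hε0 : ∀ n, 0 < ε n := fun n => by positivity
  have hε1 : ∀ n, ε n ≤ 1 := fun n => by
    rw [hεdef]
    exact (div_le_one (by positivity)).2 (by linarith [Nat.cast_nonneg (α := ℝ) n])
  choose η hη using fun n => exists_isMollifier (hε0 n)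
  have D := fun n =>
    (exists_latticeScheme (hη n) (hε0 n) (hε1 n) hu hU hdiv h2 h4 hA).some
  obtain ⟨φ, G, hφ, hGc, hG, -⟩ := exists_subseq_tendsto_continuousOn
    (isOpen_Ioi.prod isOpen_univ : IsOpen (Ioi (0 : ℝ) ×ˢ (univ : Set Plane)))
    (F := fun n s => (D n).sol s.1 s.2) (fun n s hs => (D n).abs_sol_le (le_of_lt hs.1) _)
    fun s hs δ hδ => eventually_abs_sol_sub_le hε D hU0 hs.1 s.2 hδ
  have hεφ : Tendsto (fun n => ε (φ n)) atTop (𝓝 0) := hε.comp hφ.tendsto_atTop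
  have hlim : ∀ t > 0, ∀ x, Tendsto (fun n => (D (φ n)).sol t x) atTop (𝓝 (G (t, x))) :=
    fun t ht x => hG (t, x) ⟨ht, mem_univ _⟩
  have hGA : ∀ t > 0, ∀ x, |G (t, x)| ≤ c2w41Norm θ₀ := fun t ht x =>
    le_of_tendsto (hlim t ht x).abs (Eventually.of_forall fun n => (D _).abs_sol_le (le_of_lt ht) _)
  refine ⟨fun t x => G (t, x), ⟨?_, fun ψ hψ hψc => ?_⟩, hGc, fun t ht => ?_⟩
  · refine memLp_top_of_bound (hGc.aestronglyMeasurable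
      (measurableSet_Ioi.prod MeasurableSet.univ)) (c2w41Norm θ₀) ?_
    filter_upwards [ae_restrict_mem (measurableSet_Ioi.prod MeasurableSet.univ)] with s hs
    exact hGA s.1 hs.1 s.2
  · exact integral_eq_of_tendsto_sol hεφ (fun n => hη (φ n)) (fun n => D (φ n)) hu
      h2.1.continuous hlim ⟨hψ, hψc⟩
  · exact abs_sub_le_log hU0 hA.le ht (hGA t ht) fun x y hxy hxy' =>
      abs_sub_le_of_tendsto_sol hεφ (fun n => D (φ n)) hU0 ht (hlim t ht) hxy hxy'

theorem isDistributionalSolution_zero (u : Plane → Plane) :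
    IsDistributionalSolution u (fun _ => 0) fun _ _ => 0 where
  memLp_top := by simp
  integral_eq φ _ _ := by simp

end Main

theorem theoremt :
    ∃ C : ℝ, 0 < C ∧
      ∀ (u : Plane → Plane) (θ₀ : Plane → ℝ),
        LocallyIntegrable u → uniformLocL1Norm u < ⊤ → IsDivFree u →
        MemC2 θ₀ → MemW41 θ₀ →
        ∃ θ : ℝ → Plane → ℝ,
          IsDistributionalSolution u θ₀ θ ∧
          ContinuousOn (fun p : ℝ × Plane => θ p.1 p.2) (Ioi (0 : ℝ) ×ˢ (univ : Set Plane)) ∧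
          ∀ t : ℝ, 0 < t →
            ∃ ρ : ℝ → ℝ, IsModulusOfContinuity ρ ∧
              (∀ r ∈ Ioo (0 : ℝ) (1 / 2),
                ρ r = C * (1 + (uniformLocL1Norm u).toReal) * c2w41Norm θ₀ * (1 + 1 / t)
                  / Real.sqrt (-Real.log r)) ∧
              SatisfiesModulusAt θ ρ t := by
  refine ⟨20000, by norm_num, fun u θ₀ hu hU hdiv h2 h4 => ?_⟩
  have hU0 : 0 ≤ (uniformLocL1Norm u).toReal := ENNReal.toReal_nonneg
  have hA0 : 0 ≤ c2w41Norm θ₀ := ENNReal.toReal_nonneg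
  suffices h : ∃ θ : ℝ → Plane → ℝ, IsDistributionalSolution u θ₀ θ ∧
      ContinuousOn (fun p : ℝ × Plane => θ p.1 p.2) (Ioi (0 : ℝ) ×ˢ (univ : Set Plane)) ∧
      ∀ t, 0 < t → ∀ x y, |θ t x - θ t y| ≤
        20000 * (1 + (uniformLocL1Norm u).toReal) * c2w41Norm θ₀ * (1 + 1 / t) /
          √(-Real.log (min (dist x y) (1 / 2))) by
    obtain ⟨θ, h1, h3, h5⟩ := h
    refine ⟨θ, h1, h3, fun t ht => ⟨_, isModulusOfContinuity_log (K := 20000 *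
      (1 + (uniformLocL1Norm u).toReal) * c2w41Norm θ₀ * (1 + 1 / t)) (by positivity),
      fun r hr => ?_, h5 t ht⟩⟩
    simp only [min_eq_left hr.2.le]
  -- The approximation scheme requires a positive norm of the initial value. If the norm vanishes,
  -- so does `θ₀`, and the zero function is a solution.
  rcases hA0.eq_or_lt with hA | hA
  · have hz : θ₀ = fun _ => 0 := by
      funext x
      have := abs_le_c2w41Norm h2 h4 x
      rw [← hA] at this
      exact abs_nonpos_iff.1 this
    refine ⟨fun _ _ => 0, ?_, continuousOn_const, fun t ht x y => ?_⟩
    · rw [hz]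
      exact isDistributionalSolution_zero u
    · rw [← hA]
      simp
  · exact exists_solution hu hU hdiv h2 h4 hA
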